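/- Let $\mathcal T$ be a triple crossing diagram (TCD): a collection of oriented arcs (with distinct endpoints on the boundary) and loops immersed in a closed disk, considered up to isotopy, such that exactly three strands cross at each intersection point and the orientations of the strands induce consistent orientations of the faces. Assume that $\mathcal T$ is minimal: no strand is a loop, no strand intersects itself, and no two strands form a parallel bigon (two strands through two distinct crossings $x,y$, both running from $x$ to $y$). Let $G$ be the associated black-trivalent bipartite graph: its set $W$ of white vertices is the set of clockwise faces of $\mathcal T$, its set $B$ of black vertices is the set of triple crossings, and each crossing is joined to the three clockwise faces adjacent to it. Put $\operatorname{mrank}(\mathcal T)=|W|-|B|-1$. A TCD map of rank $d$ is a map $T: W\to\mathbb{CP}^d$ whose image spans $\mathbb{CP}^d$ and such that for every $b\in B$ the images of the three white neighbours of $b$ are distinct and collinear. The set of these maps is a subset of $(\mathbb{CP}^d)^W$, and $\mathrm{Moduli}(\mathcal T,d)$ is its quotient by the action of $\mathrm{PGL}(d+1,\mathbb C)$, with the quotient of the Zariski topology and with those functions regular that pull back to regular functions on the set of TCD maps. Let $1\le d\le \operatorname{mrank}(\mathcal T)$ and $$D=(d-1)(\operatorname{mrank}(\mathcal T)+1)-(d+1)^2+1+|W|.$$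 1. If $G$ is connected, then $\mathrm{Moduli}(\mathcal T,d)$ is a (non-empty, irreducible, separated) complex algebraic variety of dimension $D$. 2. If $d<\operatorname{mrank}(\mathcal T)$, then, whether or not $G$ is connected, $\mathrm{Moduli}(\mathcal T,d)$ has a dense open subset that is a (non-empty, irreducible, separated) complex algebraic variety of dimension $D$. -/

import Mathlib

open Topology

noncomputable section

/-! ### Spaces with functions and classical complex varieties -/

/-- A complex *space with functions*: a topological space with a sheaf of `ℂ`-algebras of
complex-valued functions. `IsRegular U f` says that the restriction of `f` to the open set `U` is a
section over `U`; the values of `f` outside `U` are irrelevant. -/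
structure SpaceWithFunctions (X : Type*) where
  top : TopologicalSpace X
  IsRegular : Set X → (X → ℂ) → Prop
  congr : ∀ {U : Set X} {f g : X → ℂ}, Set.EqOn f g U → IsRegular U f → IsRegular U g
  restrict : ∀ {U V : Set X} {f : X → ℂ}, V ⊆ U → IsRegular U f → IsRegular V f
  locality : ∀ {U : Set X} {f : X → ℂ},
    (∀ x ∈ U, ∃ V : Set X, IsOpen[top] V ∧ x ∈ V ∧ IsRegular (V ∩ U) f) → IsRegular U f
  const : ∀ (U : Set X) (c : ℂ), IsRegular U (fun _ => c)
  add : ∀ {U : Set X} {f g : X → ℂ}, IsRegular U f → IsRegular U g → IsRegular U (f + g)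
  mul : ∀ {U : Set X} {f g : X → ℂ}, IsRegular U f → IsRegular U g → IsRegular U (f * g)

namespace SpaceWithFunctions

variable {X Y : Type*}

/-- Morphisms: continuous maps along which regular functions pull back to regular functions. -/
def IsMorphism (O : SpaceWithFunctions X) (P : SpaceWithFunctions Y) (φ : X → Y) : Prop :=
  (∀ V : Set Y, IsOpen[P.top] V → IsOpen[O.top] (φ ⁻¹' V)) ∧
    ∀ (V : Set Y) (f : Y → ℂ), IsOpen[P.top] V → P.IsRegular V f → O.IsRegular (φ ⁻¹' V) (f ∘ φ)

/-- Two spaces with functions are isomorphic. -/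
def Isomorphic (O : SpaceWithFunctions X) (P : SpaceWithFunctions Y) : Prop :=
  ∃ e : X ≃ Y, IsMorphism O P e ∧ IsMorphism P O e.symm

/-- The structure induced on a subset: the subspace topology, and functions that locally are
restrictions of regular functions of the ambient space. -/
def sub (O : SpaceWithFunctions X) (S : Set X) : SpaceWithFunctions S where
  top := TopologicalSpace.induced Subtype.val O.top
  IsRegular U f := ∀ x ∈ U, ∃ (V : Set X) (g : X → ℂ), IsOpen[O.top] V ∧ (x : X) ∈ V ∧
    O.IsRegular V g ∧ ∀ y ∈ U, (y : X) ∈ V → f y = g y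
  congr h hf x hx := by
    obtain ⟨V, g, hV, hxV, hg, e⟩ := hf x hx
    exact ⟨V, g, hV, hxV, hg, fun y hy hyV => by rw [← h hy, e y hy hyV]⟩
  restrict h hf x hx := by
    obtain ⟨V, g, hV, hxV, hg, e⟩ := hf x (h hx)
    exact ⟨V, g, hV, hxV, hg, fun y hy hyV => e y (h hy) hyV⟩
  locality h x hx := by
    let := O.top
    obtain ⟨V', hV', hxV', hf⟩ := h x hx
    obtain ⟨T, hT, rfl⟩ := hV'
    obtain ⟨V, g, hV, hxV, hg, e⟩ := hf x ⟨hxV', hx⟩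
    exact ⟨V ∩ T, g, hV.inter hT, ⟨hxV, hxV'⟩, O.restrict Set.inter_subset_left hg,
      fun y hy hyV => e y ⟨hyV.2, hy⟩ hyV.1⟩
  const U c x _ := ⟨Set.univ, fun _ => c, @isOpen_univ _ O.top, trivial, O.const _ _,
    fun _ _ _ => rfl⟩
  add hf hg x hx := by
    let := O.top
    obtain ⟨V, a, hV, hxV, ha, e⟩ := hf x hx
    obtain ⟨V', a', hV', hxV', ha', e'⟩ := hg x hx
    exact ⟨V ∩ V', a + a', hV.inter hV', ⟨hxV, hxV'⟩,
      O.add (O.restrict Set.inter_subset_left ha) (O.restrict Set.inter_subset_right ha'),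
      fun y hy hyV => by simp [e y hy hyV.1, e' y hy hyV.2]⟩
  mul hf hg x hx := by
    let := O.top
    obtain ⟨V, a, hV, hxV, ha, e⟩ := hf x hx
    obtain ⟨V', a', hV', hxV', ha', e'⟩ := hg x hx
    exact ⟨V ∩ V', a * a', hV.inter hV', ⟨hxV, hxV'⟩,
      O.mul (O.restrict Set.inter_subset_left ha) (O.restrict Set.inter_subset_right ha'),
      fun y hy hyV => by simp [e y hy hyV.1, e' y hy hyV.2]⟩

/-- The quotient structure along a map `π` (used for surjective `π`): the quotient topology, and
functions that pull back to regular functions. -/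
def quot (O : SpaceWithFunctions X) (π : X → Y) : SpaceWithFunctions Y where
  top := TopologicalSpace.coinduced π O.top
  IsRegular U f := O.IsRegular (π ⁻¹' U) (f ∘ π)
  congr h hf := O.congr (fun _ hx => h hx) hf
  restrict h hf := O.restrict (Set.preimage_mono h) hf
  locality h := O.locality fun x hx => by
    obtain ⟨V, hV, hxV, hf⟩ := h (π x) hx
    exact ⟨π ⁻¹' V, hV, hxV, hf⟩
  const U c := O.const _ c
  add hf hg := O.add hf hg
  mul hf hg := O.mul hf hg

/-- The Zariski topology on `ℂ^ι`, induced by sending a point to the prime ideal of polynomials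
vanishing there. -/
abbrev zariski (ι : Type*) : TopologicalSpace (ι → ℂ) :=
  TopologicalSpace.induced (MvPolynomial.pointToPoint (k := ℂ) (K := ℂ)) inferInstance

/-- The Zariski closed sets are the common zero sets of polynomials. -/
theorem isClosed_zariski_iff {ι : Type*} (Z : Set (ι → ℂ)) :
    IsClosed[zariski ι] Z ↔
      ∃ S : Set (MvPolynomial ι ℂ), Z = {x | ∀ p ∈ S, MvPolynomial.eval x p = 0} := by
  have key : ∀ S : Set (MvPolynomial ι ℂ),
      (MvPolynomial.pointToPoint (k := ℂ) (K := ℂ)) ⁻¹' PrimeSpectrum.zeroLocus S =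
        {x : ι → ℂ | ∀ p ∈ S, MvPolynomial.eval x p = 0} := by
    intro S
    ext x
    simp only [Set.mem_preimage, PrimeSpectrum.mem_zeroLocus, Set.mem_ofPred_eq,
      MvPolynomial.pointToPoint]
    refine forall₂_congr fun p _ => ?_
    simp only [SetLike.mem_coe]
    rw [MvPolynomial.mem_vanishingIdeal_singleton_iff, MvPolynomial.aeval_eq_eval]
  unfold zariski
  rw [isClosed_induced_iff]
  constructor
  · rintro ⟨t, ht, rfl⟩
    obtain ⟨S, rfl⟩ := (PrimeSpectrum.isClosed_iff_zeroLocus t).1 ht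
    exact ⟨S, key S⟩
  · rintro ⟨S, rfl⟩
    exact ⟨_, PrimeSpectrum.isClosed_zeroLocus S, key S⟩

/-- Affine space `ℂ^ι`: the Zariski topology, and functions that locally are quotients of
polynomials. -/
def affineSpace (ι : Type*) : SpaceWithFunctions (ι → ℂ) where
  top := zariski ι
  IsRegular U f := ∀ x ∈ U, ∃ p q : MvPolynomial ι ℂ, MvPolynomial.eval x q ≠ 0 ∧
    ∀ y ∈ U, MvPolynomial.eval y q ≠ 0 → f y = MvPolynomial.eval y p / MvPolynomial.eval y q
  congr h hf x hx := by
    obtain ⟨p, q, hq, e⟩ := hf x hx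
    exact ⟨p, q, hq, fun y hy hyq => by rw [← h hy, e y hy hyq]⟩
  restrict h hf x hx := by
    obtain ⟨p, q, hq, e⟩ := hf x (h hx)
    exact ⟨p, q, hq, fun y hy hyq => e y (h hy) hyq⟩
  locality h x hx := by
    obtain ⟨V, hV, hxV, hf⟩ := h x hx
    obtain ⟨p, q, hq, e⟩ := hf x ⟨hxV, hx⟩
    let := zariski ι
    obtain ⟨S, hS⟩ := (isClosed_zariski_iff Vᶜ).1 (isClosed_compl_iff.2 hV)
    have hx' : x ∉ Vᶜ := fun hc => hc hxV
    rw [hS] at hx'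
    simp only [Set.mem_ofPred_eq, not_forall] at hx'
    obtain ⟨r, hr, hrx⟩ := hx'
    refine ⟨p * r, q * r, by simp [hq, hrx], fun y hy hyq => ?_⟩
    rw [map_mul, mul_ne_zero_iff] at hyq
    have hyV : y ∈ V := by
      by_contra hc
      have hy' : y ∈ Vᶜ := hc
      rw [hS] at hy'
      exact hyq.2 (hy' r hr)
    rw [e y ⟨hyV, hy⟩ hyq.1, map_mul, map_mul, mul_div_mul_right _ _ hyq.2]
  const U c x _ := ⟨MvPolynomial.C c, 1, by simp, fun y _ _ => by simp⟩
  add hf hg x hx := by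
    obtain ⟨p, q, hq, e⟩ := hf x hx
    obtain ⟨p', q', hq', e'⟩ := hg x hx
    refine ⟨p * q' + q * p', q * q', by simp [hq, hq'], fun y hy hyq => ?_⟩
    rw [map_mul, mul_ne_zero_iff] at hyq
    simp only [Pi.add_apply, e y hy hyq.1, e' y hy hyq.2, map_add, map_mul]
    exact div_add_div _ _ hyq.1 hyq.2
  mul hf hg x hx := by
    obtain ⟨p, q, hq, e⟩ := hf x hx
    obtain ⟨p', q', hq', e'⟩ := hg x hx
    refine ⟨p * p', q * q', by simp [hq, hq'], fun y hy hyq => ?_⟩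
    rw [map_mul, mul_ne_zero_iff] at hyq
    simp only [Pi.mul_apply, e y hy hyq.1, e' y hy hyq.2, map_mul]
    exact div_mul_div_comm _ _ _ _

/-- Affine algebraic sets: isomorphic to a Zariski closed subset of some `ℂ^m`. -/
def IsAffine (O : SpaceWithFunctions X) : Prop :=
  ∃ (m : ℕ) (Z : Set (Fin m → ℂ)), IsClosed[zariski (Fin m)] Z ∧
    Isomorphic O ((affineSpace (Fin m)).sub Z)

/-- Separatedness: two morphisms from an affine algebraic set agree on a closed set. -/
def IsSeparated (O : SpaceWithFunctions X) : Prop :=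
  ∀ (m : ℕ) (Z : Set (Fin m → ℂ)), IsClosed[zariski (Fin m)] Z → ∀ φ ψ : Z → X,
    IsMorphism ((affineSpace (Fin m)).sub Z) O φ → IsMorphism ((affineSpace (Fin m)).sub Z) O ψ →
      IsClosed[((affineSpace (Fin m)).sub Z).top] {z | φ z = ψ z}

/-- A complex algebraic variety: irreducible (in particular non-empty), separated, and covered by
finitely many affine open subsets. -/
structure IsVariety (O : SpaceWithFunctions X) : Prop where
  irreducible : @IrreducibleSpace X O.top
  affine_cover : ∃ 𝒰 : Set (Set X), 𝒰.Finite ∧ ⋃₀ 𝒰 = Set.univ ∧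
    ∀ U ∈ 𝒰, IsOpen[O.top] U ∧ IsAffine (O.sub U)
  separated : IsSeparated O

/-- The dimension, as the Krull dimension of the underlying topological space. -/
def dim (O : SpaceWithFunctions X) : WithBot ℕ∞ := @topologicalKrullDim X O.top

/-- The product `(ℂP^d)^W`, as the quotient of `(ℂ^{d+1} ∖ 0)^W` by the rescalings of each factor.
-/
def projectivePower (W : Type*) (d : ℕ) :
    SpaceWithFunctions (W → Projectivization ℂ (Fin (d + 1) → ℂ)) :=
  ((affineSpace (W × Fin (d + 1))).sub {v | ∀ w, (fun i => v (w, i)) ≠ 0}).quot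
    fun v w => Projectivization.mk ℂ (fun i => v.1 (w, i)) (v.2 w)

end SpaceWithFunctions

/-! ### Triple crossing diagrams -/

/-- At a triple crossing `b` the six half-edges are, in clockwise order,
`out 0, in 0, out 1, in 1, out 2, in 2`; around the boundary of the disk the endpoints are, in
clockwise order, `sink 0, source 0, sink 1, source 1, …`. An element of `HalfEdge B n` stands both
for a beginning (`out i` at `b`, or a source) and for an end (`in i` at `b`, or a sink) of a strand
segment. -/
abbrev HalfEdge (B : Type*) (n : ℕ) : Type _ := (B × Fin 3) ⊕ Fin n

/-- The permutation `out i ↦ out (i+1)` at each crossing and `source j ↦ source (j-1)`. -/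
def turn (B : Type*) (n : ℕ) : Equiv.Perm (HalfEdge B n) :=
  Equiv.sumCongr (Equiv.prodCongr (Equiv.refl B) (finRotate 3)) (finRotate n).symm

/-- A triple crossing diagram in an oriented disk with set of triple crossings `B` and `n` arcs, up
to isotopy, encoded as a combinatorial map: `seg x` is the end of the strand segment that begins at
`x`. Walking along a segment with a face on the right and turning right at each crossing (at a sink,
following the boundary of the disk clockwise to the next source) leads from the segment beginning at
`x` to the one beginning at `seg x`, so the clockwise faces are the cycles of `seg`. Walking with a
face on the left leads to the segment beginning at `turn (seg x)`, so the counterclockwise faces are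
the cycles of `turn * seg`. The diagram together with the boundary circle is connected, and it lies
in a disk, which by Euler's formula (`|B| + 2n` vertices, `3|B| + 3n` edges, and one outer face) is
the condition `euler`. -/
structure TCD (B : Type*) [Fintype B] (n : ℕ) where
  seg : Equiv.Perm (HalfEdge B n)
  connected : ∀ x y : HalfEdge B n, ∃ g ∈ Subgroup.closure {seg, turn B n}, g x = y
  euler : Nat.card (Quotient (Equiv.Perm.SameCycle.setoid seg)) +
    Nat.card (Quotient (Equiv.Perm.SameCycle.setoid (turn B n * seg))) =
      2 * Fintype.card B + n + 1

namespace TCD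

variable {B : Type*} [Fintype B] {n : ℕ}

/-- The segment `y` directly follows the segment `x` on a strand: `x` ends at `in i` of a crossing
and `y` begins at the opposite half-edge, which is `out (i-1)`. -/
def Next (T : TCD B n) (x y : HalfEdge B n) : Prop :=
  ∃ (b : B) (i : Fin 3), T.seg x = Sum.inl (b, i) ∧ y = Sum.inl (b, i - 1)

/-- The segment `y` comes after the segment `x` on a strand. -/
def Follows (T : TCD B n) : HalfEdge B n → HalfEdge B n → Prop :=
  Relation.TransGen T.Next

/-- Minimal (reduced) diagrams: no closed strands, no self-intersecting strands, and no parallel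
bigons, i.e. no two strands through two crossings `b`, `b'` both running from `b` to `b'`. -/
structure IsMinimal (T : TCD B n) : Prop where
  no_loop : ∀ x, ¬ T.Follows x x
  no_self_intersection : ∀ (b : B) (i j : Fin 3), ¬ T.Follows (Sum.inl (b, i)) (Sum.inl (b, j))
  no_parallel_bigon : ∀ (b b' : B) (i j i' j' : Fin 3), b ≠ b' → i ≠ j →
    ¬ (T.Follows (Sum.inl (b, i)) (Sum.inl (b', i')) ∧
      T.Follows (Sum.inl (b, j)) (Sum.inl (b', j')))

/-- The white vertices of the black-trivalent bipartite graph: the clockwise faces. -/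
def W (T : TCD B n) : Type _ := Quotient (Equiv.Perm.SameCycle.setoid T.seg)

/-- The `i`-th white neighbour of the black vertex `b`: the clockwise face in the corner between
`in i` and `out i`. -/
def nbr (T : TCD B n) (b : B) (i : Fin 3) : T.W :=
  Quotient.mk (Equiv.Perm.SameCycle.setoid T.seg) (Sum.inl (b, i))

/-- The black-trivalent bipartite graph (its underlying simple graph). -/
def graph (T : TCD B n) : SimpleGraph (B ⊕ T.W) :=
  SimpleGraph.fromRel fun u v => ∃ (b : B) (i : Fin 3), u = Sum.inl b ∧ v = Sum.inr (T.nbr b i)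

/-- The maximal rank `|W| - |B| - 1`. -/
def mrank (T : TCD B n) : ℤ := Nat.card T.W - Fintype.card B - 1

/-- TCD maps: at each triple crossing the three points are distinct and lie on a line. -/
def IsTCDMap (T : TCD B n) {d : ℕ} (P : T.W → Projectivization ℂ (Fin (d + 1) → ℂ)) : Prop :=
  ∀ b : B, Function.Injective (fun i => P (T.nbr b i)) ∧
    Projectivization.IsCollinear (Set.range fun i => P (T.nbr b i))

/-- The rank of a family of points: the dimension of their projective span. -/
def rank (T : TCD B n) {d : ℕ} (P : T.W → Projectivization ℂ (Fin (d + 1) → ℂ)) : ℤ :=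
  (Module.finrank ℂ ↥(⨆ w, (P w).submodule) : ℤ) - 1

/-- The set of TCD maps of rank `d` in `ℂP^d`. -/
def maps (T : TCD B n) (d : ℕ) : Set (T.W → Projectivization ℂ (Fin (d + 1) → ℂ)) :=
  {P | T.IsTCDMap P ∧ T.rank P = d}

/-- `Moduli(T, d)`: TCD maps of rank `d` modulo `PGL(d+1)`. -/
def Moduli (T : TCD B n) (d : ℕ) : Type _ :=
  Quotient (Setoid.comap (Subtype.val : T.maps d → _)
    (MulAction.orbitRel (Matrix.ProjGenLinGroup (Fin (d + 1)) ℂ)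
      (T.W → Projectivization ℂ (Fin (d + 1) → ℂ))))

/-- The structure of space with functions on `Moduli(T, d)`: the quotient by `PGL(d+1)` of the
subspace of TCD maps in `(ℂP^d)^W`. -/
def moduli (T : TCD B n) (d : ℕ) : SpaceWithFunctions (T.Moduli d) :=
  ((SpaceWithFunctions.projectivePower T.W d).sub (T.maps d)).quot (Quotient.mk _)

end TCD

end

noncomputable section

namespace TCD

variable {B : Type*} [Fintype B] {n : ℕ} {T : TCD B n}

/-! ### Strands -/

/-! The combinatorial core is an acyclic matching: every crossing `b` gets an adjacent clockwise
face of its own, and the faces are ranked so that the other two neighbours of `b` lie below it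
(`IsMinimal.exists_acyclic_matching`). Representing points by vectors, each collinearity then
expresses the matched vector through two earlier ones with non-zero coefficients. The vectors at the
`|W| - |B| = mrank + 1` unmatched faces and two coefficients per crossing are free parameters, and
the TCD maps of rank `d` correspond to a Zariski open set `good` of parameters, up to rescaling the
vectors and applying `GL(d+1)`.

The matching comes from the sinks of the strands. On a disk every conserved flow has a height
function on the faces (`IsMinimal.exists_height`, an Euler characteristic count). Applied mod 3 to
the three strands leaving `b`, this shows that they end in clockwise order
(`IsMinimal.sink_cyclic`), so that exactly one corner of `b` is a descent of sink labels; its face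
is matched with `b`. By Euler's formula every clockwise face carries exactly one weak descent,
located at its largest label (`IsMinimal.max_of_descent`). This gives injectivity, and together with
height functions of single strands it excludes infinite dependence chains
(`IsMinimal.wellFounded_dependence`).

For the quotient, a frame of `d + 1` free vectors removes `GL(d+1)`. In the resulting coordinates
the torus of rescalings acts on each parameter by a character `μ(src)/μ(dst)`, so a spanning tree of
parameters can be normalized to `1`. The remaining scalars act trivially, and each class in the
domain has one normal form in a coordinate slice (`Gauge.exists_chart`). The slice has `(mrank +
1)(d + 1) + 2|B| - (d + 1)² - (|W| - 1)` coordinates, which is `D`.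

If `G` is connected, the tree can be chosen among the coefficients, which never vanish, so the
charts of all frames cover the quotient; equality of classes in two charts is given by bilinear
equations, whence separatedness (`Tree.isVariety_quot`). If `d < mrank`, a projective frame of `d +
2` free vectors supplies a tree without connectedness, and its single chart is dense by
irreducibility (`Gauge.exists_dense_variety`). -/

theorem next_of_seg_eq {x : HalfEdge B n} {b : B} {i : Fin 3} (h : T.seg x = Sum.inl (b, i)) :
    T.Next x (Sum.inl (b, i - 1)) := ⟨b, i, h, rfl⟩

theorem next_symm (T : TCD B n) (b : B) (i : Fin 3) :
    T.Next (T.seg.symm (Sum.inl (b, i))) (Sum.inl (b, i - 1)) := next_of_seg_eq (by simp)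

theorem next_inl_iff {x : HalfEdge B n} {b : B} {i : Fin 3} :
    T.Next x (Sum.inl (b, i - 1)) ↔ x = T.seg.symm (Sum.inl (b, i)) := by
  constructor
  · rintro ⟨c, j, h, e⟩
    simp only [Sum.inl.injEq, Prod.mk.injEq] at e
    obtain ⟨rfl, e⟩ := e
    obtain rfl : i = j := sub_left_injective e
    rw [← h, Equiv.symm_apply_apply]
  · rintro rfl
    exact T.next_symm b i

theorem Next.right_unique {x y z : HalfEdge B n} (h : T.Next x y) (h' : T.Next x z) : y = z := by
  obtain ⟨b, i, e, rfl⟩ := h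
  obtain ⟨c, j, e', rfl⟩ := h'
  rw [e] at e'
  simp only [Sum.inl.injEq, Prod.mk.injEq] at e'
  rw [e'.1, e'.2]

/-- The strand that begins at `x`, as a relation between beginnings of segments. -/
def Ray (T : TCD B n) : HalfEdge B n → HalfEdge B n → Prop :=
  Relation.ReflTransGen T.Next

theorem Ray.total {x y z : HalfEdge B n} (h : T.Ray x y) (h' : T.Ray x z) :
    T.Ray y z ∨ T.Ray z y :=
  Relation.ReflTransGen.total_of_right_unique (fun _ _ _ a b => a.right_unique b) h h'

theorem ray_pred {x : HalfEdge B n} {c : B} {j : Fin 3} :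
    T.Ray x (Sum.inl (c, j - 1)) ↔
      Sum.inl (c, j - 1) = x ∨ T.Ray x (T.seg.symm (Sum.inl (c, j))) := by
  unfold Ray
  rw [Relation.ReflTransGen.cases_tail_iff]
  refine or_congr Iff.rfl ⟨?_, fun h => ⟨_, h, T.next_symm c j⟩⟩
  rintro ⟨z, h, hz⟩
  rwa [← next_inl_iff.1 hz]

theorem IsMinimal.wellFounded_follows (hT : T.IsMinimal) :
    WellFounded (fun y x => T.Follows x y) := by
  have : IsTrans (HalfEdge B n) (fun y x => T.Follows x y) := ⟨fun _ _ _ h h' => h'.trans h⟩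
  have : Std.Irrefl (fun y x : HalfEdge B n => T.Follows x y) := ⟨hT.no_loop⟩
  exact Finite.wellFounded_of_trans_of_irrefl _

theorem IsMinimal.exists_end (hT : T.IsMinimal) (x : HalfEdge B n) :
    ∃ y j, T.Ray x y ∧ T.seg y = Sum.inr j := by
  induction x using hT.wellFounded_follows.induction with
  | _ x ih =>
    rcases e : T.seg x with ⟨b, i⟩ | j
    · have h := next_of_seg_eq e
      obtain ⟨y, j, hy, hj⟩ := ih _ (.single h)
      exact ⟨y, j, .head h hy, hj⟩
    · exact ⟨x, j, .refl, e⟩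

/-- Minimality in the form used below: allowing `c = b` and one trivial arc merges the conditions on
self-intersections and on parallel bigons. -/
theorem IsMinimal.not_ray_of_follows (hT : T.IsMinimal) {b c : B} {i j i' j' : Fin 3} (hij : i ≠ j)
    (h : T.Follows (Sum.inl (b, i)) (Sum.inl (c, i'))) :
    ¬ T.Ray (Sum.inl (b, j)) (Sum.inl (c, j')) := by
  intro h'
  rcases Relation.reflTransGen_iff_eq_or_transGen.1 h' with h' | h'
  · simp only [Sum.inl.injEq, Prod.mk.injEq] at h'
    obtain ⟨rfl, rfl⟩ := h'
    exact hT.no_self_intersection _ _ _ h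
  · rcases eq_or_ne b c with rfl | hbc
    · exact hT.no_self_intersection _ _ _ h
    · exact hT.no_parallel_bigon b c i j i' j' hbc hij ⟨h, h'⟩

/-- Distinct strands that leave a crossing have no segment in common. -/
theorem IsMinimal.ray_disjoint (hT : T.IsMinimal) {b : B} {i j : Fin 3} {x : HalfEdge B n}
    (h : T.Ray (Sum.inl (b, i)) x) (h' : T.Ray (Sum.inl (b, j)) x) : i = j := by
  by_contra hij
  rcases Relation.reflTransGen_iff_eq_or_transGen.1 h with rfl | h
  · rcases Relation.reflTransGen_iff_eq_or_transGen.1 h' with h' | h'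
    · simp only [Sum.inl.injEq, Prod.mk.injEq, true_and] at h'
      exact hij h'
    · exact hT.no_self_intersection _ _ _ h'
  · obtain ⟨z, -, c, k, -, rfl⟩ := Relation.TransGen.tail'_iff.1 h
    exact hT.not_ray_of_follows hij h h'

/-- `t x` is the endpoint of the strand through the segment `x`. -/
structure IsSink (T : TCD B n) (t : HalfEdge B n → Fin n) : Prop where
  inr : ∀ {x j}, T.seg x = Sum.inr j → t x = j
  inl : ∀ {x b i}, T.seg x = Sum.inl (b, i) → t x = t (Sum.inl (b, i - 1))

theorem IsSink.ray {t : HalfEdge B n → Fin n} (ht : T.IsSink t) {x y : HalfEdge B n}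
    (h : T.Ray x y) : t x = t y := by
  induction h with
  | refl => rfl
  | tail _ h ih =>
    obtain ⟨b, i, e, rfl⟩ := h
    rw [ih, ht.inl e]

theorem IsMinimal.exists_isSink (hT : T.IsMinimal) : ∃ t, T.IsSink t := by
  choose f t hf ht using hT.exists_end
  have key : ∀ {x y}, T.Ray x y → t x = t y := by
    intro x y h
    have last : ∀ {y z j}, T.seg y = Sum.inr j → T.Ray y z → y = z := by
      intro y z j e h
      rcases Relation.ReflTransGen.cases_head h with h | ⟨w, ⟨b, i, e', -⟩, -⟩
      · exact h
      · rw [e] at e'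
        exact absurd e' (by simp)
    have : f x = f y := by
      rcases (hf x).total (h.trans (hf y)) with h | h
      · exact last (ht x) h
      · exact (last (ht y) h).symm
    have h1 := ht x
    rw [this, ht y] at h1
    exact (Sum.inr_injective h1).symm
  refine ⟨t, fun {x j} e => ?_, fun e => key (.single (next_of_seg_eq e))⟩
  rcases Relation.ReflTransGen.cases_head (hf x) with h | ⟨w, ⟨b, i, e', -⟩, -⟩
  · have := ht x
    rw [← h, e] at this
    exact (Sum.inr_injective this).symm
  · rw [e] at e'
    exact absurd e' (by simp)

open Classical in
/-- The flow along a strand is conserved at all crossings but the one where the strand begins. -/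
theorem IsMinimal.sum_ray (hT : T.IsMinimal) (R : Type*) [CommRing R] (b : B) (i : Fin 3) (c : B) :
    ∑ j, (if T.Ray (Sum.inl (b, i)) (Sum.inl (c, j)) then (1 : R) else 0) =
      ∑ j, (if T.Ray (Sum.inl (b, i)) (T.seg.symm (Sum.inl (c, j))) then (1 : R) else 0) +
        if c = b then 1 else 0 := by
  -- Reindexed so that the opposite half-edges `in j` and `out (j - 1)` are compared; they are
  -- either both on the ray or both off it, except where the ray starts.
  rw [← (Equiv.subRight (1 : Fin 3)).sum_comp]
  have h1 : ∀ j : Fin 3, (if T.Ray (Sum.inl (b, i)) (Sum.inl (c, j - 1)) then (1 : R) else 0) =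
      (if T.Ray (Sum.inl (b, i)) (T.seg.symm (Sum.inl (c, j))) then (1 : R) else 0) +
        if c = b ∧ j = i + 1 then 1 else 0 := by
    intro j
    by_cases h : c = b ∧ j = i + 1
    · obtain ⟨rfl, rfl⟩ := h
      have h2 : ¬ T.Ray (Sum.inl (c, i)) (T.seg.symm (Sum.inl (c, i + 1))) := fun h =>
        hT.no_loop _ (.tail' h (by simpa using T.next_symm c (i + 1)))
      have h3 : T.Ray (Sum.inl (c, i)) (Sum.inl (c, i)) := .refl
      simp [h2, h3]
    · have h' : ¬ (Sum.inl (c, j - 1) : HalfEdge B n) = Sum.inl (b, i) := by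
        simp only [Sum.inl.injEq, Prod.mk.injEq]
        exact fun h' => h ⟨h'.1, by rw [← h'.2]; simp⟩
      simp [h, ray_pred, h']
  simp only [Equiv.subRight_apply, h1, Finset.sum_add_distrib]
  congr 1
  by_cases h : c = b <;> simp [h]

/-! ### Faces and height functions -/

/-- The counterclockwise faces. -/
def CcwFace (T : TCD B n) : Type _ := Quotient (Equiv.Perm.SameCycle.setoid (turn B n * T.seg))

/-- The clockwise face to the right of a segment. -/
def cw (T : TCD B n) (x : HalfEdge B n) : T.W := Quotient.mk (Equiv.Perm.SameCycle.setoid T.seg) x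

/-- The counterclockwise face to the left of a segment. -/
def ccw (T : TCD B n) (x : HalfEdge B n) : T.CcwFace :=
  Quotient.mk (Equiv.Perm.SameCycle.setoid (turn B n * T.seg)) x

instance : Finite T.W := inferInstanceAs (Finite (Quotient _))
instance : Finite T.CcwFace := inferInstanceAs (Finite (Quotient _))

theorem cw_surjective (T : TCD B n) : Function.Surjective T.cw := Quotient.mk_surjective
theorem ccw_surjective (T : TCD B n) : Function.Surjective T.ccw := Quotient.mk_surjective

theorem cw_eq_iff {x y : HalfEdge B n} : T.cw x = T.cw y ↔ T.seg.SameCycle x y := Quotient.eq''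
theorem ccw_eq_iff {x y : HalfEdge B n} :
    T.ccw x = T.ccw y ↔ (turn B n * T.seg).SameCycle x y := Quotient.eq''

theorem cw_seg (T : TCD B n) (x : HalfEdge B n) : T.cw (T.seg x) = T.cw x :=
  cw_eq_iff.2 (Equiv.Perm.sameCycle_apply_left.2 (Equiv.Perm.SameCycle.refl _ _))

theorem ccw_turn_seg (T : TCD B n) (x : HalfEdge B n) : T.ccw (turn B n (T.seg x)) = T.ccw x :=
  ccw_eq_iff.2 (Equiv.Perm.sameCycle_apply_left (f := turn B n * T.seg).2
    (Equiv.Perm.SameCycle.refl _ _))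

theorem turn_inl (b : B) (i : Fin 3) :
    turn B n (Sum.inl (b, i)) = Sum.inl (b, i + 1) := by
  simp [turn]

theorem cw_symm (T : TCD B n) (x : HalfEdge B n) : T.cw (T.seg.symm x) = T.cw x := by
  rw [← T.cw_seg, Equiv.apply_symm_apply]

theorem ccw_symm (T : TCD B n) (b : B) (i : Fin 3) :
    T.ccw (T.seg.symm (Sum.inl (b, i))) = T.ccw (Sum.inl (b, i + 1)) := by
  rw [← T.ccw_turn_seg, Equiv.apply_symm_apply, turn_inl]

theorem nbr_eq (T : TCD B n) (b : B) (i : Fin 3) : T.nbr b i = T.cw (Sum.inl (b, i)) := rfl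

/-- A function that is invariant under `seg` and `turn` is constant. -/
theorem eq_of_invariant {X : Type*} (T : TCD B n) (f : HalfEdge B n → X)
    (h1 : ∀ x, f (T.seg x) = f x) (h2 : ∀ x, f (turn B n x) = f x) (x y : HalfEdge B n) :
    f x = f y := by
  obtain ⟨g, hg, rfl⟩ := T.connected x y
  suffices ∀ x, f (g x) = f x from (this x).symm
  induction hg using Subgroup.closure_induction with
  | mem g hg =>
    rcases hg with rfl | rfl
    · exact h1
    · exact h2
  | one => simp
  | mul g h _ _ hg hh => intro x; rw [Equiv.Perm.mul_apply, hg, hh]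
  | inv g _ hg => intro x; rw [← hg, ← Equiv.Perm.mul_apply, mul_inv_cancel, Equiv.Perm.one_apply]

variable (k : Type*) [Field k]

/-- The differences of a function on the faces across the segments. -/
def coboundary (T : TCD B n) : ((T.W → k) × (T.CcwFace → k)) →ₗ[k] (HalfEdge B n → k) where
  toFun H x := H.2 (T.ccw x) - H.1 (T.cw x)
  map_add' _ _ := by ext; simp; ring
  map_smul' _ _ := by ext; simp; ring

/-- The failure of a flow to be conserved at the crossings. -/
def divergence (T : TCD B n) : (HalfEdge B n → k) →ₗ[k] (B → k) where
  toFun α b := ∑ i, α (Sum.inl (b, i)) - ∑ i, α (T.seg.symm (Sum.inl (b, i)))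
  map_add' _ _ := by ext; simp [Finset.sum_add_distrib]; ring
  map_smul' _ _ := by ext; simp [Finset.mul_sum, mul_sub]

/-- Each corner at a crossing lies between one incoming and one outgoing half-edge, so every face
value occurs once with each sign. -/
theorem divergence_coboundary (T : TCD B n) (H : (T.W → k) × (T.CcwFace → k)) :
    T.divergence k (T.coboundary k H) = 0 := by
  ext b
  simp only [divergence, coboundary, LinearMap.coe_mk, AddHom.coe_mk, cw_symm, ccw_symm,
    Finset.sum_sub_distrib, Pi.zero_apply]
  have := Equiv.sum_comp (Equiv.addRight (1 : Fin 3)) (fun i => H.2 (T.ccw (Sum.inl (b, i))))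
  simp only [Equiv.coe_addRight] at this
  rw [this]
  ring

/-- The unit flow along the strand that leaves `b` by `out 0` has divergence `1` at `b` and `0` at
all other crossings. -/
theorem IsMinimal.divergence_surjective (hT : T.IsMinimal) :
    LinearMap.range (T.divergence k) = ⊤ := by
  classical
  rw [LinearMap.range_eq_top]
  intro v
  refine ⟨∑ b, v b • fun x => if T.Ray (Sum.inl (b, 0)) x then 1 else 0, ?_⟩
  rw [map_sum]
  ext c
  simp only [map_smul, Finset.sum_apply, Pi.smul_apply, smul_eq_mul]
  have : ∀ b, T.divergence k (fun x => if T.Ray (Sum.inl (b, 0)) x then 1 else 0) c =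
      if c = b then 1 else 0 := by
    intro b
    simp only [divergence, LinearMap.coe_mk, AddHom.coe_mk, hT.sum_ray k b 0 c]
    ring
  simp [this]

/-- A function without jumps across segments is invariant under `seg` and `turn`, hence constant by
connectedness. -/
theorem finrank_ker_coboundary_le (T : TCD B n) :
    Module.finrank k (LinearMap.ker (T.coboundary k)) ≤ 1 := by
  have h0 : T.coboundary k (fun _ => 1, fun _ => 1) = 0 := by ext; simp [coboundary]
  refine finrank_le_one ⟨_, h0⟩ fun ⟨H, hH⟩ => ?_
  have h1 : ∀ x, H.2 (T.ccw x) = H.1 (T.cw x) := fun x => sub_eq_zero.1 (congrFun hH x)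
  have h2 := T.eq_of_invariant (fun x => H.1 (T.cw x)) (fun x => by rw [cw_seg])
    (fun x => by
      obtain ⟨y, rfl⟩ := T.seg.surjective x
      simp only [← h1, ccw_turn_seg]
      rw [h1, h1, cw_seg])
  rcases isEmpty_or_nonempty (HalfEdge B n) with h | ⟨⟨x⟩⟩
  · refine ⟨0, Subtype.ext (Prod.ext (funext fun w => ?_) (funext fun w => ?_))⟩
    · obtain ⟨x, -⟩ := T.cw_surjective w
      exact h.elim x
    · obtain ⟨x, -⟩ := T.ccw_surjective w
      exact h.elim x
  · refine ⟨H.1 (T.cw x), Subtype.ext (Prod.ext (funext fun w => ?_) (funext fun w => ?_))⟩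
    · obtain ⟨y, rfl⟩ := T.cw_surjective w
      simpa using h2 x y
    · obtain ⟨y, rfl⟩ := T.ccw_surjective w
      simpa [h1] using h2 x y

theorem card_halfEdge : Nat.card (HalfEdge B n) = 3 * Fintype.card B + n := by
  simp; ring

/-- Every conserved flow is the coboundary of a function on the faces. -/
theorem IsMinimal.exists_height (hT : T.IsMinimal) (α : HalfEdge B n → k)
    (hα : ∀ b, ∑ i, α (Sum.inl (b, i)) = ∑ i, α (T.seg.symm (Sum.inl (b, i)))) :
    ∃ (f : T.W → k) (g : T.CcwFace → k), ∀ x, g (T.ccw x) - f (T.cw x) = α x := by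
  have hle : LinearMap.range (T.coboundary k) ≤ LinearMap.ker (T.divergence k) := by
    rintro _ ⟨H, rfl⟩
    exact T.divergence_coboundary k H
  -- By Euler's formula the coboundaries have dimension at least `2|B| + n`, one less than the
  -- number of faces. The conserved flows have dimension `3|B| + n - |B|`, because the divergence is
  -- surjective. Hence the two spaces agree.
  have h1 := LinearMap.finrank_range_add_finrank_ker (T.coboundary k)
  have h2 := LinearMap.finrank_range_add_finrank_ker (T.divergence k)
  have h3 := T.finrank_ker_coboundary_le k
  have h4 := T.euler
  cases nonempty_fintype T.W
  cases nonempty_fintype T.CcwFace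
  rw [Module.finrank_prod, Module.finrank_fintype_fun_eq_card,
    Module.finrank_fintype_fun_eq_card, ← Nat.card_eq_fintype_card, ← Nat.card_eq_fintype_card] at h1
  rw [hT.divergence_surjective k, finrank_top, Module.finrank_fintype_fun_eq_card,
    Module.finrank_fintype_fun_eq_card, ← Nat.card_eq_fintype_card (α := HalfEdge B n),
    card_halfEdge] at h2
  change Nat.card T.W + Nat.card T.CcwFace = _ at h4
  have h5 := Submodule.eq_of_le_of_finrank_le hle (by omega)
  have h6 : α ∈ LinearMap.ker (T.divergence k) := by
    ext b
    simp [divergence, hα]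
  rw [← h5] at h6
  obtain ⟨H, hH⟩ := h6
  exact ⟨H.1, H.2, fun x => congrFun hH x⟩

end TCD

/-! ### The cyclic order of the sinks at a crossing -/

namespace TCD

variable {B : Type*} [Fintype B] {n : ℕ} {T : TCD B n}

/-- A second passage through `c` of strands leaving `b` would be a self-intersection or a parallel
bigon. -/
theorem IsMinimal.ray_cross_unique (hT : T.IsMinimal) {b c : B} {i j k k' : Fin 3}
    (h : T.Follows (Sum.inl (b, i)) (Sum.inl (c, k)))
    (h' : T.Ray (Sum.inl (b, j)) (Sum.inl (c, k'))) : k' = k := by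
  by_contra hk
  have key : ∀ {k k' : Fin 3}, k ≠ k' → ¬ T.Ray (Sum.inl (c, k)) (Sum.inl (c, k')) := by
    intro k k' hk h
    rcases Relation.reflTransGen_iff_eq_or_transGen.1 h with h | h
    · simp only [Sum.inl.injEq, Prod.mk.injEq, true_and] at h
      exact hk h.symm
    · exact hT.no_self_intersection _ _ _ h
  rcases eq_or_ne i j with rfl | hij
  · rcases Ray.total h.to_reflTransGen h' with h | h
    · exact key (Ne.symm hk) h
    · exact key hk h
  · exact hT.not_ray_of_follows hij h h'

theorem not_ray_inr {x : B × Fin 3} {j : Fin n} : ¬ T.Ray (Sum.inl x) (Sum.inr j) := by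
  intro h
  rcases Relation.ReflTransGen.cases_tail h with h | ⟨z, -, c, k, -, h⟩ <;> simp at h

theorem IsMinimal.ray_last_iff (hT : T.IsMinimal) {t : HalfEdge B n → Fin n} (ht : T.IsSink t)
    {x : HalfEdge B n} {j : Fin n} : T.Ray x (T.seg.symm (Sum.inr j)) ↔ t x = j := by
  constructor
  · intro h
    rw [ht.ray h, ht.inr (T.seg.apply_symm_apply _)]
  · rintro rfl
    obtain ⟨y, j, h, e⟩ := hT.exists_end x
    rwa [ht.ray h, ht.inr e, ← e, Equiv.symm_apply_apply]

theorem IsMinimal.sink_injective (hT : T.IsMinimal) {t : HalfEdge B n → Fin n} (ht : T.IsSink t)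
    (b : B) : Function.Injective fun i => t (Sum.inl (b, i)) := fun _ _ h =>
  hT.ray_disjoint ((hT.ray_last_iff ht).2 h) ((hT.ray_last_iff ht).2 rfl)

/-- The sum in `hR` is the rank of `q i` among the three values. By `hS` this rank drops by one mod
3 from `i` to `i - 1`, so the only rise is the jump from the smallest to the largest value. -/
theorem cyclic_of_count {m : ℕ} (q : Fin 3 → Fin m) (hq : Function.Injective q) (R : ZMod 3)
    (S : Fin 3 → ZMod 3) (hS : ∀ i, S (i - 1) = S i + 1)
    (hR : ∀ i, S i = R - ∑ k, if q k ≤ q i then 1 else 0) :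
    ∃ i, q i < q (i - 1) ∧ ∀ j ≠ i, q (j - 1) < q j := by
  have h01 : q 0 ≠ q 1 := fun h => absurd (hq h) (by decide)
  have h02 : q 0 ≠ q 2 := fun h => absurd (hq h) (by decide)
  have h12 : q 1 ≠ q 2 := fun h => absurd (hq h) (by decide)
  have e0 : (0 : Fin 3) - 1 = 2 := rfl
  have e1 : (1 : Fin 3) - 1 = 0 := rfl
  have e2 : (2 : Fin 3) - 1 = 1 := rfl
  have s0 := hS 0
  have s1 := hS 1
  have s2 := hS 2
  rw [e0, hR, hR] at s0
  rw [e1, hR, hR] at s1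
  rw [e2, hR, hR] at s2
  simp only [Fin.sum_univ_three, le_refl, if_true] at s0 s1 s2
  clear hR hS
  have key : (q 0 < q 2 ∧ q 0 < q 1 ∧ q 1 < q 2) ∨ (q 1 < q 0 ∧ q 1 < q 2 ∧ q 2 < q 0) ∨
      (q 2 < q 1 ∧ q 2 < q 0 ∧ q 0 < q 1) := by
    rcases lt_or_gt_of_ne h01 with a | a <;> rcases lt_or_gt_of_ne h02 with b | b <;>
      rcases lt_or_gt_of_ne h12 with c | c <;>
      simp only [a.le, b.le, c.le, not_le.2 a, not_le.2 b, not_le.2 c, if_true, if_false]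
        at s0 s1 s2 <;>
      first
      | exact Or.inl ⟨b, a, c⟩
      | exact Or.inr (Or.inl ⟨a, c, b⟩)
      | exact Or.inr (Or.inr ⟨c, b, a⟩)
      | (exfalso; clear h01 h02 h12 hq a b c; revert R; decide)
  rcases key with h | h | h
  · refine ⟨0, h.1, fun j hj => ?_⟩
    fin_cases j
    exacts [absurd rfl hj, h.2.1, h.2.2]
  · refine ⟨1, h.1, fun j hj => ?_⟩
    fin_cases j
    exacts [h.2.2, absurd rfl hj, h.2.1]
  · refine ⟨2, h.1, fun j hj => ?_⟩
    fin_cases j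
    exacts [h.2.1, h.2.2, absurd rfl hj]

open Classical in
/-- The three strands that leave a crossing end in clockwise order. -/
theorem IsMinimal.sink_cyclic (hT : T.IsMinimal) {t : HalfEdge B n → Fin n} (ht : T.IsSink t)
    (b : B) : ∃ i, t (Sum.inl (b, i)) < t (Sum.inl (b, i - 1)) ∧
      ∀ j ≠ i, t (Sum.inl (b, j - 1)) < t (Sum.inl (b, j)) := by
  have sub_one_ne : ∀ k : Fin 3, k - 1 ≠ k := by decide
  -- The three strands leaving `b` create a flow of total strength three there; mod 3 this is
  -- nothing, so `α` is conserved everywhere and has a height function.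
  set α : HalfEdge B n → ZMod 3 := fun x => ∑ i, if T.Ray (Sum.inl (b, i)) x then 1 else 0 with hα
  have hα0 : ∀ x, (∀ i, ¬ T.Ray (Sum.inl (b, i)) x) → α x = 0 := fun x hx => by simp [hα, hx]
  have hcons : ∀ c, ∑ i, α (Sum.inl (c, i)) = ∑ i, α (T.seg.symm (Sum.inl (c, i))) := by
    intro c
    simp only [hα]
    rw [Finset.sum_comm]
    simp only [hT.sum_ray (ZMod 3) b _ c]
    rw [Finset.sum_add_distrib, Finset.sum_comm]
    have : ∀ z : ZMod 3, z + z + z = 0 := by decide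
    simp only [Fin.sum_univ_three, this, add_zero]
  obtain ⟨f, g, H⟩ := hT.exists_height (ZMod 3) α hcons
  -- The clockwise corners `k` and `k - 1` are separated by `out k` and `in (k - 1)`, with one
  -- counterclockwise face in between.
  have move : ∀ c k, f (T.cw (Sum.inl (c, k - 1))) = f (T.cw (Sum.inl (c, k))) +
      α (Sum.inl (c, k)) - α (T.seg.symm (Sum.inl (c, k - 1))) := by
    intro c k
    rw [← H, ← H, ccw_symm, cw_symm, sub_add_cancel]
    ring
  -- The height to the right of a ray from `b` never changes: a ray that enters a crossing by `in k`
  -- leaves by `out (k - 1)`, and the half-edges `out k` and `in (k - 1)` on its right carry no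
  -- flow, since no ray from `b` leaves that crossing by another half-edge.
  have hconst : ∀ i x, T.Ray (Sum.inl (b, i)) x → f (T.cw x) = f (T.cw (Sum.inl (b, i))) := by
    intro i x h
    induction h with
    | refl => rfl
    | tail h h' ih =>
      have hF := Relation.TransGen.tail' h h'
      obtain ⟨c, k, e, rfl⟩ := h'
      rw [move, ← e, cw_seg, ih, e, hα0 _, hα0 _]
      · ring
      · intro j hj
        have := hT.ray_cross_unique hF (hj.tail (T.next_symm c (k - 1)))
        exact sub_one_ne _ this
      · intro j hj
        exact sub_one_ne _ (hT.ray_cross_unique hF hj).symm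
  have hS : ∀ i, f (T.cw (Sum.inl (b, i - 1))) = f (T.cw (Sum.inl (b, i))) + 1 := by
    intro i
    rw [move, hα0 (T.seg.symm _) fun j hj =>
      hT.no_self_intersection _ _ _ (.tail' hj (T.next_symm b (i - 1))), sub_zero]
    congr 1
    simp only [hα]
    rw [Finset.sum_eq_single i]
    · exact if_pos .refl
    · intro j _ hj
      exact if_neg fun h => hj (hT.ray_disjoint h .refl)
    · simp
  -- Along the boundary only segments that end at sinks carry flow, because a ray from `b` never
  -- contains the segment at a source.
  have hbd : ∀ j, f (T.cw (Sum.inr j)) = f (T.cw (Sum.inr ((finRotate n).symm j))) -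
      ∑ i, if t (Sum.inl (b, i)) = j then 1 else 0 := by
    intro j
    have h1 := H (T.seg.symm (Sum.inr j))
    have h2 := H (Sum.inr ((finRotate n).symm j))
    rw [hα0 _ fun i => not_ray_inr] at h2
    rw [← T.ccw_turn_seg, Equiv.apply_symm_apply, cw_symm] at h1
    change g (T.ccw (Sum.inr ((finRotate n).symm j))) - _ = _ at h1
    rw [← sub_eq_zero.1 h2, eq_sub_iff_add_eq, ← eq_sub_iff_add_eq', h1]
    simp only [hα, hT.ray_last_iff ht]
  obtain ⟨m, rfl⟩ : ∃ m, n = m + 1 := by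
    obtain ⟨_, j, -⟩ := hT.exists_end (Sum.inl (b, 0))
    exact ⟨n - 1, by have := j.2; omega⟩
  have hG : ∀ j, f (T.cw (Sum.inr j)) = f (T.cw (Sum.inr (Fin.last m))) -
      ∑ i, if t (Sum.inl (b, i)) ≤ j then 1 else 0 := by
    intro j
    induction j using Fin.induction with
    | zero =>
      have : (finRotate (m + 1)).symm 0 = Fin.last m := by
        rw [Equiv.symm_apply_eq, finRotate_last]
      rw [hbd, this]
      simp
    | succ j ih =>
      have : (finRotate (m + 1)).symm j.succ = j.castSucc := by
        rw [Equiv.symm_apply_eq]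
        simp
      rw [hbd, this, ih, sub_sub, ← Finset.sum_add_distrib]
      congr 1
      refine Finset.sum_congr rfl fun i _ => ?_
      rcases lt_trichotomy (t (Sum.inl (b, i))) j.succ with h | h | h
      · have h' : t (Sum.inl (b, i)) ≤ j.castSucc := Fin.le_castSucc_iff.2 h
        simp [h', h.ne, h.le]
      · have h' : ¬ t (Sum.inl (b, i)) ≤ j.castSucc := by
          rw [Fin.le_castSucc_iff, h]; exact lt_irrefl _
        simp [h]
      · have h' : ¬ t (Sum.inl (b, i)) ≤ j.castSucc := by
          rw [Fin.le_castSucc_iff]; exact h.not_gt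
        simp [h', h.ne', h.not_ge]
  refine cyclic_of_count (fun i => t (Sum.inl (b, i))) (hT.sink_injective ht b)
    (f (T.cw (Sum.inr (Fin.last m)))) (fun i => f (T.cw (Sum.inl (b, i)))) hS fun i => ?_
  -- The height in corner `i` of `b` is transported along the strand to the boundary, where it
  -- counts the sinks passed so far.
  rw [← hG, ← hconst i _ ((hT.ray_last_iff ht).2 rfl), cw_symm]

end TCD

/-! ### Descents along the cycles of a permutation -/

namespace Equiv.Perm

variable {X L : Type*} [Finite X] [LinearOrder L] (f : Equiv.Perm X) (t : X → L)

theorem exists_max_sameCycle (c : Quotient (SameCycle.setoid f)) :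
    ∃ x, Quotient.mk (SameCycle.setoid f) x = c ∧ ∀ y, f.SameCycle x y → t y ≤ t x := by
  obtain ⟨z, rfl⟩ := Quotient.mk_surjective c
  obtain ⟨x, hx, hmax⟩ := Set.exists_max_image {y | f.SameCycle z y} t (Set.toFinite _) ⟨z, .refl _ _⟩
  exact ⟨x, Quotient.sound (s := SameCycle.setoid f) hx.symm, fun y hy => hmax y (hx.trans hy)⟩

/-- The maximum of `t` on a cycle is a weak descent. -/
theorem card_sameCycle_le :
    Nat.card (Quotient (SameCycle.setoid f)) ≤ Nat.card {x // t (f x) ≤ t x} := by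
  choose m hm hmax using f.exists_max_sameCycle t
  refine Nat.card_le_card_of_injective
    (fun c => ⟨m c, hmax c _ (sameCycle_apply_right.2 (.refl _ _))⟩) fun c c' h => ?_
  have h' : m c = m c' := Subtype.ext_iff.1 h
  rw [← hm c, ← hm c', h']

/-- If there are no more weak descents than cycles, then a weak descent is the only maximum of its
cycle. -/
theorem max_of_card_le
    (h : Nat.card {x // t (f x) ≤ t x} ≤ Nat.card (Quotient (SameCycle.setoid f)))
    {x y : X} (hx : t (f x) ≤ t x) (hxy : f.SameCycle x y) : t y ≤ t x ∧ (t y = t x → y = x) := by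
  choose m hm hmax using f.exists_max_sameCycle t
  let φ : Quotient (SameCycle.setoid f) → {x // t (f x) ≤ t x} := fun c =>
    ⟨m c, hmax c _ (sameCycle_apply_right.2 (.refl _ _))⟩
  have hφ : Function.Injective φ := fun c c' h => by
    have h' : m c = m c' := Subtype.ext_iff.1 h
    rw [← hm c, ← hm c', h']
  have hb := hφ.bijective_of_nat_card_le h
  have key : ∀ z, t (f z) ≤ t z → m (Quotient.mk (SameCycle.setoid f) z) = z := by
    intro z hz
    obtain ⟨c, hc⟩ := hb.2 ⟨z, hz⟩
    have hc' : m c = z := Subtype.ext_iff.1 hc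
    rw [← hc', hm, hc']
  have h1 : ∀ y, f.SameCycle x y → t y ≤ t x := by
    have := hmax (Quotient.mk (SameCycle.setoid f) x)
    rwa [key x hx] at this
  refine ⟨h1 y hxy, fun e => ?_⟩
  rw [← key x hx, ← key y (e ▸ h1 _ (sameCycle_apply_right.2 hxy))]
  congr 1
  exact Quotient.sound (s := SameCycle.setoid f) hxy.symm

end Equiv.Perm

/-! ### Descents of the sinks along the faces, and the acyclic matching -/

namespace TCD

variable {B : Type*} [Fintype B] {n : ℕ} {T : TCD B n}

-- By the cyclic order of the sinks, each crossing contributes one descent at a clockwise corner and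
-- one ascent at a counterclockwise corner, while the boundary contributes `n + 1`. The bound equals
-- the number of all faces in Euler's formula, which makes the count sharp.
open Classical in
theorem IsMinimal.card_descents_le (hT : T.IsMinimal) {t : HalfEdge B n → Fin n}
    (ht : T.IsSink t) :
    Nat.card {x // t (T.seg x) ≤ t x} + Nat.card {x // t x ≤ t (turn B n (T.seg x))} ≤
      2 * Fintype.card B + n + 1 := by
  rcases n with _ | m
  -- Every segment has a sink, so without boundary points there are no segments.
  · have : IsEmpty (HalfEdge B 0) := ⟨fun x => (t x).elim0⟩
    simp
  have h1 : Nat.card {x // t (T.seg x) ≤ t x} =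
      ∑ y, if t y ≤ t (T.seg.symm y) then 1 else 0 := by
    rw [Nat.card_eq_fintype_card, Fintype.card_subtype, Finset.card_filter]
    exact Fintype.sum_equiv T.seg _ _ fun x => by simp
  have h2 : Nat.card {x // t x ≤ t (turn B (m + 1) (T.seg x))} =
      ∑ y, if t (T.seg.symm y) ≤ t (turn B (m + 1) y) then 1 else 0 := by
    rw [Nat.card_eq_fintype_card, Fintype.card_subtype, Finset.card_filter]
    exact Fintype.sum_equiv T.seg _ _ fun x => by simp
  have e1 : ∀ b i, t (T.seg.symm (Sum.inl (b, i))) = t (Sum.inl (b, i - 1)) := fun b i =>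
    ht.inl (T.seg.apply_symm_apply _)
  have e2 : ∀ j, t (T.seg.symm (Sum.inr j)) = j := fun j => ht.inr (T.seg.apply_symm_apply _)
  rw [h1, h2, Fintype.sum_sum_type, Fintype.sum_sum_type, Fintype.sum_prod_type,
    Fintype.sum_prod_type]
  simp only [e1, e2, turn_inl]
  have s1 : ∀ b, ∑ i, (if t (Sum.inl (b, i)) ≤ t (Sum.inl (b, i - 1)) then 1 else 0) = 1 := by
    intro b
    obtain ⟨i, hi, hj⟩ := hT.sink_cyclic ht b
    rw [Finset.sum_eq_single i, if_pos hi.le]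
    · exact fun j _ hji => if_neg (hj j hji).not_ge
    · simp
  have s2 : ∀ b, ∑ i, (if t (Sum.inl (b, i - 1)) ≤ t (Sum.inl (b, i + 1)) then 1 else 0) = 1 := by
    intro b
    refine Eq.trans (Fintype.sum_equiv (Equiv.subRight (1 : Fin 3)) _ _ fun i => ?_) (s1 b)
    have a1 : ∀ i : Fin 3, i + 1 = i - 1 - 1 := by decide
    rw [a1 i]
    rfl
  have s3 : (∑ j, if t (Sum.inr j) ≤ j then 1 else 0) +
      ∑ j, (if j ≤ t (turn B (m + 1) (Sum.inr j)) then 1 else 0) = m + 2 := by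
    -- After a shift by one, the second indicator is the negation of the first for every index but
    -- the last; at the last index, where the shift wraps around, both are `1`.
    rw [← Equiv.sum_comp (finRotate (m + 1)) (fun j => if j ≤ t _ then 1 else 0),
      ← Finset.sum_add_distrib, Fin.sum_univ_castSucc]
    have a2 : finRotate (m + 1) (Fin.last m) = 0 := finRotate_last
    have a3 : ∀ j : Fin m, finRotate (m + 1) j.castSucc = j.succ := by intro j; simp
    have a1 : ∀ j : Fin m, turn B (m + 1) (Sum.inr j.succ) = Sum.inr j.castSucc := by
      intro j; rw [← a3]; simp [turn, -finRotate_apply]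
    simp only [a1, a2, a3, Fin.zero_le, Fin.le_last, if_true]
    rw [Finset.sum_eq_card_nsmul (b := 1)]
    · simp
    · intro j _
      rcases lt_or_ge j.castSucc (t (Sum.inr j.castSucc)) with h | h
      · rw [if_neg h.not_ge, if_pos (Fin.castSucc_lt_iff_succ_le.1 h)]
      · rw [if_pos h, if_neg fun hc => h.not_gt (Fin.castSucc_lt_iff_succ_le.2 hc)]
  simp only [s1, s2]
  simp only [Finset.sum_const, Finset.card_univ, smul_eq_mul, mul_one]
  omega

/-- On a clockwise face, a segment that is followed by a weak descent of the sinks is the only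
maximum. -/
theorem IsMinimal.max_of_descent (hT : T.IsMinimal) {t : HalfEdge B n → Fin n} (ht : T.IsSink t)
    {x y : HalfEdge B n} (hx : t (T.seg x) ≤ t x) (hxy : T.cw y = T.cw x) :
    t y ≤ t x ∧ (t y = t x → y = x) := by
  -- Each counterclockwise face has at least one weak ascent, so the total count leaves at most as
  -- many weak descents as there are clockwise faces.
  refine T.seg.max_of_card_le t ?_ hx (cw_eq_iff.1 hxy).symm
  have h1 := hT.card_descents_le ht
  have h2 := (turn B n * T.seg).card_sameCycle_le (fun x => OrderDual.toDual (t x))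
  have h3 := T.euler
  simp only [OrderDual.toDual_le_toDual, Equiv.Perm.mul_apply] at h2
  omega

/-- The height function of a strand: how the side of the strand changes around a crossing. -/
theorem IsMinimal.exists_strand_height (hT : T.IsMinimal) {t : HalfEdge B n → Fin n}
    (ht : T.IsSink t) (s : Fin n) : ∃ L : T.W → ℚ, ∀ b k, L (T.nbr b (k - 1)) = L (T.nbr b k) +
      (if t (Sum.inl (b, k)) = s then 1 else 0) - if t (Sum.inl (b, k + 1)) = s then 1 else 0 := by
  have e1 : ∀ b i, t (T.seg.symm (Sum.inl (b, i))) = t (Sum.inl (b, i - 1)) := fun b i =>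
    ht.inl (T.seg.apply_symm_apply _)
  -- The unit flow along all segments with sink `s` is conserved; its height is larger by one on the
  -- left.
  obtain ⟨f, g, H⟩ := hT.exists_height ℚ (fun x => if t x = s then 1 else 0) (by
    intro b
    simp only [e1]
    exact (Equiv.sum_comp (Equiv.subRight (1 : Fin 3))
      (fun i => if t (Sum.inl (b, i)) = s then (1 : ℚ) else 0)).symm)
  refine ⟨f, fun b k => ?_⟩
  have h1 := H (Sum.inl (b, k))
  have h2 := H (T.seg.symm (Sum.inl (b, k - 1)))
  have a1 : ∀ k : Fin 3, k - 1 - 1 = k + 1 := by decide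
  rw [ccw_symm, cw_symm, sub_add_cancel, e1, a1] at h2
  rw [nbr_eq, nbr_eq, ← h1, ← h2]
  ring

/-- The strand that leaves by `out k` has the corner `k` on its right and `k - 1` on its left, so
its height function distinguishes these two faces. -/
theorem IsMinimal.nbr_injective (hT : T.IsMinimal) (b : B) : Function.Injective (T.nbr b) := by
  obtain ⟨t, ht⟩ := hT.exists_isSink
  have key : ∀ k : Fin 3, T.nbr b (k - 1) ≠ T.nbr b k := by
    intro k h
    obtain ⟨L, hL⟩ := hT.exists_strand_height ht (t (Sum.inl (b, k)))
    have h1 := hL b k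
    have h2 : t (Sum.inl (b, k + 1)) ≠ t (Sum.inl (b, k)) := fun e => by
      exact absurd (hT.sink_injective ht b e) (by simp)
    rw [h, if_pos rfl, if_neg h2] at h1
    linarith
  intro i j h
  by_contra hij
  have a1 : ∀ i j : Fin 3, i ≠ j → i = j - 1 ∨ j = i - 1 := by decide
  rcases a1 i j hij with rfl | rfl
  · exact key _ h
  · exact key _ h.symm

/-- A chain of dependencies between clockwise faces does not continue forever: `σ b` is the corner
at which the sinks descend. -/
theorem IsMinimal.wellFounded_dependence (hT : T.IsMinimal) {t : HalfEdge B n → Fin n}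
    (ht : T.IsSink t) {σ : B → Fin 3}
    (hσ : ∀ b, t (Sum.inl (b, σ b)) < t (Sum.inl (b, σ b - 1)))
    (hσ' : ∀ b, t (Sum.inl (b, σ b + 1)) < t (Sum.inl (b, σ b - 1))) :
    WellFounded fun w' w => ∃ b i, i ≠ σ b ∧ w = T.nbr b (σ b) ∧ w' = T.nbr b i := by
  have e1 : ∀ b i, t (T.seg.symm (Sum.inl (b, i))) = t (Sum.inl (b, i - 1)) := fun b i =>
    ht.inl (T.seg.apply_symm_apply _)
  rw [wellFounded_iff_isEmpty_descending_chain]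
  refine ⟨fun ⟨f, hf⟩ => ?_⟩
  choose b i hi hw hw' using hf
  -- The segment `x l` enters `b l` by `in σ`. It belongs to the strand with the largest sink `A l`
  -- at `b l`, and is the unique maximum of the sinks on the face `f l`.
  let x : ℕ → HalfEdge B n := fun l => T.seg.symm (Sum.inl (b l, σ (b l)))
  let A : ℕ → Fin n := fun l => t (Sum.inl (b l, σ (b l) - 1))
  have hA : ∀ l, t (x l) = A l := fun l => e1 _ _
  have hPQ : ∀ l, i l = σ (b l) - 1 ∨ i l = σ (b l) + 1 := by
    intro l
    have := hi l
    generalize i l = p at this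
    generalize σ (b l) = q at this
    revert p q
    decide
  -- In a step to the corner `σ - 1`, the continuation of `x l` borders the new face, whose unique
  -- maximum is `x (l + 1)`.
  have hP : ∀ l, i l = σ (b l) - 1 → A l < A (l + 1) ∨ T.Next (x l) (x (l + 1)) := by
    intro l h
    have h1 : T.cw (Sum.inl (b l, i l)) = T.cw (x (l + 1)) := by
      rw [← nbr_eq, ← hw' l, hw (l + 1), nbr_eq, cw_symm]
    have h2 : t (T.seg (x (l + 1))) ≤ t (x (l + 1)) := by
      rw [hA, Equiv.apply_symm_apply]
      exact (hσ _).le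
    obtain ⟨h3, h4⟩ := hT.max_of_descent ht h2 h1
    rw [hA, h] at h3 h4
    rcases h3.lt_or_eq with h3 | h3
    · exact Or.inl h3
    · exact Or.inr (h4 h3 ▸ T.next_symm _ _)
  have hPle : ∀ l, i l = σ (b l) - 1 → A l ≤ A (l + 1) := by
    intro l h
    rcases hP l h with h | h
    · exact h.le
    · rw [← hA, ← hA, ht.ray (.single h)]
  by_cases hQ : ∃ N, ∀ l ≥ N, i l = σ (b l) - 1
  · obtain ⟨N, hN⟩ := hQ
    -- If all late steps go to `σ - 1`, the chain ascends forever in a strict order on a finite set: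
    -- by sink, and by position along a strand when the sinks are equal.
    let S : HalfEdge B n → HalfEdge B n → Prop := fun y x => t x < t y ∨ T.Follows x y
    have : IsTrans _ S := ⟨by
      rintro z y x (h | h) (h' | h')
      · exact Or.inl (h'.trans h)
      · exact Or.inl (ht.ray h'.to_reflTransGen ▸ h)
      · exact Or.inl (ht.ray h.to_reflTransGen ▸ h')
      · exact Or.inr (h'.trans h)⟩
    have : Std.Irrefl S := ⟨fun x h => h.elim (lt_irrefl _) (hT.no_loop x)⟩
    have hwf := Finite.wellFounded_of_trans_of_irrefl S
    rw [wellFounded_iff_isEmpty_descending_chain] at hwf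
    refine hwf.false ⟨fun l => x (N + l), fun l => ?_⟩
    rcases hP (N + l) (hN _ (by omega)) with h | h
    · left
      rw [hA, hA]
      exact h
    · exact Or.inr (.single h)
  · have hfreq : ∃ᶠ l in Filter.atTop, ∃ a, i l ≠ σ (b l) - 1 ∧ A l = a := by
      rw [Filter.frequently_atTop]
      intro N
      push Not at hQ
      obtain ⟨l, hl, h⟩ := hQ N
      exact ⟨l, hl, _, h, rfl⟩
    have hne : {a | ∃ᶠ l in Filter.atTop, i l ≠ σ (b l) - 1 ∧ A l = a}.Nonempty := by
      by_contra hc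
      rw [Set.not_nonempty_iff_eq_empty, Set.eq_empty_iff_forall_notMem] at hc
      refine hfreq ?_
      simp only [Set.mem_ofPred_eq, Filter.not_frequently] at hc
      filter_upwards [Filter.eventually_all.2 hc] with l hl
      push Not at hl ⊢
      exact hl
    -- Otherwise `a` is the largest sink that is `A l` for infinitely many steps to the corner `σ +
    -- 1`. From some index on, such steps have `A l ≤ a`.
    obtain ⟨a, ha, hmax⟩ := Set.exists_max_image _ id (Set.toFinite _) hne
    have hev : ∀ᶠ l in Filter.atTop, ∀ a', a < a' → ¬ (i l ≠ σ (b l) - 1 ∧ A l = a') := by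
      rw [Filter.eventually_all]
      intro a'
      by_cases h : a < a'
      · have : ¬ ∃ᶠ l in Filter.atTop, i l ≠ σ (b l) - 1 ∧ A l = a' := fun hc =>
          (hmax a' hc).not_gt h
        filter_upwards [Filter.not_frequently.1 this] with l hl _ using hl
      · exact Filter.Eventually.of_forall fun l h' => absurd h' h
    obtain ⟨N, hN⟩ := Filter.eventually_atTop.1 hev
    replace ha := Filter.frequently_atTop.1 ha
    by_cases hC : ∃ m ≥ N, t (Sum.inl (b m, σ (b m) + 1)) = a
    · obtain ⟨m, hm, hC⟩ := hC
      -- If `a` is the middle sink at a late crossing, then `A` exceeds `a` there; this forces steps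
      -- to `σ - 1`, along which `A` does not decrease, so steps of the other kind never return.
      have h1 : ∀ l ≥ m, a < A l ∧ i l = σ (b l) - 1 := by
        intro l hl
        have h2 : a < A l → i l = σ (b l) - 1 := fun h => by
          by_contra hc
          exact hN l (by omega) _ h ⟨hc, rfl⟩
        induction l, hl using Nat.le_induction with
        | base =>
          have : a < A m := hC ▸ hσ' (b m)
          exact ⟨this, h2 this⟩
        | succ l hl ih =>
          have h3 := ih fun h => by
            by_contra hc
            exact hN l (by omega) _ h ⟨hc, rfl⟩
          have : a < A (l + 1) := h3.1.trans_le (hPle l h3.2)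
          exact ⟨this, h2 this⟩
      obtain ⟨l, hl, h, -⟩ := ha m
      exact h (h1 l hl).2
    · push Not at hC
      obtain ⟨L, hL⟩ := hT.exists_strand_height ht a
      -- Once `a` is never the middle sink, no step crosses the strand `a` from left to right, and a
      -- step to `σ + 1` with `A l = a` crosses it from right to left. The height of this strand
      -- would then grow without bound on finitely many faces.
      have hstep : ∀ l ≥ N, L (f l) ≤ L (f (l + 1)) ∧
          (i l ≠ σ (b l) - 1 ∧ A l = a → L (f l) < L (f (l + 1))) := by
        intro l hl
        rcases hPQ l with h | h
        · have h1 := hL (b l) (σ (b l))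
          rw [← h, ← hw', ← hw, if_neg (hC l hl)] at h1
          refine ⟨?_, fun h' => absurd h h'.1⟩
          split_ifs at h1 <;> linarith
        · have h1 := hL (b l) (i l)
          have a1 : i l - 1 = σ (b l) := by rw [h]; simp
          have a2 : i l + 1 = σ (b l) - 1 := by
            rw [h]; generalize σ (b l) = p; revert p; decide
          rw [a1, a2, ← hw', ← hw, h, if_neg (hC l hl)] at h1
          refine ⟨?_, fun h' => ?_⟩
          · split_ifs at h1 <;> linarith
          · rw [if_pos h'.2] at h1
            linarith
      obtain ⟨w, ⟨l0, hl0, rfl⟩, hw⟩ := Set.exists_max_image {w | ∃ l ≥ N, f l = w} L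
        (Set.toFinite _) ⟨_, N, le_rfl, rfl⟩
      have hmono : ∀ l ≥ l0, L (f l0) ≤ L (f l) := by
        intro l hl
        induction l, hl using Nat.le_induction with
        | base => exact le_rfl
        | succ l hl ih => exact ih.trans (hstep l (by omega)).1
      obtain ⟨l, hl, h⟩ := ha l0
      have h1 := (hstep l (by omega)).2 h
      have h2 := hw (f (l + 1)) ⟨l + 1, by omega, rfl⟩
      have h3 := hmono l hl
      linarith

/-- In a minimal diagram, every crossing can be assigned an adjacent clockwise face of its own, in
an acyclic way. -/
theorem IsMinimal.exists_acyclic_matching (hT : T.IsMinimal) :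
    ∃ (σ : B → Fin 3) (ρ : T.W → ℕ), Function.Injective (fun b => T.nbr b (σ b)) ∧
      ∀ b i, i ≠ σ b → ρ (T.nbr b i) < ρ (T.nbr b (σ b)) := by
  obtain ⟨t, ht⟩ := hT.exists_isSink
  choose σ hσ hσ' using hT.sink_cyclic ht
  have a1 : ∀ p : Fin 3, p - 1 ≠ p ∧ p - 1 - 1 = p + 1 := by decide
  have hwf := hT.wellFounded_dependence ht hσ (fun b => by
    rw [← (a1 (σ b)).2]
    exact hσ' b _ (a1 _).1)
  set R : T.W → T.W → Prop := fun w' w => ∃ b i, i ≠ σ b ∧ w = T.nbr b (σ b) ∧ w' = T.nbr b i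
  -- The rank of a face is the number of faces on which it depends. Injectivity holds because the
  -- segments that enter matched corners are unique maxima of their faces.
  refine ⟨σ, fun w => {w' | Relation.TransGen R w' w}.ncard, fun b b' h => ?_, fun b i hi => ?_⟩
  · have hx : ∀ b, t (T.seg (T.seg.symm (Sum.inl (b, σ b)))) ≤ t (T.seg.symm (Sum.inl (b, σ b))) := by
      intro b
      rw [ht.inl (T.seg.apply_symm_apply _), Equiv.apply_symm_apply]
      exact (hσ b).le
    have hc : T.cw (T.seg.symm (Sum.inl (b, σ b))) = T.cw (T.seg.symm (Sum.inl (b', σ b'))) := by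
      rw [cw_symm, cw_symm]
      exact h
    have h1 := hT.max_of_descent ht (hx b') hc
    have h2 := hT.max_of_descent ht (hx b) hc.symm
    have h3 := T.seg.symm.injective (h1.2 (le_antisymm h1.1 h2.1))
    simp only [Sum.inl.injEq, Prod.mk.injEq] at h3
    exact h3.1
  · have hR : R (T.nbr b i) (T.nbr b (σ b)) := ⟨b, i, hi, rfl, rfl⟩
    refine Set.ncard_lt_ncard ⟨fun w hw => hw.tail hR, fun hc => ?_⟩ (Set.toFinite _)
    have : Relation.TransGen R (T.nbr b i) (T.nbr b i) := hc (.single hR)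
    exact hwf.transGen.irrefl.irrefl _ this

end TCD

namespace SpaceWithFunctions

variable {X Y Z ι κ : Type*}

/-! ### Spaces with functions with continuous functions and inverses -/

/-- The non-vanishing loci of regular functions are open, and non-vanishing regular functions have
regular inverses. -/
structure HasInverses (O : SpaceWithFunctions X) : Prop where
  isOpen_ne : ∀ {U : Set X} {f : X → ℂ}, IsOpen[O.top] U → O.IsRegular U f →
    IsOpen[O.top] {x | x ∈ U ∧ f x ≠ 0}
  inv : ∀ {U : Set X} {f : X → ℂ}, O.IsRegular U f → (∀ x ∈ U, f x ≠ 0) → O.IsRegular U f⁻¹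

theorem isOpen_zariski_iff {V : Set (ι → ℂ)} : IsOpen[zariski ι] V ↔ ∀ x ∈ V,
    ∃ p : MvPolynomial ι ℂ, MvPolynomial.eval x p ≠ 0 ∧
      ∀ y, MvPolynomial.eval y p ≠ 0 → y ∈ V := by
  let := zariski ι
  constructor
  · intro h x hx
    obtain ⟨S, hS⟩ := (isClosed_zariski_iff _).1 (isClosed_compl_iff.2 h)
    have hx' : x ∉ Vᶜ := fun h => h hx
    rw [hS] at hx'
    simp only [Set.mem_ofPred_eq, not_forall] at hx'
    obtain ⟨p, hp, hpx⟩ := hx'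
    refine ⟨p, hpx, fun y hy => ?_⟩
    by_contra hc
    have hy' : y ∈ Vᶜ := hc
    rw [hS] at hy'
    exact hy (hy' p hp)
  · intro h
    rw [← isClosed_compl_iff]
    refine (isClosed_zariski_iff _).2
      ⟨{p | ∀ y, MvPolynomial.eval y p ≠ 0 → y ∈ V}, Set.ext fun x => ⟨fun hx p hp => ?_, ?_⟩⟩
    · by_contra hc
      exact hx (hp x hc)
    · intro hx hxV
      obtain ⟨p, hpx, hp⟩ := h x hxV
      exact hpx (hx p hp)

theorem isOpen_zariski_ne (p : MvPolynomial ι ℂ) :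
    IsOpen[zariski ι] {x | MvPolynomial.eval x p ≠ 0} :=
  isOpen_zariski_iff.2 fun _ hx => ⟨p, hx, fun _ hy => hy⟩

theorem affineSpace_hasInverses (ι : Type*) : (affineSpace ι).HasInverses where
  isOpen_ne {U f} hU hf := by
    refine isOpen_zariski_iff.2 fun x hx => ?_
    obtain ⟨p, q, hq, e⟩ := hf x hx.1
    obtain ⟨r, hr, hr'⟩ := isOpen_zariski_iff.1 hU x hx.1
    refine ⟨p * q * r, ?_, fun y hy => ?_⟩
    · have := hx.2
      rw [e x hx.1 hq, div_ne_zero_iff] at this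
      simp [this, hr]
    · simp only [map_mul, mul_ne_zero_iff] at hy
      refine ⟨hr' y hy.2, ?_⟩
      rw [e y (hr' y hy.2) hy.1.2]
      exact div_ne_zero hy.1.1 hy.1.2
  inv {U f} hf h0 x hx := by
    obtain ⟨p, q, hq, e⟩ := hf x hx
    have := h0 x hx
    rw [e x hx hq, div_ne_zero_iff] at this
    refine ⟨q * q, p * q, by simp [this], fun y hy hyq => ?_⟩
    simp only [map_mul, mul_ne_zero_iff] at hyq ⊢
    rw [Pi.inv_apply, e y hy hyq.2, inv_div, mul_div_mul_right _ _ hyq.2]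

theorem HasInverses.sub {O : SpaceWithFunctions X} (hO : O.HasInverses) (S : Set X) :
    (O.sub S).HasInverses where
  isOpen_ne {U f} hU hf := by
    let := O.top
    let := (O.sub S).top
    rw [isOpen_iff_forall_mem_open]
    intro x hx
    obtain ⟨V, g, hV, hxV, hg, e⟩ := hf x hx.1
    obtain ⟨U', hU', rfl⟩ := hU
    refine ⟨Subtype.val ⁻¹' ({y | y ∈ V ∧ g y ≠ 0} ∩ U'), ?_,
      ⟨_, (hO.isOpen_ne hV hg).inter hU', rfl⟩, ?_⟩
    · rintro y ⟨⟨h1, h2⟩, h3⟩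
      refine ⟨h3, ?_⟩
      rwa [e y h3 h1]
    · refine ⟨⟨hxV, ?_⟩, hx.1⟩
      rw [← e x hx.1 hxV]
      exact hx.2
  inv {U f} hf h0 x hx := by
    let := O.top
    obtain ⟨V, g, hV, hxV, hg, e⟩ := hf x hx
    refine ⟨{y | y ∈ V ∧ g y ≠ 0}, g⁻¹, hO.isOpen_ne hV hg, ⟨hxV, ?_⟩,
      hO.inv (O.restrict (fun y hy => hy.1) hg) (fun y hy => hy.2), fun y hy hyV => ?_⟩
    · rw [← e x hx hxV]
      exact h0 x hx
    · simp [e y hy hyV.1]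

theorem HasInverses.quot {O : SpaceWithFunctions X} (hO : O.HasInverses) (π : X → Y) :
    (O.quot π).HasInverses where
  isOpen_ne hU hf := hO.isOpen_ne hU hf
  inv hf h0 := hO.inv hf fun _ hx => h0 _ hx

section Regular

variable {O : SpaceWithFunctions X} {U : Set X}

theorem IsRegular.neg {f : X → ℂ} (hf : O.IsRegular U f) : O.IsRegular U (-f) := by
  have := O.mul (O.const U (-1)) hf
  exact O.congr (fun x _ => by simp) this

theorem IsRegular.sum {J : Type*} {s : Finset J} {f : J → X → ℂ}
    (hf : ∀ j ∈ s, O.IsRegular U (f j)) : O.IsRegular U (fun x => ∑ j ∈ s, f j x) := by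
  classical
  induction s using Finset.induction_on with
  | empty => simpa using O.const U 0
  | insert a s ha ih =>
    simp only [Finset.sum_insert ha]
    exact O.add (hf a (by simp)) (ih fun j hj => hf j (by simp [hj]))

theorem IsRegular.prod {J : Type*} {s : Finset J} {f : J → X → ℂ}
    (hf : ∀ j ∈ s, O.IsRegular U (f j)) : O.IsRegular U (fun x => ∏ j ∈ s, f j x) := by
  classical
  induction s using Finset.induction_on with
  | empty => simpa using O.const U 1
  | insert a s ha ih =>
    simp only [Finset.prod_insert ha]
    exact O.mul (hf a (by simp)) (ih fun j hj => hf j (by simp [hj]))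

theorem IsRegular.eval {φ : X → ι → ℂ} (hφ : ∀ i, O.IsRegular U fun x => φ x i)
    (p : MvPolynomial ι ℂ) : O.IsRegular U fun x => MvPolynomial.eval (φ x) p := by
  induction p using MvPolynomial.induction_on with
  | C a => simpa using O.const U a
  | add p q hp hq => exact O.congr (fun x _ => by simp) (O.add hp hq)
  | mul_X p i hp => exact O.congr (fun x _ => by simp) (O.mul hp (hφ i))

theorem IsRegular.det {m : Type*} [Fintype m] [DecidableEq m] {M : X → Matrix m m ℂ}
    (hM : ∀ i j, O.IsRegular U fun x => M x i j) : O.IsRegular U fun x => (M x).det := by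
  simp only [Matrix.det_apply, Units.smul_def, zsmul_eq_mul]
  exact IsRegular.sum fun σ _ => O.mul (O.const _ _) (IsRegular.prod fun i _ => hM _ _)

theorem IsRegular.inv_matrix (hO : O.HasInverses) {m : Type*} [Fintype m] [DecidableEq m]
    {M : X → Matrix m m ℂ} (hM : ∀ i j, O.IsRegular U fun x => M x i j)
    (h : ∀ x ∈ U, (M x).det ≠ 0) (i j : m) : O.IsRegular U fun x => (M x)⁻¹ i j := by
  simp only [Matrix.inv_def, Matrix.smul_apply, Ring.inverse_eq_inv', smul_eq_mul,
    Matrix.adjugate_apply]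
  refine O.mul (hO.inv (IsRegular.det hM) h) (IsRegular.det fun k l => ?_)
  by_cases hk : k = j
  · subst hk
    simpa using O.const U ((Pi.single i (1 : ℂ) : m → ℂ) l)
  · simpa [Matrix.updateRow_ne hk] using hM k l

theorem isOpen_coord (hO : O.HasInverses) (hU : IsOpen[O.top] U) {φ : X → ι → ℂ}
    (hφ : ∀ i, O.IsRegular U fun x => φ x i) {V : Set (ι → ℂ)} (hV : IsOpen[zariski ι] V) :
    IsOpen[O.top] {x | x ∈ U ∧ φ x ∈ V} := by
  let := O.top
  rw [isOpen_iff_forall_mem_open]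
  intro x hx
  obtain ⟨p, hp, hpV⟩ := isOpen_zariski_iff.1 hV _ hx.2
  exact ⟨_, fun y hy => ⟨hy.1, hpV _ hy.2⟩, hO.isOpen_ne hU (IsRegular.eval hφ p), hx.1, hp⟩

theorem IsRegular.comp (hO : O.HasInverses) (hU : IsOpen[O.top] U) {φ : X → ι → ℂ}
    (hφ : ∀ i, O.IsRegular U fun x => φ x i) {V : Set (ι → ℂ)} {h : (ι → ℂ) → ℂ}
    (hh : (affineSpace ι).IsRegular V h) : O.IsRegular {x | x ∈ U ∧ φ x ∈ V} fun x => h (φ x) := by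
  refine O.locality fun x hx => ?_
  obtain ⟨p, q, hq, e⟩ := hh _ hx.2
  refine ⟨_, hO.isOpen_ne hU (IsRegular.eval hφ q), ⟨hx.1, hq⟩, ?_⟩
  refine O.congr (f := (fun x => MvPolynomial.eval (φ x) p) *
      (fun x => MvPolynomial.eval (φ x) q)⁻¹) ?_ (O.restrict Set.inter_subset_left ?_)
  · intro y hy
    simp [e _ hy.2.2 hy.1.2, div_eq_mul_inv]
  · exact O.mul (O.restrict (fun y hy => hy.1) (IsRegular.eval hφ p))
      (hO.inv (O.restrict (fun y hy => hy.1) (IsRegular.eval hφ q)) fun y hy => hy.2)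

theorem isOpen_coord_sub (hO : O.HasInverses) (hU : IsOpen[O.top] U) {φ : X → ι → ℂ}
    (hφ : ∀ i, O.IsRegular U fun x => φ x i) {S : Set (ι → ℂ)} (hS : ∀ x ∈ U, φ x ∈ S)
    {V : Set S} (hV : IsOpen[((affineSpace ι).sub S).top] V) :
    IsOpen[O.top] {x | x ∈ U ∧ ∃ h : φ x ∈ S, ⟨φ x, h⟩ ∈ V} := by
  obtain ⟨V', hV', rfl⟩ := hV
  convert! isOpen_coord hO hU hφ hV' using 3 with x
  exact and_congr_right fun hx => ⟨fun ⟨_, h⟩ => h, fun h => ⟨hS _ hx, h⟩⟩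

theorem IsRegular.comp_sub (hO : O.HasInverses) (hU : IsOpen[O.top] U) {φ : X → ι → ℂ}
    (hφ : ∀ i, O.IsRegular U fun x => φ x i) {S : Set (ι → ℂ)}
    {V : Set S} {h : S → ℂ} (hh : ((affineSpace ι).sub S).IsRegular V h) {U' : Set X} {f : X → ℂ}
    (hU' : ∀ x ∈ U', x ∈ U ∧ ∃ hx : φ x ∈ S, ⟨φ x, hx⟩ ∈ V ∧ f x = h ⟨φ x, hx⟩) :
    O.IsRegular U' f := by
  refine O.locality fun x hx => ?_
  obtain ⟨hxU, hxS, hxV, hfx⟩ := hU' x hx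
  obtain ⟨V', g, hV', hxV', hg, e⟩ := hh _ hxV
  refine ⟨_, isOpen_coord hO hU hφ hV', ⟨hxU, hxV'⟩, ?_⟩
  refine O.congr ?_ (O.restrict Set.inter_subset_left (IsRegular.comp hO hU hφ hg))
  rintro y ⟨⟨hy1, hy2⟩, hy3⟩
  obtain ⟨-, hyS, hyV, hfy⟩ := hU' y hy3
  rw [hfy, e _ hyV hy2]

end Regular

/-! ### Morphisms -/

section Morphism

variable {O : SpaceWithFunctions X} {P : SpaceWithFunctions Y} {Q : SpaceWithFunctions Z}

theorem IsMorphism.comp {φ : X → Y} {ψ : Y → Z} (hψ : IsMorphism P Q ψ) (hφ : IsMorphism O P φ) :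
    IsMorphism O Q (ψ ∘ φ) :=
  ⟨fun V hV => hφ.1 _ (hψ.1 V hV), fun V f hV hf => hφ.2 _ _ (hψ.1 V hV) (hψ.2 V f hV hf)⟩

theorem isMorphism_quot (O : SpaceWithFunctions X) (π : X → Y) : IsMorphism O (O.quot π) π :=
  ⟨fun _ h => h, fun _ _ _ h => h⟩

theorem isMorphism_val (O : SpaceWithFunctions X) (S : Set X) :
    IsMorphism (O.sub S) O Subtype.val :=
  ⟨fun V hV => ⟨V, hV, rfl⟩, fun V f hV hf _ hx => ⟨V, f, hV, hx, hf, fun _ _ _ => rfl⟩⟩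

theorem isMorphism_sub {S : Set Y} {φ : X → S} (h : IsMorphism O P fun x => (φ x : Y)) :
    IsMorphism O (P.sub S) φ := by
  refine ⟨?_, fun V f hV hf => O.locality fun x hx => ?_⟩
  · rintro _ ⟨V, hV, rfl⟩
    exact h.1 V hV
  · obtain ⟨V', g, hV', hxV', hg, e⟩ := hf _ hx
    refine ⟨_, h.1 V' hV', hxV', O.congr ?_ (O.restrict Set.inter_subset_left (h.2 V' g hV' hg))⟩
    intro y hy
    exact (e _ hy.2 hy.1).symm

theorem isMorphism_of_coord (hO : O.HasInverses) {S : Set (ι → ℂ)} {φ : X → S}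
    (hφ : ∀ i, O.IsRegular Set.univ fun x => (φ x : ι → ℂ) i) :
    IsMorphism O ((affineSpace ι).sub S) φ := by
  let := O.top
  refine isMorphism_sub ⟨fun V hV => ?_, fun V f hV hf => ?_⟩
  · simpa using! isOpen_coord hO isOpen_univ hφ hV
  · have := IsRegular.comp hO isOpen_univ hφ hf
    simpa using! this

theorem affineSpace_regular_coord (U : Set (ι → ℂ)) (i : ι) :
    (affineSpace ι).IsRegular U fun x => x i :=
  fun x _ => ⟨MvPolynomial.X i, 1, by simp, fun y _ _ => by simp⟩

theorem sub_regular_coord {S : Set (ι → ℂ)} (U : Set S) (i : ι) :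
    ((affineSpace ι).sub S).IsRegular U fun x => (x : ι → ℂ) i :=
  fun _ _ => ⟨Set.univ, fun y => y i, @isOpen_univ _ (zariski ι), trivial,
    affineSpace_regular_coord _ i, fun _ _ _ => rfl⟩

theorem isOpen_sub_iff {S : Set X} (hS : IsOpen[O.top] S) {U : Set X} (hU : U ⊆ S) :
    IsOpen[(O.sub S).top] (Subtype.val ⁻¹' U) ↔ IsOpen[O.top] U := by
  let := O.top
  constructor
  · rintro ⟨U', hU', e⟩
    have : U = U' ∩ S := by
      ext x
      constructor
      · intro hx
        have : (⟨x, hU hx⟩ : S) ∈ Subtype.val ⁻¹' U' := by rw [e]; exact hx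
        exact ⟨this, hU hx⟩
      · rintro ⟨h1, h2⟩
        have : (⟨x, h2⟩ : S) ∈ Subtype.val ⁻¹' U := by rw [← e]; exact h1
        exact this
    rw [this]
    exact hU'.inter hS
  · exact fun h => ⟨U, h, rfl⟩

/-- A morphism with local sections presents its target as a quotient of an affine piece. -/
theorem quot_of_sections (hO : O.HasInverses) {π : X → Y} {S : Set (ι → ℂ)} {q : S → Y}
    (hq : IsMorphism ((affineSpace ι).sub S) (O.quot π) q)
    (hsec : ∀ x, ∃ (U : Set X) (φ : X → ι → ℂ), IsOpen[O.top] U ∧ x ∈ U ∧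
      (∀ i, O.IsRegular U fun x => φ x i) ∧ ∀ y ∈ U, ∃ h : φ y ∈ S, q ⟨φ y, h⟩ = π y) :
    IsMorphism (O.quot π) (((affineSpace ι).sub S).quot q) id ∧
      IsMorphism (((affineSpace ι).sub S).quot q) (O.quot π) id := by
  let := O.top
  refine ⟨⟨fun U hU => ?_, fun U f _ h => O.locality fun x hx => ?_⟩, hq⟩
  · change IsOpen[O.top] (π ⁻¹' U)
    -- Openness is tested locally: near `x` the preimage under `π` is the preimage under the section
    -- `φ` of the preimage under `q`.
    rw [isOpen_iff_forall_mem_open]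
    intro x hx
    obtain ⟨V, φ, hV, hxV, hφ, hs⟩ := hsec x
    refine ⟨_, ?_, isOpen_coord_sub hO hV hφ (fun y hy => (hs y hy).1) hU, hxV, ?_⟩
    · rintro y ⟨hy, h, hyU⟩
      obtain ⟨h', e⟩ := hs y hy
      rw [Set.mem_preimage, ← e]
      exact hyU
    · obtain ⟨h', e⟩ := hs x hxV
      refine ⟨h', ?_⟩
      rw [Set.mem_preimage, e]
      exact hx
  · obtain ⟨V, φ, hV, hxV, hφ, hs⟩ := hsec x
    refine ⟨V, hV, hxV, IsRegular.comp_sub hO hV hφ h fun y hy => ⟨hy.1, ?_⟩⟩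
    obtain ⟨h', e⟩ := hs y hy.1
    refine ⟨h', ?_, ?_⟩
    · show q ⟨φ y, h'⟩ ∈ U
      rw [e]
      exact hy.2
    · simp [e]

theorem IsMorphism.sub_id {P : SpaceWithFunctions X} (h : IsMorphism O P id) (S : Set X) :
    IsMorphism (O.sub S) (P.sub S) id :=
  isMorphism_sub (h.comp (isMorphism_val O S))

/-- A morphism with an inverse on an open piece. -/
theorem isomorphic_sub_of_inverse {U : Set X} {V : Set Y} {φ : X → Y} {ψ : Y → X}
    (hφ : IsMorphism (O.sub U) P fun x => φ x) (hψ : IsMorphism (P.sub V) O fun y => ψ y)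
    (h1 : ∀ x ∈ U, φ x ∈ V ∧ ψ (φ x) = x) (h2 : ∀ y ∈ V, ψ y ∈ U ∧ φ (ψ y) = y) :
    Isomorphic (O.sub U) (P.sub V) :=
  ⟨⟨fun x => ⟨φ x, (h1 x x.2).1⟩, fun y => ⟨ψ y, (h2 y y.2).1⟩,
    fun x => Subtype.ext (h1 x x.2).2, fun y => Subtype.ext (h2 y y.2).2⟩,
    isMorphism_sub hφ, isMorphism_sub hψ⟩

theorem Isomorphic.symm (h : Isomorphic O P) : Isomorphic P O :=
  let ⟨e, h1, h2⟩ := h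
  ⟨e.symm, h2, h1⟩

theorem Isomorphic.trans (h : Isomorphic O P) (h' : Isomorphic P Q) : Isomorphic O Q :=
  let ⟨e, h1, h2⟩ := h
  let ⟨e', h1', h2'⟩ := h'
  ⟨e.trans e', h1'.comp h1, h2.comp h2'⟩

theorem isomorphic_of_id {P : SpaceWithFunctions X} (h : IsMorphism O P id)
    (h' : IsMorphism P O id) : Isomorphic O P := ⟨Equiv.refl X, h, h'⟩

/-- An isomorphism restricts to the preimage of a subset. -/
theorem isomorphic_sub_preimage {e : X ≃ Y} (h1 : IsMorphism O P e) (h2 : IsMorphism P O e.symm)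
    (V : Set Y) : Isomorphic (O.sub (e ⁻¹' V)) (P.sub V) :=
  isomorphic_sub_of_inverse (φ := e) (ψ := e.symm) (h1.comp (isMorphism_val _ _))
    (h2.comp (isMorphism_val _ _)) (fun x hx => ⟨hx, by simp⟩)
    (fun y hy => ⟨by simpa using hy, by simp⟩)

theorem Isomorphic.isAffine (h : Isomorphic O P) (hP : IsAffine P) : IsAffine O :=
  let ⟨m, Z, hZ, h'⟩ := hP
  ⟨m, Z, hZ, h.trans h'⟩

theorem Isomorphic.isHomeomorph (h : Isomorphic O P) :
    ∃ e : X → Y, @IsHomeomorph X Y O.top P.top e := by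
  let := O.top
  let := P.top
  obtain ⟨e, h1, h2⟩ := h
  exact ⟨e, (Homeomorph.mk e ⟨h1.1⟩ ⟨h2.1⟩).isHomeomorph⟩

theorem Isomorphic.dim_eq (h : Isomorphic O P) : O.dim = P.dim := by
  let := O.top
  let := P.top
  obtain ⟨e, he⟩ := h.isHomeomorph
  exact he.topologicalKrullDim_eq

theorem Isomorphic.isSeparated (h : Isomorphic O P) (hP : P.IsSeparated) : O.IsSeparated := by
  obtain ⟨e, h1, -⟩ := h
  intro m Z hZ φ ψ hφ hψ
  have := hP m Z hZ _ _ (h1.comp hφ) (h1.comp hψ)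
  simpa using this

theorem Isomorphic.isVariety (h : Isomorphic O P) (hP : P.IsVariety) : O.IsVariety where
  irreducible := by
    let := O.top
    let := P.top
    have := hP.irreducible
    obtain ⟨e, he⟩ := h.symm.isHomeomorph
    have h1 := IrreducibleSpace.isIrreducible_univ Y
    have h2 := h1.image e he.continuous.continuousOn
    rw [Set.image_univ, he.surjective.range_eq] at h2
    exact (irreducibleSpace_def X).2 h2
  affine_cover := by
    obtain ⟨𝒰, hfin, hcov, h𝒰⟩ := hP.affine_cover
    obtain ⟨e, h1, h2⟩ := h
    refine ⟨(e ⁻¹' ·) '' 𝒰, hfin.image _, ?_, ?_⟩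
    · rw [Set.sUnion_image, ← Set.preimage_iUnion₂, ← Set.sUnion_eq_biUnion, hcov,
        Set.preimage_univ]
    · rintro _ ⟨U, hU, rfl⟩
      exact ⟨h1.1 _ (h𝒰 U hU).1, (isomorphic_sub_preimage h1 h2 U).isAffine (h𝒰 U hU).2⟩
  separated := h.isSeparated hP.separated

/-- Separatedness, if distinct points are separated by sums of products of regular functions that
vanish on the diagonal. -/
theorem isSeparated_of_functions
    (h : ∀ x y : X, x ≠ y → ∃ (U V : Set X) (J : Type) (_ : Fintype J) (f g : J → X → ℂ),
      IsOpen[O.top] U ∧ IsOpen[O.top] V ∧ x ∈ U ∧ y ∈ V ∧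
      (∀ j, O.IsRegular U (f j)) ∧ (∀ j, O.IsRegular V (g j)) ∧
      ∑ j, f j x * g j y ≠ 0 ∧ ∀ z, z ∈ U → z ∈ V → ∑ j, f j z * g j z = 0) :
    O.IsSeparated := by
  intro m Z hZ φ ψ hφ hψ
  have hA := (affineSpace_hasInverses (Fin m)).sub Z
  let := ((affineSpace (Fin m)).sub Z).top
  rw [← isOpen_compl_iff, isOpen_iff_forall_mem_open]
  intro z hz
  obtain ⟨U, V, J, hJ, f, g, hU, hV, hx, hy, hf, hg, hne, hdiag⟩ := h _ _ hz
  have hUV := (hφ.1 U hU).inter (hψ.1 V hV)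
  have hreg : ((affineSpace (Fin m)).sub Z).IsRegular (φ ⁻¹' U ∩ ψ ⁻¹' V)
      (fun z => ∑ j, f j (φ z) * g j (ψ z)) :=
    IsRegular.sum fun j _ => SpaceWithFunctions.mul _
      (SpaceWithFunctions.restrict _ Set.inter_subset_left (hφ.2 U _ hU (hf j)))
      (SpaceWithFunctions.restrict _ Set.inter_subset_right (hψ.2 V _ hV (hg j)))
  refine ⟨_, ?_, hA.isOpen_ne hUV hreg, ⟨hx, hy⟩, hne⟩
  rintro w ⟨⟨h1, h2⟩, h3⟩ (h4 : φ w = ψ w)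
  rw [Set.mem_preimage, ← h4] at h2
  refine h3 ?_
  rw [← h4]
  exact hdiag _ h1 h2

end Morphism

end SpaceWithFunctions

namespace SpaceWithFunctions

variable {X Y Z ι κ : Type*}

/-! ### Open subsets of affine space -/

/-- Each set contains the non-vanishing locus of a non-zero polynomial, and the product of the two
polynomials, being non-zero, does not vanish at some point. -/
theorem zariski_inter_nonempty {V V' : Set (ι → ℂ)} (hV : IsOpen[zariski ι] V)
    (hV' : IsOpen[zariski ι] V') (h : V.Nonempty) (h' : V'.Nonempty) : (V ∩ V').Nonempty := by
  obtain ⟨x, hx⟩ := h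
  obtain ⟨x', hx'⟩ := h'
  obtain ⟨p, hp, hpV⟩ := isOpen_zariski_iff.1 hV x hx
  obtain ⟨p', hp', hpV'⟩ := isOpen_zariski_iff.1 hV' x' hx'
  have h0 : p * p' ≠ 0 := by
    refine mul_ne_zero ?_ ?_
    · rintro rfl
      simp at hp
    · rintro rfl
      simp at hp'
  by_contra hc
  refine h0 (MvPolynomial.funext fun y => ?_)
  by_contra hy
  simp only [map_mul, map_zero, mul_ne_zero_iff] at hy
  exact hc ⟨y, hpV y hy.1, hpV' y hy.2⟩

theorem irreducibleSpace_sub {Ω : Set (ι → ℂ)} (hΩ : IsOpen[zariski ι] Ω) (hne : Ω.Nonempty) :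
    @IrreducibleSpace Ω ((affineSpace ι).sub Ω).top := by
  let := zariski ι
  let := ((affineSpace ι).sub Ω).top
  have : Nonempty Ω := hne.to_subtype
  refine { isPreirreducible_univ := ?_, toNonempty := this }
  rintro _ _ ⟨V, hV, rfl⟩ ⟨V', hV', rfl⟩ ⟨x, -, hx⟩ ⟨x', -, hx'⟩
  obtain ⟨y, ⟨h1, h2⟩, h3, -⟩ := zariski_inter_nonempty (hV.inter hΩ) (hV'.inter hΩ)
    ⟨x, hx, x.2⟩ ⟨x', hx', x'.2⟩
  exact ⟨⟨y, h2⟩, trivial, h1, h3⟩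

theorem irreducibleSpace_of_surjective {O : SpaceWithFunctions X} {P : SpaceWithFunctions Y}
    {φ : X → Y} (hφ : IsMorphism O P φ) (hs : Function.Surjective φ)
    (h : @IrreducibleSpace X O.top) : @IrreducibleSpace Y P.top := by
  let := O.top
  let := P.top
  have h2 := (IrreducibleSpace.isIrreducible_univ X).image φ
    (Continuous.continuousOn ⟨fun V hV => hφ.1 V hV⟩)
  rw [Set.image_univ, hs.range_eq] at h2
  exact (irreducibleSpace_def Y).2 h2

/-- The topology is induced from the prime spectrum of the polynomial ring, and passing to an
induced topology does not raise the Krull dimension. -/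
theorem dim_sub_le [Finite ι] (Ω : Set (ι → ℂ)) :
    ((affineSpace ι).sub Ω).dim ≤ Nat.card ι := by
  let := zariski ι
  let := ((affineSpace ι).sub Ω).top
  have h1 : IsInducing (fun x : Ω => MvPolynomial.pointToPoint (k := ℂ) (x : ι → ℂ)) :=
    IsInducing.comp (g := MvPolynomial.pointToPoint (k := ℂ)) ⟨rfl⟩ ⟨rfl⟩
  refine h1.topologicalKrullDim_le.trans ?_
  rw [PrimeSpectrum.topologicalKrullDim_eq_ringKrullDim]
  simp

/-- A full flag of coordinate subspaces through a point `a` of `Ω`, intersected with `Ω`, is a chain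
of irreducible closed sets of the required length. -/
theorem le_dim_sub [Finite ι] {Ω : Set (ι → ℂ)} (hΩ : IsOpen[zariski ι] Ω) (hne : Ω.Nonempty) :
    Nat.card ι ≤ ((affineSpace ι).sub Ω).dim := by
  let := zariski ι
  let := ((affineSpace ι).sub Ω).top
  obtain ⟨a, ha⟩ := hne
  let e := Finite.equivFin ι
  -- The retraction onto the `j`-th member of the flag, freezing the remaining coordinates at `a`.
  -- Irreducibility of that member is pulled back along `r j` to open sets of affine space.
  let r : ℕ → (ι → ℂ) → (ι → ℂ) := fun j x i => if (e i : ℕ) < j then x i else a i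
  have hrr : ∀ j x, r j (r j x) = r j x := by
    intro j x
    ext i
    simp only [r]
    split_ifs <;> rfl
  have hra : ∀ j, r j a = a := fun j => by
    ext i
    simp [r]
  have hreg : ∀ j i U, (affineSpace ι).IsRegular U (fun x => r j x i) := by
    intro j i U
    simp only [r]
    split_ifs
    · exact affineSpace_regular_coord U i
    · exact SpaceWithFunctions.const _ U (a i)
  have hpre : ∀ j, IsOpen {x | r j x ∈ Ω} := by
    intro j
    simpa using! isOpen_coord (affineSpace_hasInverses ι) isOpen_univ (fun i => hreg j i _) hΩ
  let Z : ℕ → Set Ω := fun j => {x | r j x = x}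
  have hclosed : ∀ j, IsClosed (Z j) := by
    intro j
    have : Z j = ⋂ i, {x : Ω | r j x i - (x : ι → ℂ) i ≠ 0}ᶜ := by
      ext x
      simp only [Z, Set.mem_ofPred_eq, Set.mem_iInter, Set.mem_compl_iff, not_not, sub_eq_zero]
      exact funext_iff
    rw [this]
    refine isClosed_iInter fun i => isClosed_compl_iff.2 ?_
    have h1 : ((affineSpace ι).sub Ω).IsRegular Set.univ
        (fun x : Ω => r j x i - (x : ι → ℂ) i) := by
      refine SpaceWithFunctions.congr _ (fun x _ => (sub_eq_add_neg _ _).symm)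
        (SpaceWithFunctions.add _ ((isMorphism_val _ Ω).2 Set.univ _ isOpen_univ (hreg j i _))
        (sub_regular_coord Set.univ i).neg)
    simpa using! ((affineSpace_hasInverses ι).sub Ω).isOpen_ne isOpen_univ h1
  have hirr : ∀ j, IsIrreducible (Z j) := by
    intro j
    refine ⟨⟨⟨a, ha⟩, hra j⟩, ?_⟩
    rintro _ _ ⟨V, hV, rfl⟩ ⟨V', hV', rfl⟩ ⟨x, hx1, hx2⟩ ⟨x', hx'1, hx'2⟩
    have hp : ∀ V : Set (ι → ℂ), IsOpen V → IsOpen {x | r j x ∈ V} := by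
      intro V hV
      simpa using! isOpen_coord (affineSpace_hasInverses ι) isOpen_univ (fun i => hreg j i _) hV
    obtain ⟨y, ⟨h1, h2⟩, h3, -⟩ := zariski_inter_nonempty ((hp V hV).inter (hpre j))
      ((hp V' hV').inter (hpre j))
      ⟨x, by simpa [hx1.out] using hx2, by simp [hx1.out]⟩
      ⟨x', by simpa [hx'1.out] using hx'2, by simp [hx'1.out]⟩
    exact ⟨⟨r j y, h2⟩, hrr j y, h1, h3⟩
  have hlt : ∀ j, j < Nat.card ι → Z j < Z (j + 1) := by
    intro j hj
    constructor
    · intro x (hx : r j x = x)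
      show r (j + 1) x = x
      ext i
      have := congrFun hx i
      simp only [r] at this ⊢
      split_ifs at this ⊢ <;> first | rfl | omega
    · intro hc
      let i := e.symm ⟨j, hj⟩
      have hopen : IsOpen {x : ι → ℂ | MvPolynomial.eval x (MvPolynomial.X i -
          MvPolynomial.C (a i)) ≠ 0} := isOpen_zariski_ne _
      obtain ⟨y, h1, h2⟩ := zariski_inter_nonempty (hpre (j + 1)) hopen ⟨a, by simp [hra, ha]⟩
        ⟨fun k => a k + 1, by simp⟩
      have h3 : r j (r (j + 1) y) = r (j + 1) y := @hc ⟨r (j + 1) y, h1⟩ (hrr _ y)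
      have h4 := congrFun h3 i
      simp only [r, i, Equiv.apply_symm_apply, lt_irrefl, if_false, lt_add_one, if_true] at h4
      simp only [map_sub, MvPolynomial.eval_X, MvPolynomial.eval_C, Set.mem_ofPred_eq,
        sub_ne_zero] at h2
      exact h2 h4.symm
  let C : Fin (Nat.card ι + 1) → TopologicalSpace.IrreducibleCloseds Ω :=
    fun j => ⟨Z j, hirr j, hclosed j⟩
  have hC : StrictMono C := Fin.strictMono_iff_lt_succ.2 fun j => hlt j j.2
  exact Order.LTSeries.length_le_krullDim (LTSeries.mk (Nat.card ι) C hC)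

theorem dim_sub [Finite ι] {Ω : Set (ι → ℂ)} (hΩ : IsOpen[zariski ι] Ω) (hne : Ω.Nonempty) :
    ((affineSpace ι).sub Ω).dim = Nat.card ι :=
  le_antisymm (dim_sub_le Ω) (le_dim_sub hΩ hne)

/-- All members of a chain of irreducible closed sets meet a chart around a point of the smallest
one, and restriction to that chart keeps the inclusions strict. -/
theorem dim_of_cover {O : SpaceWithFunctions X} (N : ℕ) [Nonempty X]
    (h : ∀ x, ∃ U : Set X, IsOpen[O.top] U ∧ x ∈ U ∧ (O.sub U).dim = N) : O.dim = N := by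
  let := O.top
  refine le_antisymm ?_ ?_
  · refine iSup_le fun l => ?_
    obtain ⟨x, hx⟩ := l.head.isIrreducible.nonempty
    obtain ⟨U, hU, hxU, hd⟩ := h x
    rw [← hd]
    have hU' : IsOpenEmbedding (Subtype.val : U → X) := hU.isOpenEmbedding_subtypeVal
    have hmem : ∀ i, (Subtype.val ⁻¹' (l i : Set X) : Set U).Nonempty := fun i =>
      ⟨⟨x, hxU⟩, l.head_le i hx⟩
    let iso := TopologicalSpace.IrreducibleCloseds.orderIsoOfIsOpenEmbedding _ hU'
    exact Order.LTSeries.length_le_krullDim (LTSeries.mk l.length (fun i => iso.symm ⟨l i, hmem i⟩)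
      fun i j hij => iso.symm.strictMono (l.strictMono hij))
  · obtain ⟨U, hU, hxU, hd⟩ := h (Classical.arbitrary X)
    rw [← hd]
    exact topologicalKrullDim_subspace_le X U

/-- The ideal generated by the polynomials whose non-vanishing locus lies in `Ω` is finitely
generated, with generators among these polynomials. -/
theorem exists_finite_basic_cover [Finite ι] {Ω : Set (ι → ℂ)} (hΩ : IsOpen[zariski ι] Ω) :
    ∃ G : Set (MvPolynomial ι ℂ), G.Finite ∧ (∀ p ∈ G, ∀ x, MvPolynomial.eval x p ≠ 0 → x ∈ Ω) ∧
      ∀ x ∈ Ω, ∃ p ∈ G, MvPolynomial.eval x p ≠ 0 := by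
  let S : Set (MvPolynomial ι ℂ) := {p | ∀ x, MvPolynomial.eval x p ≠ 0 → x ∈ Ω}
  obtain ⟨G, hGS, hG⟩ := (Submodule.fg_span_iff_fg_span_finset_subset S).1
    (IsNoetherian.noetherian (Ideal.span S))
  refine ⟨G, G.finite_toSet, fun p hp => hGS hp, fun x hx => ?_⟩
  obtain ⟨p, hp, hpΩ⟩ := isOpen_zariski_iff.1 hΩ x hx
  by_contra! hc
  have h1 : p ∈ Submodule.span (MvPolynomial ι ℂ) (G : Set (MvPolynomial ι ℂ)) := by
    rw [← hG]
    exact Submodule.subset_span hpΩ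
  have h2 : Ideal.span (G : Set (MvPolynomial ι ℂ)) ≤
      RingHom.ker (MvPolynomial.eval x) := Ideal.span_le.2 fun q hq => hc q hq
  exact hp (h2 h1)

/-- The locus `p ≠ 0` is the hypersurface `p · y = 1` in one more variable. -/
theorem isAffine_basic [Finite ι] (p : MvPolynomial ι ℂ) :
    IsAffine ((affineSpace ι).sub {x | MvPolynomial.eval x p ≠ 0}) := by
  let e := Finite.equivFin ι
  set m := Nat.card ι
  let ψ : (Fin (m + 1) → ℂ) → (ι → ℂ) := fun y i => y (e i).castSucc
  let φ : (ι → ℂ) → (Fin (m + 1) → ℂ) := fun x =>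
    Fin.snoc (fun j => x (e.symm j)) (MvPolynomial.eval x p)⁻¹
  have hψφ : ∀ x, ψ (φ x) = x := fun x => by
    ext i
    simp [ψ, φ]
  let Z : Set (Fin (m + 1) → ℂ) := {y | MvPolynomial.eval (ψ y) p * y (Fin.last m) = 1}
  let := zariski (Fin (m + 1))
  have hA := affineSpace_hasInverses (Fin (m + 1))
  have hψ : ∀ i U, (affineSpace (Fin (m + 1))).IsRegular U fun y => ψ y i := fun i U =>
    affineSpace_regular_coord U _
  refine ⟨m + 1, Z, ?_, ?_⟩
  · rw [← isOpen_compl_iff]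
    have h1 : (affineSpace (Fin (m + 1))).IsRegular Set.univ
        (fun y => MvPolynomial.eval (ψ y) p * y (Fin.last m) + -1) :=
      SpaceWithFunctions.add _ (SpaceWithFunctions.mul _ (IsRegular.eval (fun i => hψ i _) p)
        (affineSpace_regular_coord _ _)) (SpaceWithFunctions.const _ _ (-1))
    have := hA.isOpen_ne isOpen_univ h1
    convert! this using 1
    ext y
    simp [Z, ← sub_eq_add_neg, sub_eq_zero]
  · have hS := (affineSpace_hasInverses ι).sub {x | MvPolynomial.eval x p ≠ 0}
    refine isomorphic_sub_of_inverse (φ := φ) (ψ := ψ) ?_ ?_ ?_ ?_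
    · refine (isMorphism_val _ Set.univ).comp (isMorphism_of_coord (S := Set.univ)
        (φ := fun x => ⟨φ x, trivial⟩)
        hS fun i => ?_)
      refine Fin.lastCases ?_ (fun j => ?_) i
      · simp only [φ, Fin.snoc_last]
        exact hS.inv (IsRegular.eval (fun i => sub_regular_coord _ i) p) fun x _ => x.2
      · simp only [φ, Fin.snoc_castSucc]
        exact sub_regular_coord _ _
    · exact (isMorphism_val _ Set.univ).comp (isMorphism_of_coord (S := Set.univ)
        (φ := fun x => ⟨ψ x, trivial⟩)
        (hA.sub Z) fun i => sub_regular_coord _ _)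
    · intro x hx
      refine ⟨?_, hψφ x⟩
      show MvPolynomial.eval (ψ (φ x)) p * φ x (Fin.last m) = 1
      rw [hψφ]
      simp only [φ, Fin.snoc_last]
      exact mul_inv_cancel₀ hx
    · intro y (hy : MvPolynomial.eval (ψ y) p * y (Fin.last m) = 1)
      refine ⟨left_ne_zero_of_mul_eq_one hy, ?_⟩
      ext j
      refine Fin.lastCases ?_ (fun j => ?_) j
      · simp only [φ, Fin.snoc_last]
        exact inv_eq_of_mul_eq_one_right hy
      · simp [φ, ψ]

/-! ### Spaces covered by open subsets of affine space -/

variable {O : SpaceWithFunctions X}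

theorem isomorphic_sub_sub {S U : Set X} (h : U ⊆ S) :
    Isomorphic ((O.sub S).sub (Subtype.val ⁻¹' U)) (O.sub U) :=
  ⟨⟨fun x => ⟨x.1.1, x.2⟩, fun x => ⟨⟨x.1, h x.2⟩, x.2⟩, fun _ => rfl, fun _ => rfl⟩,
    isMorphism_sub ((isMorphism_val O S).comp (isMorphism_val _ _)),
    isMorphism_sub (isMorphism_sub (isMorphism_val O U))⟩

theorem isomorphic_sub_univ (O : SpaceWithFunctions X) : Isomorphic (O.sub Set.univ) O :=
  ⟨Equiv.Set.univ X, isMorphism_val O _,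
    isMorphism_sub ⟨fun _ h => h, fun _ _ _ h => h⟩⟩

theorem isVariety_of_charts [Finite ι] (hirr : @IrreducibleSpace X O.top) (hsep : O.IsSeparated)
    (𝒰 : Set (Set X)) (hfin : 𝒰.Finite) (hcov : ∀ x, ∃ U ∈ 𝒰, x ∈ U)
    (h𝒰 : ∀ U ∈ 𝒰, IsOpen[O.top] U ∧ ∃ Ω : Set (ι → ℂ), IsOpen[zariski ι] Ω ∧
      Isomorphic (O.sub U) ((affineSpace ι).sub Ω)) :
    O.IsVariety ∧ O.dim = Nat.card ι := by
  let := O.top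
  refine ⟨⟨hirr, ?_, hsep⟩, ?_⟩
  · have key : ∀ U ∈ 𝒰, ∃ 𝒱 : Set (Set X), 𝒱.Finite ∧ U ⊆ ⋃₀ 𝒱 ∧
        ∀ V ∈ 𝒱, IsOpen V ∧ IsAffine (O.sub V) := by
      intro U hU
      obtain ⟨hUo, Ω, hΩ, e, h1, h2⟩ := h𝒰 U hU
      obtain ⟨G, hG, hGΩ, hGcov⟩ := exists_finite_basic_cover hΩ
      let V : MvPolynomial ι ℂ → Set X := fun p =>
        Subtype.val '' (e ⁻¹' (Subtype.val ⁻¹' {x | MvPolynomial.eval x p ≠ 0}))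
      have hVU : ∀ p, Subtype.val ⁻¹' V p =
          e ⁻¹' (Subtype.val ⁻¹' {x | MvPolynomial.eval x p ≠ 0}) := fun p =>
        Set.preimage_image_eq _ Subtype.val_injective
      refine ⟨V '' G, hG.image _, fun x hx => ?_, ?_⟩
      · obtain ⟨p, hp, hpx⟩ := hGcov (e ⟨x, hx⟩) (e ⟨x, hx⟩).2
        exact ⟨V p, ⟨p, hp, rfl⟩, ⟨x, hx⟩, hpx, rfl⟩
      · rintro _ ⟨p, hp, rfl⟩
        have hsub : V p ⊆ U := Subtype.coe_image_subset _ _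
        refine ⟨?_, ?_⟩
        · rw [← isOpen_sub_iff hUo hsub, hVU]
          exact h1.1 _ ⟨_, isOpen_zariski_ne p, rfl⟩
        · refine ((isomorphic_sub_sub hsub).symm.trans ?_).isAffine (isAffine_basic p)
          rw [hVU]
          exact (isomorphic_sub_preimage h1 h2 _).trans (isomorphic_sub_sub (hGΩ p hp))
    choose! 𝒱 h1 h2 h3 using key
    refine ⟨⋃ U ∈ 𝒰, 𝒱 U, hfin.biUnion h1, ?_, ?_⟩
    · rw [Set.eq_univ_iff_forall]
      intro x
      obtain ⟨U, hU, hx⟩ := hcov x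
      obtain ⟨V, hV, hxV⟩ := h2 U hU hx
      exact ⟨V, Set.mem_biUnion hU hV, hxV⟩
    · intro V hV
      obtain ⟨U, hU, hV⟩ := Set.mem_iUnion₂.1 hV
      exact h3 U hU V hV
  · have : Nonempty X := hirr.toNonempty
    refine dim_of_cover _ fun x => ?_
    obtain ⟨U, hU, hx⟩ := hcov x
    obtain ⟨hUo, Ω, hΩ, h⟩ := h𝒰 U hU
    refine ⟨U, hUo, hx, ?_⟩
    rw [h.dim_eq]
    obtain ⟨e, -⟩ := h
    exact dim_sub hΩ ⟨e ⟨x, hx⟩, (e ⟨x, hx⟩).2⟩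

theorem isVariety_sub [Finite ι] {Ω : Set (ι → ℂ)} (hΩ : IsOpen[zariski ι] Ω)
    (hne : Ω.Nonempty) :
    ((affineSpace ι).sub Ω).IsVariety ∧ ((affineSpace ι).sub Ω).dim = Nat.card ι := by
  let := ((affineSpace ι).sub Ω).top
  refine isVariety_of_charts (irreducibleSpace_sub hΩ hne) (isSeparated_of_functions ?_)
    {Set.univ} (Set.finite_singleton _) (by simp) ?_
  · intro x y hxy
    obtain ⟨i, hi⟩ := Function.ne_iff.1 fun h => hxy (Subtype.ext h)
    refine ⟨Set.univ, Set.univ, Fin 2, inferInstance, ![fun x => (x : ι → ℂ) i, fun _ => 1],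
      ![fun _ => 1, fun y => -(y : ι → ℂ) i], isOpen_univ, isOpen_univ, trivial, trivial,
      ?_, ?_, ?_, ?_⟩
    · intro j
      fin_cases j
      exacts [sub_regular_coord _ i, SpaceWithFunctions.const _ _ 1]
    · intro j
      fin_cases j
      exacts [SpaceWithFunctions.const _ _ 1, (sub_regular_coord _ i).neg]
    · simpa [← sub_eq_add_neg, sub_eq_zero] using hi
    · simp
  · rintro _ rfl
    exact ⟨isOpen_univ, Ω, hΩ, isomorphic_sub_univ _⟩

end SpaceWithFunctions

/-! ### Configurations of vectors given by an acyclic elimination -/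

/-- Each `b` expresses the vector at `out b` through the vectors at `tgt b 0` and `tgt b 1`, which
come earlier. -/
structure Elimination (B W : Type*) where
  out : B → W
  tgt : B → Fin 2 → W
  rk : W → ℕ
  out_injective : Function.Injective out
  rk_lt : ∀ b j, rk (tgt b j) < rk (out b)
  tgt_ne : ∀ b, tgt b 0 ≠ tgt b 1

namespace Elimination

open SpaceWithFunctions

variable {B W : Type*} (E : Elimination B W) (d : ℕ)

/-- The elements whose vectors can be chosen freely. -/
def Free : Type _ := {w // w ∉ Set.range E.out}

instance [Finite W] : Finite E.Free := inferInstanceAs (Finite (Subtype _))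

/-- The parameters: the free vectors, and the coefficients. -/
abbrev Param : Type _ := (E.Free × Fin (d + 1)) ⊕ (B × Fin 2)

variable {d}

open Classical in
/-- The configuration of vectors with given parameters. -/
def vec (θ : E.Param d → ℂ) (w : W) : Fin (d + 1) → ℂ :=
  if h : w ∈ Set.range E.out then
    ∑ j, θ (Sum.inr (h.choose, j)) • vec θ (E.tgt h.choose j)
  else fun i => θ (Sum.inl (⟨w, h⟩, i))
termination_by E.rk w
decreasing_by
  rw [← congrArg E.rk h.choose_spec]
  exact E.rk_lt _ _

variable {E}

theorem vec_out (θ : E.Param d → ℂ) (b : B) :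
    E.vec θ (E.out b) = ∑ j, θ (Sum.inr (b, j)) • E.vec θ (E.tgt b j) := by
  have h : E.out b ∈ Set.range E.out := ⟨b, rfl⟩
  rw [vec, dif_pos h, E.out_injective h.choose_spec]

theorem vec_free (θ : E.Param d → ℂ) (f : E.Free) (i : Fin (d + 1)) :
    E.vec θ f.1 i = θ (Sum.inl (f, i)) := by
  rw [vec, dif_neg f.2]
  rfl

/-- Induction along an elimination. -/
theorem induction {p : W → Prop} (free : ∀ f : E.Free, p f.1)
    (out : ∀ b, (∀ j, p (E.tgt b j)) → p (E.out b)) (w : W) : p w := by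
  induction h : E.rk w using Nat.strong_induction_on generalizing w with
  | _ n ih =>
    by_cases hw : w ∈ Set.range E.out
    · obtain ⟨b, rfl⟩ := hw
      exact out b fun j => ih _ (h ▸ E.rk_lt b j) _ rfl
    · exact free ⟨w, hw⟩

theorem eq_vec {θ : E.Param d → ℂ} {v : W → Fin (d + 1) → ℂ}
    (hf : ∀ f i, v f.1 i = θ (Sum.inl (f, i)))
    (ho : ∀ b, v (E.out b) = ∑ j, θ (Sum.inr (b, j)) • v (E.tgt b j)) (w : W) :
    v w = E.vec θ w := by
  induction w using E.induction with
  | free f => exact funext fun i => (hf f i).trans (vec_free θ f i).symm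
  | out b ih => simp only [ho, vec_out, ih]

theorem vec_regular (U : Set (E.Param d → ℂ)) (w : W) (i : Fin (d + 1)) :
    (affineSpace (E.Param d)).IsRegular U fun θ => E.vec θ w i := by
  induction w using E.induction generalizing i with
  | free f =>
    simp only [vec_free]
    exact affineSpace_regular_coord U _
  | out b ih =>
    simp only [vec_out, Finset.sum_apply, Pi.smul_apply, smul_eq_mul]
    exact IsRegular.sum fun j _ =>
      SpaceWithFunctions.mul _ (affineSpace_regular_coord U _) (ih j i)

/-- The `2 × 2` minors of a configuration. -/
def minor (v : W → Fin (d + 1) → ℂ) (a c : W) (r s : Fin (d + 1)) : ℂ :=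
  v a r * v c s - v a s * v c r

theorem minor_regular {X : Type*} {O : SpaceWithFunctions X} {U : Set X}
    {v : X → W → Fin (d + 1) → ℂ} (hv : ∀ w i, O.IsRegular U fun x => v x w i)
    (a c : W) (r s : Fin (d + 1)) : O.IsRegular U fun x => minor (v x) a c r s := by
  refine O.congr (fun x _ => (sub_eq_add_neg _ _).symm)
    (O.add (O.mul (hv a r) (hv c s)) (O.mul (hv a s) (hv c r)).neg)

variable (E) in
/-- The non-degenerate configurations. -/
structure IsConfig (v : W → Fin (d + 1) → ℂ) : Prop where
  ne_zero : ∀ w, v w ≠ 0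
  relation : ∀ b, ∃ k : Fin 2 → ℂ, (∀ j, k j ≠ 0) ∧ v (E.out b) = ∑ j, k j • v (E.tgt b j)
  minor_ne : ∀ b, ∃ r s, minor v (E.tgt b 0) (E.tgt b 1) r s ≠ 0
  span : ∃ I : Fin (d + 1) → E.Free, (Matrix.of fun i j => v (I j).1 i).det ≠ 0

variable (E d) in
/-- The parameters of the non-degenerate configurations. -/
def good : Set (E.Param d → ℂ) := {θ | (∀ e, θ (Sum.inr e) ≠ 0) ∧ E.IsConfig (E.vec θ)}

/-- The parameters of a configuration, by Cramer's rule for the rows `r b` and `s b`. -/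
def cramer (r s : B → Fin (d + 1)) (v : W → Fin (d + 1) → ℂ) : E.Param d → ℂ :=
  Sum.elim (fun x => v x.1.1 x.2) fun e =>
    ![minor v (E.out e.1) (E.tgt e.1 1) (r e.1) (s e.1),
      minor v (E.tgt e.1 0) (E.out e.1) (r e.1) (s e.1)] e.2 *
      (minor v (E.tgt e.1 0) (E.tgt e.1 1) (r e.1) (s e.1))⁻¹

theorem cramer_eq {r s : B → Fin (d + 1)} {v : W → Fin (d + 1) → ℂ} {b : B} {k : Fin 2 → ℂ}
    (hm : minor v (E.tgt b 0) (E.tgt b 1) (r b) (s b) ≠ 0)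
    (hk : v (E.out b) = ∑ j, k j • v (E.tgt b j)) (j : Fin 2) :
    cramer (E := E) r s v (Sum.inr (b, j)) = k j := by
  have h : ∀ i, v (E.out b) i = k 0 * v (E.tgt b 0) i + k 1 * v (E.tgt b 1) i := fun i => by
    rw [hk]
    simp
  simp only [cramer, Sum.elim_inr]
  rw [← div_eq_mul_inv, div_eq_iff hm]
  fin_cases j <;> simp [minor, h] <;> ring

theorem vec_cramer {r s : B → Fin (d + 1)} {v : W → Fin (d + 1) → ℂ}
    (hm : ∀ b, minor v (E.tgt b 0) (E.tgt b 1) (r b) (s b) ≠ 0)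
    (hk : ∀ b, ∃ k : Fin 2 → ℂ, v (E.out b) = ∑ j, k j • v (E.tgt b j)) :
    E.vec (cramer r s v) = v := by
  refine funext fun w => (eq_vec (fun f i => rfl) (fun b => ?_) w).symm
  obtain ⟨k, hk⟩ := hk b
  simp only [cramer_eq (hm b) hk]
  exact hk

theorem cramer_mem_good {r s : B → Fin (d + 1)} {v : W → Fin (d + 1) → ℂ} (hv : E.IsConfig v)
    (hm : ∀ b, minor v (E.tgt b 0) (E.tgt b 1) (r b) (s b) ≠ 0) :
    cramer r s v ∈ E.good d ∧ E.vec (cramer r s v) = v := by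
  have h := vec_cramer hm fun b => (hv.relation b).imp fun k hk => hk.2
  refine ⟨⟨fun ⟨b, j⟩ => ?_, h.symm ▸ hv⟩, h⟩
  obtain ⟨k, hk0, hk⟩ := hv.relation b
  rw [cramer_eq (hm b) hk]
  exact hk0 j

theorem IsConfig.exists_good {v : W → Fin (d + 1) → ℂ} (hv : E.IsConfig v) :
    ∃ θ ∈ E.good d, E.vec θ = v := by
  choose r s h using hv.minor_ne
  exact ⟨_, cramer_mem_good hv h⟩

theorem good_iff {θ : E.Param d → ℂ} : θ ∈ E.good d ↔ (∀ e, θ (Sum.inr e) ≠ 0) ∧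
    (∀ w, ∃ i, E.vec θ w i ≠ 0) ∧
    (∀ b, ∃ r s, minor (E.vec θ) (E.tgt b 0) (E.tgt b 1) r s ≠ 0) ∧
    ∃ I : Fin (d + 1) → E.Free, (Matrix.of fun i j => θ (Sum.inl (I j, i))).det ≠ 0 := by
  simp only [good, Set.mem_ofPred_eq]
  refine and_congr_right fun h0 => ⟨fun h => ⟨fun w => Function.ne_iff.1 (h.ne_zero w), h.minor_ne,
    by simpa only [vec_free] using h.span⟩, fun h => ⟨fun w => Function.ne_iff.2 (h.1 w),
    fun b => ⟨_, fun j => h0 (b, j), vec_out θ b⟩, h.2.1, by simpa only [vec_free] using h.2.2⟩⟩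

theorem isOpen_ne {ι : Type*} {f : (ι → ℂ) → ℂ}
    (hf : (affineSpace ι).IsRegular Set.univ f) : IsOpen[zariski ι] {θ | f θ ≠ 0} := by
  let := zariski ι
  simpa using! (affineSpace_hasInverses ι).isOpen_ne isOpen_univ hf

theorem isOpen_nondegenerate [Finite B] [Finite W] :
    IsOpen[zariski (E.Param d)] {θ | (∀ e, θ (Sum.inr e) ≠ 0) ∧
    (∀ w, ∃ i, E.vec θ w i ≠ 0) ∧
    (∀ b, ∃ r s, minor (E.vec θ) (E.tgt b 0) (E.tgt b 1) r s ≠ 0)} := by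
  let := zariski (E.Param d)
  simp only [Set.ofPred_and, Set.ofPred_forall, Set.ofPred_exists]
  refine (isOpen_iInter_of_finite fun e => isOpen_ne (affineSpace_regular_coord _ _)).inter
    ((isOpen_iInter_of_finite fun w => isOpen_iUnion fun i => isOpen_ne (vec_regular _ w i)).inter
    (isOpen_iInter_of_finite fun b => isOpen_iUnion fun r => isOpen_iUnion fun s =>
      isOpen_ne (minor_regular (fun w i => vec_regular _ w i) _ _ r s)))

theorem isOpen_det (I : Fin (d + 1) → E.Free) : IsOpen[zariski (E.Param d)]
    {θ | (Matrix.of fun i j => θ (Sum.inl (I j, i))).det ≠ 0} :=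
  isOpen_ne (IsRegular.det fun _ _ => affineSpace_regular_coord _ _)

theorem isOpen_good [Finite B] [Finite W] : IsOpen[zariski (E.Param d)] (E.good d) := by
  let := zariski (E.Param d)
  have h : E.good d = {θ | (∀ e, θ (Sum.inr e) ≠ 0) ∧ (∀ w, ∃ i, E.vec θ w i ≠ 0) ∧
      (∀ b, ∃ r s, minor (E.vec θ) (E.tgt b 0) (E.tgt b 1) r s ≠ 0)} ∩
      ⋃ I : Fin (d + 1) → E.Free, {θ | (Matrix.of fun i j => θ (Sum.inl (I j, i))).det ≠ 0} := by
    ext θ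
    rw [good_iff]
    simp [and_assoc]
  rw [h]
  exact isOpen_nondegenerate.inter (isOpen_iUnion fun I => isOpen_det I)

/-- Configurations of distinct points on a line satisfy all conditions but that on the span, so that
these conditions are dense. -/
theorem good_inter_nonempty [Finite B] [Finite W] (hd : 1 ≤ d) {V : Set (E.Param d → ℂ)}
    (hV : IsOpen[zariski (E.Param d)] V) (hne : V.Nonempty)
    (hspan : ∀ θ ∈ V, ∃ I : Fin (d + 1) → E.Free,
      (Matrix.of fun i j => θ (Sum.inl (I j, i))).det ≠ 0) : (E.good d ∩ V).Nonempty := by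
  have hW : ∃ f : W → ℂ, Function.Injective f :=
    ⟨fun w => (Finite.equivFin W w : ℕ), fun w w' h => by
      simpa [Fin.val_inj] using h⟩
  obtain ⟨f, hf⟩ := hW
  -- Distinct points on one affine line. Since `d ≥ 1`, the rows `0` and `Fin.last d` differ, and
  -- their minors are the differences of the values of `f`.
  let v : W → Fin (d + 1) → ℂ := fun w i => if i = 0 then 1 else f w
  have hlast : Fin.last d ≠ 0 := by
    rw [Ne, Fin.ext_iff]
    simp
    omega
  have hminor : ∀ a c, minor v a c 0 (Fin.last d) = f c - f a := fun a c => by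
    simp [minor, v, hlast]
  have hout : ∀ b j, f (E.out b) - f (E.tgt b j) ≠ 0 := fun b j =>
    sub_ne_zero.2 fun h => (E.rk_lt b j).ne (congrArg E.rk (hf h)).symm
  have htgt : ∀ b, f (E.tgt b 1) - f (E.tgt b 0) ≠ 0 := fun b =>
    sub_ne_zero.2 fun h => E.tgt_ne b (hf h).symm
  have hvec : E.vec (cramer (fun _ => 0) (fun _ => Fin.last d) v) = v := by
    refine vec_cramer (fun b => by rw [hminor]; exact htgt b) fun b => ?_
    -- The coefficients of linear interpolation between the two target points.
    refine ⟨![(f (E.out b) - f (E.tgt b 1)) / (f (E.tgt b 0) - f (E.tgt b 1)),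
      (f (E.tgt b 0) - f (E.out b)) / (f (E.tgt b 0) - f (E.tgt b 1))], ?_⟩
    have h0 := htgt b
    have h1 : f (E.tgt b 0) - f (E.tgt b 1) ≠ 0 := by
      rw [← neg_sub]
      exact neg_ne_zero.2 h0
    ext i
    by_cases hi : i = 0
    · simp [v, hi]
      field_simp
      ring
    · simp [v, hi]
      field_simp
      ring
  suffices h : _ by
    obtain ⟨θ, h1, h2⟩ := zariski_inter_nonempty (isOpen_nondegenerate (E := E) (d := d)) hV
      ⟨cramer (fun _ => 0) (fun _ => Fin.last d) v, h⟩ hne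
    exact ⟨θ, good_iff.2 ⟨h1.1, h1.2.1, h1.2.2, hspan θ h2⟩, h2⟩
  refine ⟨?_, ?_, ?_⟩
  · rintro ⟨b, j⟩
    simp only [cramer, Sum.elim_inr, hminor]
    refine mul_ne_zero ?_ (inv_ne_zero (htgt b))
    fin_cases j
    · rw [← neg_ne_zero]
      simpa [sub_eq_zero, eq_comm] using hout b 1
    · simpa using hout b 0
  · rw [hvec]
    exact fun w => ⟨0, by simp [v]⟩
  · rw [hvec]
    exact fun b => ⟨0, Fin.last d, by rw [hminor]; exact htgt b⟩

/-! ### Equivalence of configurations -/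

variable (E) in
/-- The action of rescalings and linear automorphisms in terms of the parameters. -/
def Rel (θ θ' : E.Param d → ℂ) : Prop :=
  ∃ (μ : W → ℂ) (g : Matrix (Fin (d + 1)) (Fin (d + 1)) ℂ), (∀ w, μ w ≠ 0) ∧ g.det ≠ 0 ∧
    (∀ f : E.Free, (fun i => θ' (Sum.inl (f, i))) =
      μ f.1 • g.mulVec fun i => θ (Sum.inl (f, i))) ∧
    ∀ b j, θ' (Sum.inr (b, j)) * μ (E.tgt b j) = μ (E.out b) * θ (Sum.inr (b, j))

theorem Rel.vec_eq {θ θ' : E.Param d → ℂ} {μ : W → ℂ} {g : Matrix (Fin (d + 1)) (Fin (d + 1)) ℂ}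
    (hf : ∀ f : E.Free, (fun i => θ' (Sum.inl (f, i))) =
      μ f.1 • g.mulVec fun i => θ (Sum.inl (f, i)))
    (hk : ∀ b j, θ' (Sum.inr (b, j)) * μ (E.tgt b j) = μ (E.out b) * θ (Sum.inr (b, j)))
    (w : W) : E.vec θ' w = μ w • g.mulVec (E.vec θ w) := by
  have : ∀ (θ : E.Param d → ℂ) (f : E.Free), E.vec θ f.1 = fun i => θ (Sum.inl (f, i)) :=
    fun θ f => funext fun i => vec_free θ f i
  induction w using E.induction with
  | free f =>
    rw [this, this]
    exact hf f
  | out b ih =>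
    rw [vec_out, vec_out, Matrix.mulVec_sum, Finset.smul_sum]
    refine Finset.sum_congr rfl fun j _ => ?_
    rw [ih, smul_smul, hk b j, Matrix.mulVec_smul, smul_smul]

/-- Proportional vectors already determine how the coefficients transform: at each `b` the two
target vectors of `θ'` are independent, so Cramer's rule makes the coefficients unique. -/
theorem rel_iff {θ θ' : E.Param d → ℂ} (hθ' : θ' ∈ E.good d) :
    E.Rel θ θ' ↔ ∃ (μ : W → ℂ) (g : Matrix (Fin (d + 1)) (Fin (d + 1)) ℂ), (∀ w, μ w ≠ 0) ∧
      g.det ≠ 0 ∧ ∀ w, E.vec θ' w = μ w • g.mulVec (E.vec θ w) := by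
  refine exists_congr fun μ => exists_congr fun g => and_congr_right fun hμ =>
    and_congr_right fun hg => ⟨fun h w => ?_, fun h => ⟨fun f => ?_, fun b => ?_⟩⟩
  · exact Rel.vec_eq h.1 h.2 w
  · have : ∀ θ : E.Param d → ℂ, (fun i => θ (Sum.inl (f, i))) = E.vec θ f.1 := fun θ =>
      funext fun i => (vec_free θ f i).symm
    rw [this, this]
    exact h f.1
  · obtain ⟨r, s, hrs⟩ := hθ'.2.minor_ne b
    have h1 : E.vec θ' (E.out b) =
        ∑ j, (μ (E.out b) * θ (Sum.inr (b, j)) * (μ (E.tgt b j))⁻¹) • E.vec θ' (E.tgt b j) := by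
      rw [h, vec_out, Matrix.mulVec_sum, Finset.smul_sum]
      refine Finset.sum_congr rfl fun j _ => ?_
      rw [h, Matrix.mulVec_smul, smul_smul, smul_smul, mul_assoc _ (_⁻¹), inv_mul_cancel₀ (hμ _),
        mul_one]
    intro j
    have h2 := cramer_eq (r := fun _ => r) (s := fun _ => s) hrs h1 j
    have h3 := cramer_eq (r := fun _ => r) (s := fun _ => s) hrs (vec_out θ' b) j
    rw [← h3, h2, mul_assoc, inv_mul_cancel₀ (hμ _), mul_one]

end Elimination

/-! ### Charts of quotients from coordinate slices -/

namespace SpaceWithFunctions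

variable {N ι Y : Type*}

open Classical in
/-- The point of a coordinate slice with given free coordinates. -/
def slicePoint {F : Set N} (r : ι ≃ {n // n ∉ F}) (c : N → ℂ) (ξ : ι → ℂ) (n : N) : ℂ :=
  if h : n ∉ F then ξ (r.symm ⟨n, h⟩) else c n

theorem slicePoint_restrict {F : Set N} (r : ι ≃ {n // n ∉ F}) {c x : N → ℂ}
    (h : ∀ n ∈ F, x n = c n) : slicePoint r c (fun i => x (r i)) = x := by
  ext n
  by_cases hn : n ∈ F
  · simp [slicePoint, hn, h]
  · simp [slicePoint, hn]

theorem slicePoint_apply {F : Set N} (r : ι ≃ {n // n ∉ F}) (c : N → ℂ) (ξ : ι → ℂ) (i : ι) :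
    slicePoint r c ξ (r i) = ξ i := by
  have : (r i : N) ∉ F := (r i).2
  simp [slicePoint, this]

theorem slicePoint_of_mem {F : Set N} (r : ι ≃ {n // n ∉ F}) (c : N → ℂ) (ξ : ι → ℂ) {n : N}
    (h : n ∈ F) : slicePoint r c ξ n = c n := by
  simp [slicePoint, h]

theorem slicePoint_regular {F : Set N} (r : ι ≃ {n // n ∉ F}) (c : N → ℂ) (U : Set (ι → ℂ))
    (n : N) : (affineSpace ι).IsRegular U fun ξ => slicePoint r c ξ n := by
  by_cases h : n ∈ F
  · simp only [slicePoint_of_mem r c _ h]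
    exact SpaceWithFunctions.const _ _ _
  · simp only [slicePoint, h, not_false_eq_true, dif_pos]
    exact affineSpace_regular_coord _ _

/-- A quotient of a part of affine space looks, on an open set, like an open subset of a coordinate
slice that meets every class in at most one point, if there is a regular normalization map to the
slice. -/
theorem exists_slice_chart [Nonempty Y] {S D : Set (N → ℂ)} {q : S → Y} (hqs : Function.Surjective q)
    (hD : IsOpen[zariski N] D) (hDS : D ⊆ S)
    (hsat : ∀ x y : S, q x = q y → x.1 ∈ D → y.1 ∈ D)
    {F : Set N} (r : ι ≃ {n // n ∉ F}) {c : N → ℂ} {ν : (N → ℂ) → N → ℂ}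
    (hreg : ∀ n, (affineSpace N).IsRegular D fun x => ν x n)
    (hν : ∀ x (h : x ∈ D), ∃ h' : ν x ∈ S, q ⟨ν x, h'⟩ = q ⟨x, hDS h⟩)
    (hF : ∀ x ∈ D, ∀ n ∈ F, ν x n = c n)
    (huniq : ∀ x y : S, x.1 ∈ D → y.1 ∈ D → (∀ n ∈ F, x.1 n = c n) → (∀ n ∈ F, y.1 n = c n) →
      q x = q y → x = y) :
    ∃ (U : Set Y) (ξ : Y → N → ℂ), (∀ x : S, q x ∈ U ↔ x.1 ∈ D) ∧
      (∀ x : S, x.1 ∈ D → ξ (q x) = ν x) ∧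
      IsOpen[(((affineSpace N).sub S).quot q).top] U ∧
      (∀ n, (((affineSpace N).sub S).quot q).IsRegular U fun y => ξ y n) ∧
      ∃ Ω : Set (ι → ℂ), IsOpen[zariski ι] Ω ∧
        Isomorphic ((((affineSpace N).sub S).quot q).sub U) ((affineSpace ι).sub Ω) := by
  -- The section is only set-theoretic, which is harmless because `ν` takes the same value on all
  -- representatives in `D` (`hν1`).
  let s := Function.surjInv hqs
  have hs : ∀ y, q (s y) = y := Function.surjInv_eq hqs
  have hνD : ∀ x ∈ D, ν x ∈ D := fun x hx => by
    obtain ⟨h', e⟩ := hν x hx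
    exact hsat ⟨x, hDS hx⟩ ⟨_, h'⟩ e.symm hx
  have hν1 : ∀ x y : S, q x = q y → x.1 ∈ D → ν x = ν y := fun x y h hx => by
    have hy := hsat x y h hx
    obtain ⟨h1, e1⟩ := hν x hx
    obtain ⟨h2, e2⟩ := hν y hy
    exact congrArg Subtype.val (huniq ⟨_, h1⟩ ⟨_, h2⟩ (hνD _ hx) (hνD _ hy) (hF _ hx) (hF _ hy)
      (e1.trans (h.trans e2.symm)))
  have hUD : ∀ x : S, q x ∈ {y | (s y).1 ∈ D} ↔ x.1 ∈ D := fun x =>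
    ⟨hsat _ _ (hs _), hsat _ _ (hs _).symm⟩
  have hpre : q ⁻¹' {y | (s y).1 ∈ D} = Subtype.val ⁻¹' D := Set.ext hUD
  have hξ : ∀ x : S, x.1 ∈ D → ν (s (q x)) = ν x := fun x hx => (hν1 _ _ (hs _).symm hx).symm
  have hU : IsOpen[(((affineSpace N).sub S).quot q).top] {y | (s y).1 ∈ D} := by
    show IsOpen[((affineSpace N).sub S).top] (q ⁻¹' _)
    rw [hpre]
    exact (isMorphism_val _ S).1 D hD
  have hξreg : ∀ n, (((affineSpace N).sub S).quot q).IsRegular {y | (s y).1 ∈ D}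
      fun y => ν (s y) n := fun n => by
    show ((affineSpace N).sub S).IsRegular (q ⁻¹' _) _
    rw [hpre]
    exact SpaceWithFunctions.congr _ (fun x hx => (congrFun (hξ x hx) n).symm)
      ((isMorphism_val _ S).2 D _ hD (hreg n))
  refine ⟨{y | (s y).1 ∈ D}, fun y => ν (s y), hUD, hξ, hU, hξreg, ?_⟩
  let φ : Y → ι → ℂ := fun y i => ν (s y) (r i)
  have hφq : ∀ x : S, x.1 ∈ D → slicePoint r c (φ (q x)) = ν x := fun x hx => by
    rw [← hξ x hx]
    exact slicePoint_restrict r (hF _ ((hUD _).2 hx))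
  classical
  -- Only slice points in `D` matter; the default value is never used there.
  let ψ : (ι → ℂ) → Y := fun ξ =>
    if h : slicePoint r c ξ ∈ S then q ⟨_, h⟩ else Classical.arbitrary Y
  have hψ : ∀ {ξ} (h : slicePoint r c ξ ∈ S), ψ ξ = q ⟨_, h⟩ := fun h => dif_pos h
  have hA := affineSpace_hasInverses ι
  refine ⟨{ξ | slicePoint r c ξ ∈ D}, ?_, isomorphic_sub_of_inverse (φ := φ) (ψ := ψ) ?_ ?_ ?_ ?_⟩
  · let := zariski ι
    simpa using! isOpen_coord hA isOpen_univ (slicePoint_regular r c _) hD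
  · refine (isMorphism_val _ Set.univ).comp (isMorphism_of_coord (S := Set.univ)
      (φ := fun y => ⟨φ y, trivial⟩) ((((affineSpace_hasInverses N).sub S).quot q).sub _)
      fun i => ?_)
    have := (isMorphism_val (((affineSpace N).sub S).quot q) {y | (s y).1 ∈ D}).2 _ _ hU
      (hξreg (r i))
    exact SpaceWithFunctions.restrict _ (fun y _ => y.2) this
  · have := (isMorphism_quot ((affineSpace N).sub S) q).comp (isMorphism_of_coord (S := S)
      (φ := fun ξ : {ξ | slicePoint r c ξ ∈ D} => ⟨slicePoint r c ξ.1, hDS ξ.2⟩)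
      (hA.sub _) fun n => by
        have h1 := (isMorphism_val (affineSpace ι) {ξ | slicePoint r c ξ ∈ D}).2 Set.univ _
          (@isOpen_univ _ (zariski ι)) (slicePoint_regular r c _ n)
        simpa using! h1)
    convert! this using 1
    exact funext fun ξ => hψ _
  · intro y hy
    obtain ⟨h', e⟩ := hν _ hy
    have h1 := hφq (s y) hy
    rw [hs] at h1
    have h2 : slicePoint r c (φ y) ∈ S := h1 ▸ h'
    refine ⟨show slicePoint r c (φ y) ∈ D from h1 ▸ hνD _ hy, ?_⟩
    rw [hψ h2]
    simp only [h1]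
    rw [e]
    exact hs y
  · intro ξ hξD
    rw [hψ (hDS hξD)]
    refine ⟨(hUD ⟨_, _⟩).2 hξD, funext fun i => ?_⟩
    have h1 := hξ ⟨_, hDS hξD⟩ hξD
    obtain ⟨h', e⟩ := hν _ hξD
    have h2 := huniq ⟨_, h'⟩ ⟨_, hDS hξD⟩ (hνD _ hξD) hξD (hF _ hξD)
      (fun n hn => slicePoint_of_mem r c ξ hn) e
    show ν (s (q _)) (r i) = ξ i
    rw [h1, ← slicePoint_apply r c ξ i]
    exact congrFun (congrArg Subtype.val h2) _

end SpaceWithFunctions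

namespace Elimination

open SpaceWithFunctions

variable {B W : Type*} {E : Elimination B W} {d : ℕ}

/-! ### Invariance under rescalings and linear automorphisms -/

theorem minor_eq_zero_iff {v : W → Fin (d + 1) → ℂ} {a c : W} (h : v a ≠ 0) :
    (∀ r s, minor v a c r s = 0) ↔ ∃ t : ℂ, v c = t • v a := by
  constructor
  · intro h0
    obtain ⟨r, hr⟩ := Function.ne_iff.1 h
    refine ⟨v c r / v a r, funext fun s => ?_⟩
    have := h0 r s
    simp only [minor, Pi.zero_apply, Pi.smul_apply, smul_eq_mul] at this hr ⊢
    field_simp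
    linear_combination this
  · rintro ⟨t, ht⟩ r s
    simp only [minor, ht, Pi.smul_apply, smul_eq_mul]
    ring

theorem IsConfig.smul_mulVec {v v' : W → Fin (d + 1) → ℂ} (hv : E.IsConfig v) {μ : W → ℂ}
    {g : Matrix (Fin (d + 1)) (Fin (d + 1)) ℂ} (hμ : ∀ w, μ w ≠ 0) (hg : g.det ≠ 0)
    (h : ∀ w, v' w = μ w • g.mulVec (v w)) : E.IsConfig v' := by
  have hinj : Function.Injective g.mulVec :=
    Matrix.mulVec_injective_iff_isUnit.2 ((Matrix.isUnit_iff_isUnit_det g).2 hg.isUnit)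
  have hne : ∀ w, v' w ≠ 0 := fun w => by
    rw [h]
    refine smul_ne_zero (hμ w) fun h0 => hv.ne_zero w (hinj ?_)
    rw [h0, Matrix.mulVec_zero]
  refine ⟨hne, fun b => ?_, fun b => ?_, ?_⟩
  · obtain ⟨k, hk0, hk⟩ := hv.relation b
    refine ⟨fun j => μ (E.out b) * k j * (μ (E.tgt b j))⁻¹, fun j =>
      mul_ne_zero (mul_ne_zero (hμ _) (hk0 j)) (inv_ne_zero (hμ _)), ?_⟩
    rw [h, hk, Matrix.mulVec_sum, Finset.smul_sum]
    refine Finset.sum_congr rfl fun j _ => ?_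
    rw [h, Matrix.mulVec_smul, smul_smul, smul_smul, mul_assoc _ (_⁻¹), inv_mul_cancel₀ (hμ _),
      mul_one]
  · by_contra! hc
    obtain ⟨t, ht⟩ := (minor_eq_zero_iff (hne _)).1 hc
    obtain ⟨r, s, hrs⟩ := hv.minor_ne b
    refine hrs ((minor_eq_zero_iff (hv.ne_zero _)).2
      ⟨(μ (E.tgt b 1))⁻¹ * (t * μ (E.tgt b 0)), hinj ?_⟩ r s)
    rw [h, h, smul_smul] at ht
    rw [Matrix.mulVec_smul, ← smul_smul, ← ht, smul_smul, inv_mul_cancel₀ (hμ _), one_smul]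
  · obtain ⟨I, hI⟩ := hv.span
    refine ⟨I, ?_⟩
    have : (Matrix.of fun i j => v' (I j).1 i) = g * (Matrix.of fun i j => v (I j).1 i) *
        Matrix.diagonal fun j => μ (I j).1 := by
      ext i j
      rw [Matrix.mul_diagonal]
      simp only [Matrix.of_apply, h, Pi.smul_apply, smul_eq_mul, Matrix.mul_apply, Matrix.mulVec,
        dotProduct]
      ring
    rw [this, Matrix.det_mul, Matrix.det_mul, Matrix.det_diagonal]
    exact mul_ne_zero (mul_ne_zero hg hI) (Finset.prod_ne_zero_iff.2 fun j _ => hμ _)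

theorem Rel.mem_good {θ θ' : E.Param d → ℂ} (h : E.Rel θ θ') (hθ : θ ∈ E.good d) :
    θ' ∈ E.good d := by
  obtain ⟨μ, g, hμ, hg, hf, hk⟩ := h
  refine ⟨fun ⟨b, j⟩ h0 => ?_, hθ.2.smul_mulVec hμ hg (Rel.vec_eq hf hk)⟩
  have := hk b j
  rw [h0, zero_mul, eq_comm, mul_eq_zero] at this
  exact this.elim (hμ _) (hθ.1 _)

/-! ### Charts given by a frame and a tree -/

/-- The starting point of the directed edge labelled by a parameter. -/
def src (n : E.Param d) : W := Sum.elim (fun x => x.1.1) (fun e => E.out e.1) n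

/-- The end point of the directed edge labelled by a parameter, where the coordinates of the free
vectors are taken with respect to the frame `I`. -/
def dst (I : Fin (d + 1) → E.Free) (n : E.Param d) : W :=
  Sum.elim (fun x => (I x.2).1) (fun e => E.tgt e.1 e.2) n

variable (E d) in
/-- A frame, and a spanning tree of directed edges labelled by parameters: `edge w` joins `w` to
a vertex of smaller height. -/
structure Gauge where
  I : Fin (d + 1) → E.Free
  I_injective : Function.Injective I
  root : W
  height : W → ℕ
  edge : W → E.Param d
  edge_spec : ∀ w, w ≠ root → (src (edge w) = w ∧ height (dst I (edge w)) < height w) ∨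
    (dst I (edge w) = w ∧ height (src (edge w)) < height w)
  edge_ne : ∀ w, w ≠ root → ∀ i j, edge w ≠ Sum.inl (I i, j)

/-- The matrix of the frame vectors. -/
def frame (I : Fin (d + 1) → E.Free) (θ : E.Param d → ℂ) : Matrix (Fin (d + 1)) (Fin (d + 1)) ℂ :=
  Matrix.of fun i j => θ (Sum.inl (I j, i))

/-- The parameters with respect to the frame `I`. -/
def coeff (I : Fin (d + 1) → E.Free) (θ : E.Param d → ℂ) : E.Param d → ℂ :=
  Sum.elim (fun x => ((frame I θ)⁻¹.mulVec fun i => θ (Sum.inl (x.1, i))) x.2)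
    fun e => θ (Sum.inr e)

theorem coeff_regular (I : Fin (d + 1) → E.Free) (n : E.Param d) :
    (affineSpace (E.Param d)).IsRegular {θ | (frame I θ).det ≠ 0} fun θ => coeff I θ n := by
  rcases n with ⟨f, j⟩ | e
  · show (affineSpace _).IsRegular _ fun θ => ∑ k, (frame I θ)⁻¹ j k * θ (Sum.inl (f, k))
    exact IsRegular.sum fun k _ => SpaceWithFunctions.mul _
      (IsRegular.inv_matrix (M := frame I) (affineSpace_hasInverses _)
        (fun i j => affineSpace_regular_coord _ (Sum.inl (I j, i)))
        (fun _ h => h) j k) (affineSpace_regular_coord _ (Sum.inl (f, k)))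
  · exact affineSpace_regular_coord _ _

theorem coeff_free (I : Fin (d + 1) → E.Free) (θ : E.Param d → ℂ) (f : E.Free) :
    (fun j => coeff I θ (Sum.inl (f, j))) = (frame I θ)⁻¹.mulVec fun i => θ (Sum.inl (f, i)) :=
  rfl

theorem frame_mulVec_coeff {I : Fin (d + 1) → E.Free} {θ : E.Param d → ℂ}
    (h : (frame I θ).det ≠ 0) (f : E.Free) :
    ((frame I θ).mulVec fun j => coeff I θ (Sum.inl (f, j))) = fun i => θ (Sum.inl (f, i)) := by
  rw [coeff_free, Matrix.mulVec_mulVec, Matrix.mul_nonsing_inv _ h.isUnit, Matrix.one_mulVec]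

theorem coeff_unique {I : Fin (d + 1) → E.Free} {θ : E.Param d → ℂ}
    (h : (frame I θ).det ≠ 0) {f : E.Free} {x : Fin (d + 1) → ℂ}
    (hx : (frame I θ).mulVec x = fun i => θ (Sum.inl (f, i))) :
    (fun j => coeff I θ (Sum.inl (f, j))) = x := by
  rw [coeff_free, ← hx, Matrix.mulVec_mulVec, Matrix.nonsing_inv_mul _ h.isUnit, Matrix.one_mulVec]

theorem coeff_frame {I : Fin (d + 1) → E.Free} {θ : E.Param d → ℂ}
    (h : (frame I θ).det ≠ 0) (i j : Fin (d + 1)) :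
    coeff I θ (Sum.inl (I i, j)) = if i = j then 1 else 0 := by
  have := congrFun (coeff_unique h (f := I i) (x := Pi.single i 1) (by
    ext k
    simp [frame])) j
  rw [this, Pi.single_apply]
  simp only [eq_comm]

theorem coeff_of_frame_eq_one {I : Fin (d + 1) → E.Free} {θ : E.Param d → ℂ}
    (h : frame I θ = 1) : coeff I θ = θ := by
  ext n
  rcases n with ⟨f, j⟩ | e
  · simp [coeff, h]
  · rfl

/-- The torus acts on the parameters with respect to a frame by characters. -/
theorem coeff_of_rel {I : Fin (d + 1) → E.Free} {θ θ' : E.Param d → ℂ} (h : E.Rel θ θ')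
    (hI : (frame I θ).det ≠ 0) : (frame I θ').det ≠ 0 ∧ ∃ μ : W → ℂ, (∀ w, μ w ≠ 0) ∧
      ∀ n, coeff I θ' n * μ (dst I n) = μ (src n) * coeff I θ n := by
  obtain ⟨μ, g, hμ, hg, hf, hk⟩ := h
  -- The linear map acts on the left of the frame and of all free vectors alike, so it drops out of
  -- the coefficients; only the rescalings remain.
  have h1 : frame I θ' = g * frame I θ * Matrix.diagonal fun j => μ (I j).1 := by
    ext i j
    rw [Matrix.mul_diagonal]
    have := congrFun (hf (I j)) i
    simp only [frame, Matrix.of_apply, Matrix.mul_apply, this, Pi.smul_apply, smul_eq_mul,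
      Matrix.mulVec, dotProduct]
    ring
  have h2 : (frame I θ').det ≠ 0 := by
    rw [h1, Matrix.det_mul, Matrix.det_mul, Matrix.det_diagonal]
    exact mul_ne_zero (mul_ne_zero hg hI) (Finset.prod_ne_zero_iff.2 fun j _ => hμ _)
  refine ⟨h2, μ, hμ, ?_⟩
  rintro (⟨f, j⟩ | ⟨b, j⟩)
  · have h3 := coeff_unique h2 (f := f)
      (x := fun j => (μ (I j).1)⁻¹ * (μ f.1 * coeff I θ (Sum.inl (f, j)))) (by
        rw [hf f, ← frame_mulVec_coeff hI f, h1, ← Matrix.mulVec_mulVec, ← Matrix.mulVec_mulVec,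
          ← Matrix.mulVec_smul, ← Matrix.mulVec_smul]
        congr 2
        ext k
        simp [Matrix.mulVec_diagonal, mul_inv_cancel_left₀ (hμ _)])
    have h4 := congrFun h3 j
    rw [h4]
    show _ * μ (I j).1 = μ f.1 * _
    rw [mul_comm, mul_inv_cancel_left₀ (hμ _)]
  · exact hk b j

namespace Gauge

variable (c : Gauge E d)

open Classical in
/-- The rescaling that makes the parameters of all edges of the tree equal to `1`. -/
def scale (θ : E.Param d → ℂ) (w : W) : ℂ :=
  if h : w = c.root then 1 else
    if h' : src (c.edge w) = w ∧ c.height (dst c.I (c.edge w)) < c.height w then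
      scale θ (dst c.I (c.edge w)) * (coeff c.I θ (c.edge w))⁻¹
    else scale θ (src (c.edge w)) * coeff c.I θ (c.edge w)
termination_by c.height w
decreasing_by
  · exact h'.2
  · exact ((c.edge_spec w h).resolve_left h').2

/-- The domain of a chart. -/
def dom : Set (E.Param d → ℂ) :=
  {θ | (frame c.I θ).det ≠ 0 ∧ ∀ w, w ≠ c.root → coeff c.I θ (c.edge w) ≠ 0}

theorem induction {p : W → Prop} (root : p c.root)
    (edge_src : ∀ w, w ≠ c.root → src (c.edge w) = w → p (dst c.I (c.edge w)) → p w)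
    (edge_dst : ∀ w, w ≠ c.root → dst c.I (c.edge w) = w → p (src (c.edge w)) → p w) (w : W) :
    p w := by
  induction h : c.height w using Nat.strong_induction_on generalizing w with
  | _ m ih =>
    by_cases hw : w = c.root
    · exact hw ▸ root
    · rcases c.edge_spec w hw with h' | h'
      · exact edge_src w hw h'.1 (ih _ (h ▸ h'.2) _ rfl)
      · exact edge_dst w hw h'.1 (ih _ (h ▸ h'.2) _ rfl)

variable {c}

theorem scale_root (θ : E.Param d → ℂ) : c.scale θ c.root = 1 := by
  rw [scale, dif_pos rfl]

/-- Both branches in the recursion for `scale` solve this one equation, for its unknown at the upper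
end of the edge. -/
theorem scale_edge {θ : E.Param d → ℂ} (hθ : θ ∈ c.dom) {w : W} (hw : w ≠ c.root) :
    c.scale θ (src (c.edge w)) * coeff c.I θ (c.edge w) = c.scale θ (dst c.I (c.edge w)) := by
  have h0 := hθ.2 w hw
  by_cases h : src (c.edge w) = w ∧ c.height (dst c.I (c.edge w)) < c.height w
  · have : c.scale θ w = c.scale θ (dst c.I (c.edge w)) * (coeff c.I θ (c.edge w))⁻¹ := by
      rw [scale, dif_neg hw, dif_pos h]
    rw [h.1, this, mul_assoc, inv_mul_cancel₀ h0, mul_one]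
  · have : c.scale θ w = c.scale θ (src (c.edge w)) * coeff c.I θ (c.edge w) := by
      rw [scale, dif_neg hw, dif_neg h]
    rw [((c.edge_spec w hw).resolve_left h).1, this]

theorem scale_ne_zero {θ : E.Param d → ℂ} (hθ : θ ∈ c.dom) (w : W) : c.scale θ w ≠ 0 := by
  induction w using c.induction with
  | root => simp [scale_root]
  | edge_src w hw h ih =>
    rw [← scale_edge hθ hw, h] at ih
    exact left_ne_zero_of_mul ih
  | edge_dst w hw h ih =>
    have h1 := scale_edge hθ hw
    rw [h] at h1
    rw [← h1]
    exact mul_ne_zero ih (hθ.2 w hw)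

theorem scale_regular (w : W) :
    (affineSpace (E.Param d)).IsRegular c.dom fun θ => c.scale θ w := by
  have hc : ∀ n, (affineSpace (E.Param d)).IsRegular c.dom fun θ => coeff c.I θ n := fun n =>
    SpaceWithFunctions.restrict _ (fun _ h => h.1) (coeff_regular c.I n)
  induction w using c.induction with
  | root =>
    simp only [scale_root]
    exact SpaceWithFunctions.const _ _ _
  | edge_src w hw h ih =>
    refine SpaceWithFunctions.congr _ (fun θ hθ => ?_) (SpaceWithFunctions.mul _ ih
      ((affineSpace_hasInverses _).inv (hc (c.edge w)) fun θ hθ => hθ.2 w hw))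
    have h1 := scale_edge hθ hw
    rw [h] at h1
    simp only [Pi.mul_apply, Pi.inv_apply]
    rw [← h1, mul_assoc, mul_inv_cancel₀ (hθ.2 w hw), mul_one]
  | edge_dst w hw h ih =>
    refine SpaceWithFunctions.congr _ (fun θ hθ => ?_) (SpaceWithFunctions.mul _ ih (hc (c.edge w)))
    have h1 := scale_edge hθ hw
    rw [h] at h1
    exact h1

variable (c)

/-- The normalization of parameters by a gauge. -/
def normalize (θ : E.Param d → ℂ) (n : E.Param d) : ℂ :=
  c.scale θ (src n) * coeff c.I θ n * (c.scale θ (dst c.I n))⁻¹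

variable {c}

theorem normalize_regular (n : E.Param d) :
    (affineSpace (E.Param d)).IsRegular c.dom fun θ => c.normalize θ n :=
  SpaceWithFunctions.mul _ (SpaceWithFunctions.mul _ (scale_regular _)
    (SpaceWithFunctions.restrict _ (fun _ h => h.1) (coeff_regular c.I n)))
    ((affineSpace_hasInverses _).inv (scale_regular _) fun _ h => scale_ne_zero h _)

theorem normalize_edge {θ : E.Param d → ℂ} (hθ : θ ∈ c.dom) {w : W} (hw : w ≠ c.root) :
    c.normalize θ (c.edge w) = 1 := by
  rw [normalize, scale_edge hθ hw, mul_inv_cancel₀ (scale_ne_zero hθ _)]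

theorem normalize_frame {θ : E.Param d → ℂ} (hθ : θ ∈ c.dom) (i j : Fin (d + 1)) :
    c.normalize θ (Sum.inl (c.I i, j)) = if i = j then 1 else 0 := by
  rw [normalize, coeff_frame hθ.1]
  split_ifs with h
  · rw [h, mul_one]
    exact mul_inv_cancel₀ (scale_ne_zero hθ _)
  · simp

theorem rel_normalize {θ : E.Param d → ℂ} (hθ : θ ∈ c.dom) : E.Rel θ (c.normalize θ) := by
  have h0 := scale_ne_zero hθ
  -- The inverse frame passes to frame coordinates, and the diagonal factor undoes the rescaling of
  -- the frame vectors, so that the frame becomes the identity.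
  refine ⟨c.scale θ, Matrix.diagonal (fun j => (c.scale θ (c.I j).1)⁻¹) * (frame c.I θ)⁻¹, h0, ?_,
    fun f => ?_, fun b j => ?_⟩
  · rw [Matrix.det_mul, Matrix.det_diagonal, Matrix.det_nonsing_inv, Ring.inverse_eq_inv']
    exact mul_ne_zero (Finset.prod_ne_zero_iff.2 fun j _ => inv_ne_zero (h0 _)) (inv_ne_zero hθ.1)
  · rw [← Matrix.mulVec_mulVec, ← coeff_free]
    ext j
    rw [Pi.smul_apply, Matrix.mulVec_diagonal, smul_eq_mul]
    simp only [normalize, src, dst, Sum.elim_inl]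
    ring
  · exact inv_mul_cancel_right₀ (h0 (E.tgt b j)) _

theorem mem_dom_of_rel {θ θ' : E.Param d → ℂ} (h : E.Rel θ θ') (hθ : θ ∈ c.dom) : θ' ∈ c.dom := by
  obtain ⟨h1, μ, hμ, h2⟩ := coeff_of_rel h hθ.1
  refine ⟨h1, fun w hw h0 => ?_⟩
  have := h2 (c.edge w)
  rw [h0, zero_mul, eq_comm, mul_eq_zero] at this
  exact this.elim (hμ _) (hθ.2 w hw)

theorem isOpen_dom [Finite W] : IsOpen[zariski (E.Param d)] c.dom := by
  let := zariski (E.Param d)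
  have h0 : IsOpen {θ : E.Param d → ℂ | (frame c.I θ).det ≠ 0} := isOpen_det c.I
  have h : c.dom = {θ | (frame c.I θ).det ≠ 0} ∩ ⋂ w : {w // w ≠ c.root},
      {θ | θ ∈ {θ | (frame c.I θ).det ≠ 0} ∧ coeff c.I θ (c.edge w) ≠ 0} := by
    ext θ
    simp only [dom, Set.mem_ofPred_eq, Set.mem_inter_iff, Set.mem_iInter, Subtype.forall]
    exact ⟨fun h => ⟨h.1, fun w hw => ⟨h.1, h.2 w hw⟩⟩, fun h => ⟨h.1, fun w hw => (h.2 w hw).2⟩⟩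
  rw [h]
  exact h0.inter (isOpen_iInter_of_finite fun w =>
    (affineSpace_hasInverses _).isOpen_ne h0 (coeff_regular c.I _))

theorem dom_nonempty : c.dom.Nonempty := by
  classical
  -- The identity matrix on the frame and `1` elsewhere; `edge_ne` keeps the tree away from the
  -- frame entries, some of which are zero.
  let θ : E.Param d → ℂ := fun n =>
    if h : ∃ i j, n = Sum.inl (c.I i, j) then if h.choose = h.choose_spec.choose then 1 else 0
    else 1
  have h1 : frame c.I θ = 1 := by
    ext j i
    have h : ∃ i' j', (Sum.inl (c.I i, j) : E.Param d) = Sum.inl (c.I i', j') := ⟨i, j, rfl⟩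
    have h2 := h.choose_spec.choose_spec
    rw [Sum.inl.injEq, Prod.mk.injEq] at h2
    have h3 := c.I_injective h2.1
    show θ (Sum.inl (c.I i, j)) = _
    simp only [θ]
    rw [dif_pos h, ← h2.2, ← h3, Matrix.one_apply]
    simp only [eq_comm]
  refine ⟨θ, by rw [h1, Matrix.det_one]; exact one_ne_zero, fun w hw => ?_⟩
  rw [coeff_of_frame_eq_one h1]
  simp only [θ]
  rw [dif_neg fun ⟨i, j, h⟩ => c.edge_ne w hw i j h]
  exact one_ne_zero

theorem good_inter_dom_nonempty [Finite B] [Finite W] (hd : 1 ≤ d) :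
    (E.good d ∩ c.dom).Nonempty :=
  good_inter_nonempty hd isOpen_dom dom_nonempty fun _ h => ⟨c.I, h.1⟩

/-- Normalized parameters in the same class are equal. -/
theorem eq_of_rel {θ θ' : E.Param d → ℂ} (h : E.Rel θ θ') (h1 : frame c.I θ = 1)
    (h1' : frame c.I θ' = 1) (he : ∀ w, w ≠ c.root → θ (c.edge w) = 1)
    (he' : ∀ w, w ≠ c.root → θ' (c.edge w) = 1) : θ = θ' := by
  obtain ⟨-, μ, hμ, h2⟩ := coeff_of_rel (I := c.I) h (by rw [h1, Matrix.det_one]; exact one_ne_zero)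
  rw [coeff_of_frame_eq_one h1, coeff_of_frame_eq_one h1'] at h2
  -- An edge with value `1` on both sides forces equal scalings at its ends, so `μ` is constant
  -- along the spanning tree and cancels in every character.
  have hμ' : ∀ w, μ w = μ c.root := fun w => by
    induction w using c.induction with
    | root => rfl
    | edge_src w hw h ih =>
      have := h2 (c.edge w)
      rwa [he w hw, he' w hw, one_mul, mul_one, h, ih, eq_comm] at this
    | edge_dst w hw h ih =>
      have := h2 (c.edge w)
      rwa [he w hw, he' w hw, one_mul, mul_one, h, ih] at this
  ext n
  have := h2 n
  rw [hμ', hμ' (src n), mul_comm] at this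
  exact (mul_left_cancel₀ (hμ _) this).symm

variable (c)

/-- The parameters fixed by the normalization. -/
def fixed : (Fin (d + 1) × Fin (d + 1)) ⊕ {w // w ≠ c.root} → E.Param d :=
  Sum.elim (fun x => Sum.inl (c.I x.1, x.2)) fun w => c.edge w

theorem fixed_injective : Function.Injective c.fixed := by
  rintro (⟨i, j⟩ | ⟨w, hw⟩) (⟨i', j'⟩ | ⟨w', hw'⟩) h
  · simp only [fixed, Sum.elim_inl, Sum.inl.injEq, Prod.mk.injEq] at h
    rw [c.I_injective h.1, h.2]
  · exact (c.edge_ne w' hw' i j h.symm).elim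
  · exact (c.edge_ne w hw i' j' h).elim
  · have h : c.edge w = c.edge w' := h
    suffices w = w' by subst this; rfl
    have h1 := c.edge_spec w hw
    have h2 := c.edge_spec w' hw'
    rw [← h] at h2
    by_contra hne
    rcases h1 with ⟨h1, h1'⟩ | ⟨h1, h1'⟩ <;> rcases h2 with ⟨h2, h2'⟩ | ⟨h2, h2'⟩
    · exact hne (h1.symm.trans h2)
    · rw [h2] at h1'
      rw [h1] at h2'
      exact lt_asymm h1' h2'
    · rw [h2] at h1'
      rw [h1] at h2'
      exact lt_asymm h1' h2'
    · exact hne (h1.symm.trans h2)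

/-- The dimension count: from all parameters, `(d + 1) ^ 2` are removed for the frame and `|W| - 1`
for the tree, one edge for each vertex but the root. -/
theorem card_not_fixed [Finite B] [Finite W] :
    Nat.card {n // n ∉ Set.range c.fixed} + (d + 1) ^ 2 + Nat.card W =
      Nat.card E.Free * (d + 1) + 2 * Nat.card B + 1 := by
  classical
  have h1 : Nat.card (Set.range c.fixed) = (d + 1) * (d + 1) + Nat.card {w // w ≠ c.root} := by
    rw [Nat.card_range_of_injective c.fixed_injective, Nat.card_sum, Nat.card_prod, Nat.card_fin]
  have h2 : Nat.card {w // w ≠ c.root} + 1 = Nat.card W := by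
    rw [← Finite.card_option]
    exact Nat.card_congr (Equiv.optionSubtypeNe c.root)
  have h3 : Nat.card (Set.range c.fixed) + Nat.card {n // n ∉ Set.range c.fixed} =
      Nat.card (E.Param d) := by
    rw [← Nat.card_sum]
    exact Nat.card_congr (Equiv.sumCompl _)
  have h4 : Nat.card (E.Param d) = Nat.card E.Free * (d + 1) + Nat.card B * 2 := by
    rw [Nat.card_sum, Nat.card_prod, Nat.card_prod, Nat.card_fin, Nat.card_fin]
  nlinarith

/-- The normal form of a class defines a chart. -/
theorem exists_chart [Finite B] [Finite W] {Y ι : Type*} [Nonempty Y] {q : E.good d → Y}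
    (hqs : Function.Surjective q) (hq : ∀ x y, q x = q y ↔ E.Rel x.1 y.1)
    (r : ι ≃ {n // n ∉ Set.range c.fixed}) :
    ∃ (U : Set Y) (ξ : Y → E.Param d → ℂ), (∀ x : E.good d, q x ∈ U ↔ x.1 ∈ c.dom) ∧
      (∀ x : E.good d, x.1 ∈ c.dom → ξ (q x) = c.normalize x) ∧
      IsOpen[(((affineSpace (E.Param d)).sub (E.good d)).quot q).top] U ∧
      (∀ n, (((affineSpace (E.Param d)).sub (E.good d)).quot q).IsRegular U fun y => ξ y n) ∧
      ∃ Ω : Set (ι → ℂ), IsOpen[zariski ι] Ω ∧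
        Isomorphic ((((affineSpace (E.Param d)).sub (E.good d)).quot q).sub U)
          ((affineSpace ι).sub Ω) := by
  let := zariski (E.Param d)
  -- The prescribed values on the slice; the default `0` is never read, as it concerns only unfixed
  -- parameters.
  let value := Function.extend c.fixed
    (Sum.elim (fun x => if x.1 = x.2 then 1 else 0) fun _ => (1 : ℂ)) 0
  have hv := c.fixed_injective.extend_apply
    (Sum.elim (fun x => if x.1 = x.2 then 1 else 0) fun _ => (1 : ℂ)) 0
  have hfr : ∀ θ : E.Param d → ℂ, (∀ n ∈ Set.range c.fixed, θ n = value n) →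
      frame c.I θ = 1 := fun θ h => by
    ext j i
    refine (h _ ⟨Sum.inl (i, j), rfl⟩).trans ((hv _).trans ?_)
    simp only [Sum.elim_inl, Matrix.one_apply, eq_comm]
  have hed : ∀ θ : E.Param d → ℂ, (∀ n ∈ Set.range c.fixed, θ n = value n) →
      ∀ w, w ≠ c.root → θ (c.edge w) = 1 := fun θ h w hw =>
    (h _ ⟨Sum.inr ⟨w, hw⟩, rfl⟩).trans (hv _)
  obtain ⟨U, ξ, h1, h2, h3, h4, h5⟩ := exists_slice_chart (S := E.good d) (D := E.good d ∩ c.dom)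
    hqs (isOpen_good.inter isOpen_dom) Set.inter_subset_left
    (fun x y h hx => ⟨y.2, mem_dom_of_rel ((hq _ _).1 h) hx.2⟩) r (c := value) (ν := c.normalize)
    (fun n => SpaceWithFunctions.restrict _ Set.inter_subset_right (normalize_regular n))
    (fun x hx => ⟨(rel_normalize hx.2).mem_good hx.1,
      ((hq ⟨x, hx.1⟩ ⟨_, _⟩).2 (rel_normalize hx.2)).symm⟩)
    (fun x hx n hn => by
      obtain ⟨⟨i, j⟩ | ⟨w, hw⟩, rfl⟩ := hn
      · exact (normalize_frame hx.2 i j).trans (hv (Sum.inl (i, j))).symm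
      · exact (normalize_edge hx.2 hw).trans (hv (Sum.inr ⟨w, hw⟩)).symm)
    (fun x y _ _ hx hy h => Subtype.ext (eq_of_rel ((hq _ _).1 h) (hfr _ hx) (hfr _ hy) (hed _ hx)
      (hed _ hy)))
  exact ⟨U, ξ, fun x => (h1 x).trans (and_iff_right x.2), fun x hx => h2 x ⟨x.2, hx⟩, h3, h4, h5⟩

end Gauge
end Elimination

namespace Elimination

open SpaceWithFunctions

variable {B W : Type*} {E : Elimination B W} {d : ℕ}

/-! ### The moduli space of a connected diagram -/

variable (E) in
/-- A spanning tree with edges from `out b` to `tgt b j`. -/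
structure Tree where
  root : W
  height : W → ℕ
  edge : W → B × Fin 2
  edge_spec : ∀ w, w ≠ root →
    (E.out (edge w).1 = w ∧ height (E.tgt (edge w).1 (edge w).2) < height w) ∨
    (E.tgt (edge w).1 (edge w).2 = w ∧ height (E.out (edge w).1) < height w)

variable (E) in
/-- The graph on `W` with edges from `out b` to `tgt b j`. -/
def graph : SimpleGraph W := SimpleGraph.fromRel fun w w' => ∃ b j, w = E.out b ∧ w' = E.tgt b j

/-- A breadth-first tree: the height is the distance to the root, and `edge w` is the first edge of
a shortest walk. Nontriviality of `W` makes `B` non-empty, which provides the irrelevant value of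
`edge` at the root. -/
theorem nonempty_tree [Nontrivial W] (h : E.graph.Connected) : Nonempty E.Tree := by
  have : Nonempty B := by
    obtain ⟨w, w', hne⟩ := exists_pair_ne W
    obtain ⟨p⟩ := h.preconnected w w'
    cases p with
    | nil => exact (hne rfl).elim
    | cons hv _ =>
      obtain ⟨-, ⟨b, -⟩ | ⟨b, -⟩⟩ := (SimpleGraph.fromRel_adj _ _ _).1 hv <;> exact ⟨b⟩
  obtain ⟨root⟩ := h.nonempty
  have key : ∀ w, ∃ e : B × Fin 2, w ≠ root →
      (E.out e.1 = w ∧ E.graph.dist (E.tgt e.1 e.2) root < E.graph.dist w root) ∨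
      (E.tgt e.1 e.2 = w ∧ E.graph.dist (E.out e.1) root < E.graph.dist w root) := by
    intro w
    obtain ⟨p, hp⟩ := h.exists_walk_length_eq_dist w root
    cases p with
    | nil => exact ⟨(Classical.arbitrary B, 0), fun h => (h rfl).elim⟩
    | @cons _ v _ hv p =>
      have h1 : E.graph.dist v root < E.graph.dist w root :=
        (SimpleGraph.dist_le p).trans_lt (by rw [← hp, SimpleGraph.Walk.length_cons]; omega)
      obtain ⟨-, ⟨b, j, rfl, rfl⟩ | ⟨b, j, rfl, rfl⟩⟩ := (SimpleGraph.fromRel_adj _ _ _).1 hv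
      · exact ⟨(b, j), fun _ => Or.inl ⟨rfl, h1⟩⟩
      · exact ⟨(b, j), fun _ => Or.inr ⟨rfl, h1⟩⟩
  choose e he using key
  exact ⟨root, fun w => E.graph.dist w root, e, he⟩

/-- The gauge given by a frame and a spanning tree. -/
def Tree.gauge (t : E.Tree) (I : Fin (d + 1) → E.Free) (hI : Function.Injective I) :
    Gauge E d where
  I := I
  I_injective := hI
  root := t.root
  height := t.height
  edge w := Sum.inr (t.edge w)
  edge_spec := t.edge_spec
  edge_ne _ _ _ _ := Sum.inr_ne_inl

theorem injective_of_det_ne_zero {I : Fin (d + 1) → E.Free} {θ : E.Param d → ℂ}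
    (h : (frame I θ).det ≠ 0) : Function.Injective I := by
  intro i j hij
  by_contra hne
  exact h (Matrix.det_zero_of_column_eq hne fun k => by simp [frame, hij])

/-- The tree consists of coefficients and does not involve the frame, so normal forms for different
frames differ by a constant rescaling and a change of frame, which is the inverse of `frame J ξ`.
The resulting equations are sums of products of a function of `ξ` and a function of `η`, as the
separatedness criterion requires. -/
theorem Tree.rel_iff (t : E.Tree) {I J : Fin (d + 1) → E.Free} {ξ η : E.Param d → ℂ}
    (hξ : frame I ξ = 1) (hη : frame J η = 1)
    (hξ' : ∀ w, w ≠ t.root → ξ (Sum.inr (t.edge w)) = 1)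
    (hη' : ∀ w, w ≠ t.root → η (Sum.inr (t.edge w)) = 1) :
    E.Rel ξ η ↔ (∀ e, ξ (Sum.inr e) = η (Sum.inr e)) ∧
      ∀ f i, ξ (Sum.inl (f, i)) = ∑ j, ξ (Sum.inl (J j, i)) * η (Sum.inl (f, j)) := by
  have hdet : ∀ {I : Fin (d + 1) → E.Free} {θ : E.Param d → ℂ}, frame I θ = 1 →
      (frame I θ).det ≠ 0 := fun h => by rw [h, Matrix.det_one]; exact one_ne_zero
  constructor
  · rintro ⟨μ, g, hμ, hg, hf, hk⟩
    have h1 : ∀ w, μ w = μ t.root := fun w => by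
      induction w using (t.gauge I (injective_of_det_ne_zero (hdet hξ))).induction with
      | root => rfl
      | edge_src w hw h ih =>
        have h2 := hk (t.edge w).1 (t.edge w).2
        rw [hξ' w hw, hη' w hw, one_mul, mul_one] at h2
        exact (congrArg μ h).symm.trans (h2.symm.trans ih)
      | edge_dst w hw h ih =>
        have h2 := hk (t.edge w).1 (t.edge w).2
        rw [hξ' w hw, hη' w hw, one_mul, mul_one] at h2
        exact (congrArg μ h).symm.trans (h2.trans ih)
    refine ⟨fun e => ?_, fun f i => ?_⟩
    · have h2 := hk e.1 e.2
      rw [h1, h1 (E.out _), mul_comm] at h2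
      exact (mul_left_cancel₀ (hμ _) h2).symm
    · have h3 : (μ t.root • g) * frame J ξ = 1 := by
        rw [← hη]
        ext i j
        have := congrFun (hf (J j)) i
        rw [h1] at this
        simp only [frame, Matrix.of_apply, this, Matrix.mul_apply, Matrix.smul_apply, smul_eq_mul,
          Pi.smul_apply, Matrix.mulVec, dotProduct, Finset.mul_sum, mul_assoc]
      have h4 : (frame J ξ).mulVec (fun j => η (Sum.inl (f, j))) = fun i => ξ (Sum.inl (f, i)) := by
        rw [hf f, h1, ← Matrix.smul_mulVec, Matrix.mulVec_mulVec, mul_eq_one_comm.1 h3,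
          Matrix.one_mulVec]
      exact (congrFun h4 i).symm
  · rintro ⟨h1, h2⟩
    have h3 : frame J ξ * frame I η = 1 := by
      rw [← hξ]
      ext i j
      exact (h2 (I j) i).symm
    have h4 := mul_eq_one_comm.1 h3
    refine ⟨fun _ => 1, frame I η, fun _ => one_ne_zero, left_ne_zero_of_mul (b := (frame J ξ).det)
      (by rw [← Matrix.det_mul, h4, Matrix.det_one]; exact one_ne_zero), fun f => ?_, fun b j => ?_⟩
    · have h5 : (fun i => ξ (Sum.inl (f, i))) =
          (frame J ξ).mulVec fun j => η (Sum.inl (f, j)) := funext (h2 f)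
      rw [one_smul, h5, Matrix.mulVec_mulVec, h4, Matrix.one_mulVec]
    · rw [mul_one, one_mul, h1]

theorem exists_frame_index [Finite W] (h : d + 1 ≤ Nat.card E.Free) :
    ∃ I : Fin (d + 1) → E.Free, Function.Injective I :=
  ⟨fun i => (Finite.equivFin E.Free).symm (Fin.castLE h i), fun i j hij => by simpa using hij⟩

theorem Gauge.exists_equiv [Finite B] [Finite W] (c : Gauge E d) {N : ℕ}
    (hN : N + (d + 1) ^ 2 + Nat.card W = Nat.card E.Free * (d + 1) + 2 * Nat.card B + 1) :
    Nonempty (Fin N ≃ {n // n ∉ Set.range c.fixed}) := by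
  have := c.card_not_fixed
  exact ⟨(Finite.equivFinOfCardEq (by omega)).symm⟩

open Classical in
/-- A gauge given by a projective frame of free vectors. -/
theorem exists_gauge [Finite W] (h : d + 2 ≤ Nat.card E.Free) : Nonempty (Gauge E d) := by
  obtain ⟨I', hI'⟩ := exists_frame_index (d := d + 1) h
  let f₀ := I' (Fin.last (d + 1))
  let I : Fin (d + 1) → E.Free := fun i => I' i.castSucc
  have hI : Function.Injective I := hI'.comp (Fin.castSucc_injective _)
  have hf₀ : ∀ i, I i ≠ f₀ := fun i h => (Fin.castSucc_lt_last i).ne (hI' h)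
  -- The tree has root `f₀` and four levels or more: the frame vectors hang on `f₀` by its own `d +
  -- 1` coordinates, the other free vectors on `I 0` by their coordinate `0`, and each `out b` on
  -- `tgt b 0`. The offset `3` puts all dependent vectors above the free ones.
  let height : W → ℕ := fun w =>
    if w ∈ Set.range E.out then 3 + E.rk w else if w = f₀.1 then 0 else
      if ∃ i, (I i).1 = w then 1 else 2
  have h0 : height f₀.1 = 0 := by simp only [height, if_neg f₀.2, if_pos]
  have h1 : ∀ i, height (I i).1 = 1 := fun i => by
    simp only [height]
    rw [if_neg (I i).2, if_neg fun h => hf₀ i (Subtype.ext h), if_pos ⟨i, rfl⟩]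
  have h2 : ∀ f : E.Free, height f.1 ≤ 2 := fun f => by
    simp only [height]
    rw [if_neg f.2]
    split_ifs <;> omega
  have h3 : ∀ b, height (E.out b) = 3 + E.rk (E.out b) := fun b => if_pos ⟨b, rfl⟩
  have key : ∀ w, ∃ n : E.Param d, w ≠ f₀.1 →
      ((src n = w ∧ height (dst I n) < height w) ∨ (dst I n = w ∧ height (src n) < height w)) ∧
      ∀ i j, n ≠ Sum.inl (I i, j) := by
    intro w
    by_cases hw : w ∈ Set.range E.out
    · obtain ⟨b, rfl⟩ := hw
      refine ⟨Sum.inr (b, 0), fun _ => ⟨Or.inl ⟨rfl, ?_⟩, fun _ _ => Sum.inr_ne_inl⟩⟩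
      show height (E.tgt b 0) < _
      rw [h3]
      by_cases hw : E.tgt b 0 ∈ Set.range E.out
      · obtain ⟨b', hb'⟩ := hw
        have := E.rk_lt b 0
        rw [← hb'] at this ⊢
        rw [h3]
        omega
      · have := h2 ⟨_, hw⟩
        simp only at this
        omega
    · by_cases hw' : ∃ i, (I i).1 = w
      · obtain ⟨j, rfl⟩ := hw'
        refine ⟨Sum.inl (f₀, j), fun _ => ⟨Or.inr ⟨rfl, ?_⟩, fun i j' h => ?_⟩⟩
        · show height f₀.1 < _
          rw [h0, h1]
          exact one_pos
        · rw [Sum.inl.injEq, Prod.mk.injEq] at h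
          exact hf₀ i h.1.symm
      · refine ⟨Sum.inl (⟨w, hw⟩, 0), fun hw0 => ⟨Or.inl ⟨rfl, ?_⟩, fun i j' h => hw' ⟨i, ?_⟩⟩⟩
        · show height (I 0).1 < _
          rw [h1]
          simp only [height]
          rw [if_neg hw, if_neg hw0, if_neg hw']
          exact one_lt_two
        · rw [Sum.inl.injEq] at h
          exact (congrArg (fun x => x.1.1) h).symm
  choose edge hedge using key
  exact ⟨⟨I, hI, f₀.1, height, edge, fun w hw => (hedge w hw).1, fun w hw => (hedge w hw).2⟩⟩

section Quotient

variable [Finite B] [Finite W] {Y : Type*} {q : E.good d → Y} {N : ℕ}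

theorem irreducibleSpace_quot (hqs : Function.Surjective q) (hne : (E.good d).Nonempty) :
    @IrreducibleSpace Y (((affineSpace (E.Param d)).sub (E.good d)).quot q).top :=
  irreducibleSpace_of_surjective (isMorphism_quot _ _) hqs (irreducibleSpace_sub isOpen_good hne)

theorem Tree.isVariety_quot (t : E.Tree) (hd : 1 ≤ d) (hcard : d + 1 ≤ Nat.card E.Free)
    (hqs : Function.Surjective q) (hq : ∀ x y, q x = q y ↔ E.Rel x.1 y.1)
    (hN : N + (d + 1) ^ 2 + Nat.card W = Nat.card E.Free * (d + 1) + 2 * Nat.card B + 1) :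
    (((affineSpace (E.Param d)).sub (E.good d)).quot q).IsVariety ∧
      (((affineSpace (E.Param d)).sub (E.good d)).quot q).dim = N := by
  set O := ((affineSpace (E.Param d)).sub (E.good d)).quot q
  obtain ⟨I₀, hI₀⟩ := exists_frame_index hcard
  have hne : (E.good d).Nonempty :=
    ((t.gauge I₀ hI₀).good_inter_dom_nonempty hd).mono Set.inter_subset_left
  have : Nonempty Y := ⟨q ⟨_, hne.some_mem⟩⟩
  have hchart := fun I : {I : Fin (d + 1) → E.Free // Function.Injective I} =>
    (t.gauge I.1 I.2).exists_chart hqs hq ((t.gauge I.1 I.2).exists_equiv hN).some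
  choose U ξ hU hξ hUo hξreg hiso using hchart
  -- The tree parameters are coefficients and vanish nowhere on `good`, so only the frame has to be
  -- chosen; one exists by the spanning condition.
  have hcov : ∀ y, ∃ I, y ∈ U I := fun y => by
    obtain ⟨x, rfl⟩ := hqs y
    obtain ⟨h0, -, -, I, hI⟩ := good_iff.1 x.2
    exact ⟨⟨I, injective_of_det_ne_zero hI⟩, (hU _ x).2 ⟨hI, fun w _ => h0 _⟩⟩
  have hξ' : ∀ I y, y ∈ U I → frame I.1 (ξ I y) = 1 ∧
      (∀ w, w ≠ t.root → ξ I y (Sum.inr (t.edge w)) = 1) ∧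
      ∃ h : ξ I y ∈ E.good d, q ⟨_, h⟩ = y := fun I y hy => by
    obtain ⟨x, rfl⟩ := hqs y
    have hx := (hU I x).1 hy
    rw [hξ I x hx]
    refine ⟨?_, fun w hw => Gauge.normalize_edge hx hw, (Gauge.rel_normalize hx).mem_good x.2,
      ((hq x ⟨_, _⟩).2 (Gauge.rel_normalize hx)).symm⟩
    ext j i
    refine (Gauge.normalize_frame hx i j).trans ?_
    simp only [Matrix.one_apply, eq_comm]
  have heq : ∀ I J x y, x ∈ U I → y ∈ U J → (x = y ↔
      (∀ e, ξ I x (Sum.inr e) = ξ J y (Sum.inr e)) ∧ ∀ f i, ξ I x (Sum.inl (f, i)) =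
        ∑ j, ξ I x (Sum.inl (J.1 j, i)) * ξ J y (Sum.inl (f, j))) := fun I J x y hx hy => by
    obtain ⟨h1, h2, h3, h4⟩ := hξ' I x hx
    obtain ⟨h1', h2', h3', h4'⟩ := hξ' J y hy
    rw [← t.rel_iff h1 h1' h2 h2', ← hq ⟨_, h3⟩ ⟨_, h3'⟩, h4, h4']
  have hmain := isVariety_of_charts (O := O) (ι := Fin N) (irreducibleSpace_quot hqs hne)
    (isSeparated_of_functions fun x y hxy => ?_) (Set.range U) (Set.finite_range U)
    (fun y => (hcov y).elim fun I h => ⟨_, ⟨I, rfl⟩, h⟩)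
    (by rintro _ ⟨I, rfl⟩; exact ⟨hUo I, hiso I⟩)
  · simpa using hmain
  · obtain ⟨I, hx⟩ := hcov x
    obtain ⟨J, hy⟩ := hcov y
    rw [Ne, heq I J x y hx hy, not_and_or] at hxy
    rcases hxy with h | h
    · push Not at h
      obtain ⟨e, he⟩ := h
      refine ⟨U I, U J, Fin 2, inferInstance, ![fun x => ξ I x (Sum.inr e), fun _ => 1],
        ![fun _ => 1, fun y => -ξ J y (Sum.inr e)], hUo I, hUo J, hx, hy, ?_, ?_, ?_, ?_⟩
      · intro j
        fin_cases j
        exacts [hξreg I _, SpaceWithFunctions.const _ _ 1]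
      · intro j
        fin_cases j
        exacts [SpaceWithFunctions.const _ _ 1, (hξreg J _).neg]
      · simpa [← sub_eq_add_neg, sub_eq_zero] using he
      · intro z hz hz'
        simp [((heq I J z z hz hz').1 rfl).1 e]
    · push Not at h
      obtain ⟨f, i, h⟩ := h
      refine ⟨U I, U J, Option (Fin (d + 1)), inferInstance,
        fun o x => o.elim (-ξ I x (Sum.inl (f, i))) fun j => ξ I x (Sum.inl (J.1 j, i)),
        fun o y => o.elim 1 fun j => ξ J y (Sum.inl (f, j)), hUo I, hUo J, hx, hy, ?_, ?_, ?_, ?_⟩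
      · rintro (_ | j)
        exacts [(hξreg I _).neg, hξreg I _]
      · rintro (_ | j)
        exacts [SpaceWithFunctions.const _ _ 1, hξreg J _]
      · rw [Fintype.sum_option]
        simp only [Option.elim]
        rw [mul_one, neg_add_eq_sub]
        exact sub_ne_zero.2 (Ne.symm h)
      · intro z hz hz'
        rw [Fintype.sum_option]
        simp only [Option.elim]
        rw [mul_one, neg_add_eq_sub]
        exact sub_eq_zero.2 (((heq I J z z hz hz').1 rfl).2 f i).symm

theorem Gauge.exists_dense_variety (c : Gauge E d) (hd : 1 ≤ d)
    (hqs : Function.Surjective q) (hq : ∀ x y, q x = q y ↔ E.Rel x.1 y.1)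
    (hN : N + (d + 1) ^ 2 + Nat.card W = Nat.card E.Free * (d + 1) + 2 * Nat.card B + 1) :
    ∃ U : Set Y, IsOpen[(((affineSpace (E.Param d)).sub (E.good d)).quot q).top] U ∧
      @Dense _ (((affineSpace (E.Param d)).sub (E.good d)).quot q).top U ∧
      ((((affineSpace (E.Param d)).sub (E.good d)).quot q).sub U).IsVariety ∧
      ((((affineSpace (E.Param d)).sub (E.good d)).quot q).sub U).dim = N := by
  set O := ((affineSpace (E.Param d)).sub (E.good d)).quot q
  let := O.top
  obtain ⟨θ, h1, h2⟩ := c.good_inter_dom_nonempty hd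
  have : Nonempty Y := ⟨q ⟨θ, h1⟩⟩
  have : IrreducibleSpace Y := irreducibleSpace_quot hqs ⟨θ, h1⟩
  obtain ⟨U, -, hU, -, hUo, -, Ω, hΩ, hiso⟩ := c.exists_chart hqs hq (c.exists_equiv hN).some
  have hne : q ⟨θ, h1⟩ ∈ U := (hU _).2 h2
  have hvar := isVariety_sub hΩ (hiso.elim fun e _ => ⟨_, (e ⟨_, hne⟩).2⟩)
  -- A single non-empty chart suffices, being dense in an irreducible space.
  refine ⟨U, hUo, hUo.dense ⟨_, hne⟩, hiso.isVariety hvar.1, hiso.dim_eq.trans ?_⟩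
  simpa using hvar.2

end Quotient

end Elimination

/-! ### Diagrams and eliminations -/

namespace TCD

open SpaceWithFunctions

variable {B : Type*} [Fintype B] {n : ℕ} {T : TCD B n} {d : ℕ}

/-- The matched face of a crossing is solved for in terms of its other two neighbours, which have
lower rank in the acyclic matching. -/
theorem exists_elimination (hT : T.IsMinimal) : ∃ (E : Elimination B T.W) (σ : B → Fin 3),
    (∀ b, E.out b = T.nbr b (σ b)) ∧ (∀ b, E.tgt b 0 = T.nbr b (σ b + 1)) ∧
      ∀ b, E.tgt b 1 = T.nbr b (σ b + 2) := by
  obtain ⟨σ, ρ, h1, h2⟩ := hT.exists_acyclic_matching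
  have h3 : ∀ i : Fin 3, i + 1 ≠ i ∧ i + 2 ≠ i ∧ i + 1 ≠ i + 2 := by decide
  refine ⟨⟨fun b => T.nbr b (σ b), fun b => ![T.nbr b (σ b + 1), T.nbr b (σ b + 2)], ρ, h1,
    fun b j => ?_, fun b h => (h3 (σ b)).2.2 (hT.nbr_injective b h)⟩, σ, fun _ => rfl,
    fun _ => rfl, fun _ => rfl⟩
  fin_cases j
  exacts [h2 b _ (h3 _).1, h2 b _ (h3 _).2.1]

variable {E : Elimination B T.W} {σ : B → Fin 3}

/-- The configuration of points given by a configuration of vectors. -/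
def proj {W : Type*} (v : W → Fin (d + 1) → ℂ) (hv : ∀ w, v w ≠ 0) (w : W) :
    Projectivization ℂ (Fin (d + 1) → ℂ) :=
  Projectivization.mk ℂ (v w) (hv w)

theorem fin_three_cases (i j : Fin 3) : j = i ∨ j = i + 1 ∨ j = i + 2 := by
  revert i j
  decide

/-- The base index `i` will be the matched corner `σ b`, so the conditions at a crossing can be
written with `out` and `tgt`. -/
theorem injective_fin_three_iff {α : Type*} {f : Fin 3 → α} (i : Fin 3) : Function.Injective f ↔
    f (i + 1) ≠ f (i + 2) ∧ f i ≠ f (i + 1) ∧ f i ≠ f (i + 2) := by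
  have h3 : ∀ i : Fin 3, i + 1 ≠ i ∧ i + 2 ≠ i ∧ i + 1 ≠ i + 2 := by decide
  constructor
  · exact fun h => ⟨fun e => (h3 i).2.2 (h e), fun e => (h3 i).1 (h e).symm,
      fun e => (h3 i).2.1 (h e).symm⟩
  · rintro ⟨h1, h2, h4⟩ j k h
    have hk := fin_three_cases i k
    rcases fin_three_cases i j with rfl | rfl | rfl <;> rcases hk with rfl | rfl | rfl <;>
      first | rfl | exact (h1 h).elim | exact (h2 h).elim | exact (h4 h).elim |
        exact (h1 h.symm).elim | exact (h2 h.symm).elim | exact (h4 h.symm).elim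

theorem range_fin_three {α : Type*} (f : Fin 3 → α) (i : Fin 3) :
    Set.range f = {f i, f (i + 1), f (i + 2)} := by
  ext x
  constructor
  · rintro ⟨j, rfl⟩
    rcases fin_three_cases i j with rfl | rfl | rfl <;> simp
  · rintro (rfl | rfl | rfl) <;> exact ⟨_, rfl⟩

/-- Three distinct points on a line, in terms of representatives. -/
theorem distinct_collinear_iff {V : Type*} [AddCommGroup V] [Module ℂ V] [FiniteDimensional ℂ V]
    {x y z : V} (hx : x ≠ 0) (hy : y ≠ 0) (hz : z ≠ 0) :
    ((Projectivization.mk ℂ y hy ≠ Projectivization.mk ℂ z hz ∧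
      Projectivization.mk ℂ x hx ≠ Projectivization.mk ℂ y hy ∧
      Projectivization.mk ℂ x hx ≠ Projectivization.mk ℂ z hz) ∧
      Projectivization.IsCollinear {Projectivization.mk ℂ x hx, Projectivization.mk ℂ y hy,
        Projectivization.mk ℂ z hz}) ↔
    (¬ ∃ t : ℂ, z = t • y) ∧ ∃ k : Fin 2 → ℂ, (∀ j, k j ≠ 0) ∧ x = k 0 • y + k 1 • z := by
  simp only [Ne, Projectivization.mk_eq_mk_iff']
  constructor
  · rintro ⟨⟨h1, h2, h3⟩, M, -, hM, hsub⟩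
    have hyz : ¬ ∃ t : ℂ, z = t • y := by
      rintro ⟨t, rfl⟩
      have ht : t ≠ 0 := left_ne_zero_of_smul hz
      exact h1 ⟨t⁻¹, by rw [smul_smul, inv_mul_cancel₀ ht, one_smul]⟩
    have hmem : ∀ {u : V} (hu : u ≠ 0), Projectivization.mk ℂ u hu ∈ M →
        u ∈ Projectivization.Subspace.submodule M := fun hu h =>
      (Projectivization.Subspace.mem_submodule_iff M hu).2 h
    have hxM := hmem hx (hsub (by simp))
    have hyM := hmem hy (hsub (by simp))
    have hzM := hmem hz (hsub (by simp))
    have hli : LinearIndependent ℂ ![y, z] := by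
      rw [LinearIndependent.pair_iff' hy]
      exact fun t h => hyz ⟨t, h.symm⟩
    -- The line has vector dimension at most two and contains the independent `y` and `z`, so it is
    -- their span and contains `x`. A vanishing coefficient of `x` would make two of the points
    -- coincide.
    have hspan : Submodule.span ℂ {y, z} = Projectivization.Subspace.submodule M := by
      refine Submodule.eq_of_le_of_finrank_le ?_ ?_
      · rw [Submodule.span_le]
        rintro u (rfl | rfl) <;> assumption
      · have := finrank_span_eq_card hli
        rw [Matrix.range_cons, Matrix.range_cons, Matrix.range_empty, Set.union_empty,
          Set.singleton_union, Fintype.card_fin] at this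
        rw [this]
        exact hM
    rw [← hspan, Submodule.mem_span_pair] at hxM
    obtain ⟨a, b, hab⟩ := hxM
    refine ⟨hyz, ![a, b], ?_, by simp [hab]⟩
    intro j
    fin_cases j
    · rintro (rfl : a = 0)
      exact h3 ⟨b, by rw [← hab, zero_smul, zero_add]⟩
    · rintro (rfl : b = 0)
      exact h2 ⟨a, by rw [← hab, zero_smul, add_zero]⟩
  · rintro ⟨hyz, k, hk, rfl⟩
    refine ⟨⟨?_, ?_, ?_⟩, ?_⟩
    · rintro ⟨t, rfl⟩
      have ht : t ≠ 0 := left_ne_zero_of_smul hy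
      exact hyz ⟨t⁻¹, by rw [smul_smul, inv_mul_cancel₀ ht, one_smul]⟩
    · rintro ⟨t, ht⟩
      refine hyz ⟨(k 1)⁻¹ * (t - k 0), ?_⟩
      rw [← smul_smul, sub_smul, ht, add_sub_cancel_left, smul_smul, inv_mul_cancel₀ (hk 1),
        one_smul]
    · rintro ⟨t, ht⟩
      have h4 : k 0 • y = (t - k 1) • z := by rw [sub_smul, ht, add_sub_cancel_right]
      have h5 : t - k 1 ≠ 0 := by
        intro h0
        rw [h0, zero_smul] at h4
        exact smul_ne_zero (hk 0) hy h4
      exact hyz ⟨(t - k 1)⁻¹ * k 0, by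
        rw [← smul_smul, h4, smul_smul, inv_mul_cancel₀ h5, one_smul]⟩
    · refine ⟨(Submodule.span ℂ {y, z}).projectivization, ?_, ?_, ?_⟩
      · rw [OrderIso.apply_symm_apply]
        infer_instance
      · rw [OrderIso.apply_symm_apply]
        classical
        have := finrank_span_finset_le_card (R := ℂ) ({y, z} : Finset V)
        rw [Finset.coe_insert, Finset.coe_singleton] at this
        exact this.trans Finset.card_le_two
      · rintro _ (rfl | rfl | rfl)
        · exact (Submodule.mk_mem_projectivization_iff _ _).2
            (Submodule.mem_span_pair.2 ⟨_, _, rfl⟩)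
        · exact (Submodule.mk_mem_projectivization_iff _ _).2 (Submodule.subset_span (by simp))
        · exact (Submodule.mk_mem_projectivization_iff _ _).2 (Submodule.subset_span (by simp))

theorem isTCDMap_iff (hout : ∀ b, E.out b = T.nbr b (σ b))
    (htgt0 : ∀ b, E.tgt b 0 = T.nbr b (σ b + 1)) (htgt1 : ∀ b, E.tgt b 1 = T.nbr b (σ b + 2))
    {v : T.W → Fin (d + 1) → ℂ} (hv : ∀ w, v w ≠ 0) : T.IsTCDMap (proj v hv) ↔
      (∀ b, ∃ k : Fin 2 → ℂ, (∀ j, k j ≠ 0) ∧ v (E.out b) = ∑ j, k j • v (E.tgt b j)) ∧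
      ∀ b, ∃ r s, Elimination.minor v (E.tgt b 0) (E.tgt b 1) r s ≠ 0 := by
  have h1 : ∀ b, (∃ r s, Elimination.minor v (E.tgt b 0) (E.tgt b 1) r s ≠ 0) ↔
      ¬ ∃ t : ℂ, v (E.tgt b 1) = t • v (E.tgt b 0) := fun b => by
    rw [← Elimination.minor_eq_zero_iff (hv _)]
    push Not
    rfl
  rw [← forall_and]
  refine forall_congr' fun b => ?_
  rw [h1, and_comm (b := ¬ _), injective_fin_three_iff (σ b), range_fin_three _ (σ b)]
  simp only [Fin.sum_univ_two]
  rw [hout, htgt0, htgt1]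
  exact distinct_collinear_iff (hv _) (hv _) (hv _)

theorem span_free_eq_top_iff (v : T.W → Fin (d + 1) → ℂ) :
    Submodule.span ℂ (Set.range fun f : E.Free => v f.1) = ⊤ ↔
      ∃ I : Fin (d + 1) → E.Free, (Matrix.of fun i j => v (I j).1 i).det ≠ 0 := by
  have key : ∀ I : Fin (d + 1) → E.Free, (Matrix.of fun i j => v (I j).1 i).det ≠ 0 ↔
      LinearIndependent ℂ fun j => v (I j).1 := fun I => by
    rw [← isUnit_iff_ne_zero, ← Matrix.isUnit_iff_isUnit_det,
      ← Matrix.linearIndependent_cols_iff_isUnit]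
    rfl
  simp only [key]
  constructor
  · intro h
    obtain ⟨κ, a, -, h2, h3⟩ := exists_linearIndependent' ℂ fun f : E.Free => v f.1
    let b := Module.Basis.mk h3 (h2.trans h).ge
    have : Fintype κ := Module.Basis.fintypeIndexOfRankLtAleph0 b (Module.rank_lt_aleph0 _ _)
    have hcard : Fintype.card κ = Fintype.card (Fin (d + 1)) := by
      rw [← Module.finrank_eq_card_basis b, Module.finrank_fin_fun, Fintype.card_fin]
    exact ⟨fun i => a ((Fintype.equivOfCardEq hcard).symm i),
      h3.comp _ (Fintype.equivOfCardEq hcard).symm.injective⟩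
  · rintro ⟨I, hI⟩
    have := hI.span_eq_top_of_card_eq_finrank (by simp)
    rw [eq_top_iff, ← this]
    exact Submodule.span_mono (by rintro _ ⟨j, rfl⟩; exact ⟨_, rfl⟩)

theorem rank_proj_iff {v : T.W → Fin (d + 1) → ℂ} (hv : ∀ w, v w ≠ 0)
    (h : ∀ b, ∃ k : Fin 2 → ℂ, (∀ j, k j ≠ 0) ∧ v (E.out b) = ∑ j, k j • v (E.tgt b j)) :
    T.rank (proj v hv) = d ↔
      ∃ I : Fin (d + 1) → E.Free, (Matrix.of fun i j => v (I j).1 i).det ≠ 0 := by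
  -- Dependent vectors are combinations of earlier ones, so the free vectors alone span.
  have h1 : ⨆ w, (proj v hv w).submodule = Submodule.span ℂ (Set.range fun f : E.Free => v f.1) := by
    refine le_antisymm (iSup_le fun w => ?_) (Submodule.span_le.2 ?_)
    · rw [proj, Projectivization.submodule_mk, Submodule.span_singleton_le_iff_mem]
      induction w using E.induction with
      | free f => exact Submodule.subset_span ⟨f, rfl⟩
      | out b ih =>
        obtain ⟨k, -, hk⟩ := h b
        rw [hk]
        exact Submodule.sum_mem _ fun j _ => Submodule.smul_mem _ _ (ih j)
    · rintro _ ⟨f, rfl⟩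
      exact le_iSup (fun w => (proj v hv w).submodule) f.1 (Submodule.mem_span_singleton_self _)
  rw [← span_free_eq_top_iff, ← h1, rank]
  constructor
  · intro h2
    refine Submodule.eq_top_of_finrank_eq ?_
    rw [Module.finrank_fin_fun]
    omega
  · intro h2
    rw [h2, finrank_top, Module.finrank_fin_fun]
    push_cast
    ring

theorem proj_mem_maps_iff (hout : ∀ b, E.out b = T.nbr b (σ b))
    (htgt0 : ∀ b, E.tgt b 0 = T.nbr b (σ b + 1)) (htgt1 : ∀ b, E.tgt b 1 = T.nbr b (σ b + 2))
    {v : T.W → Fin (d + 1) → ℂ} (hv : ∀ w, v w ≠ 0) :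
    proj v hv ∈ T.maps d ↔ E.IsConfig v := by
  show T.IsTCDMap _ ∧ T.rank _ = _ ↔ _
  rw [isTCDMap_iff hout htgt0 htgt1]
  constructor
  · rintro ⟨⟨h1, h2⟩, h3⟩
    exact ⟨hv, h1, h2, (rank_proj_iff hv h1).1 h3⟩
  · exact fun h => ⟨⟨h.relation, h.minor_ne⟩, (rank_proj_iff hv h.relation).2 h.span⟩

theorem proj_mem_orbit_iff {W : Type*} {v v' : W → Fin (d + 1) → ℂ} (hv : ∀ w, v w ≠ 0)
    (hv' : ∀ w, v' w ≠ 0) :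
    proj v' hv' ∈ MulAction.orbit (Matrix.ProjGenLinGroup (Fin (d + 1)) ℂ) (proj v hv) ↔
      ∃ (μ : W → ℂ) (g : Matrix (Fin (d + 1)) (Fin (d + 1)) ℂ), (∀ w, μ w ≠ 0) ∧
        g.det ≠ 0 ∧ ∀ w, v' w = μ w • g.mulVec (v w) := by
  constructor
  · rintro ⟨g, hg⟩
    induction g using Matrix.ProjGenLinGroup.induction_on with
    | mk g =>
      have h : ∀ w, ∃ a : ℂˣ, a • g.1.mulVec (v w) = v' w := fun w =>
        (Projectivization.mk_eq_mk_iff ℂ _ _ _ _).1 (congrFun hg w).symm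
      choose μ hμ using h
      exact ⟨fun w => μ w, g.1, fun w => (μ w).ne_zero,
        ((Matrix.isUnit_iff_isUnit_det _).1 g.isUnit).ne_zero, fun w => (hμ w).symm⟩
  · rintro ⟨μ, g, hμ, hg, h⟩
    refine ⟨Matrix.ProjGenLinGroup.mk (Matrix.GeneralLinearGroup.mkOfDetNeZero g hg), ?_⟩
    exact funext fun w => ((Projectivization.mk_eq_mk_iff' ℂ _ _ _ _).2 ⟨μ w, (h w).symm⟩).symm

end TCD

/-! ### Homogeneous coordinates -/

namespace SpaceWithFunctions

variable {W : Type*} {d : ℕ}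

/-- The chosen representative is arbitrary up to a scalar, so only ratios of its coordinates can
serve as regular functions. -/
theorem rep_mk_div {v : Fin (d + 1) → ℂ} (hv : v ≠ 0) (i j : Fin (d + 1)) :
    (Projectivization.mk ℂ v hv).rep i / (Projectivization.mk ℂ v hv).rep j = v i / v j := by
  obtain ⟨a, ha⟩ := Projectivization.exists_smul_eq_mk_rep ℂ v hv
  rw [← ha]
  exact mul_div_mul_left _ _ a.ne_zero

theorem rep_mk_ne_zero_iff {v : Fin (d + 1) → ℂ} (hv : v ≠ 0) (j : Fin (d + 1)) :
    (Projectivization.mk ℂ v hv).rep j ≠ 0 ↔ v j ≠ 0 := by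
  obtain ⟨a, ha⟩ := Projectivization.exists_smul_eq_mk_rep ℂ v hv
  rw [← ha]
  exact mul_ne_zero_iff_left a.ne_zero

theorem isOpen_rep_ne_zero (w : W) (j : Fin (d + 1)) :
    IsOpen[(projectivePower W d).top] {P | (P w).rep j ≠ 0} := by
  have h := ((affineSpace_hasInverses (W × Fin (d + 1))).sub
    {v | ∀ w, (fun i => v (w, i)) ≠ 0}).isOpen_ne
    (@isOpen_univ _ ((affineSpace (W × Fin (d + 1))).sub _).top) (sub_regular_coord _ (w, j))
  show IsOpen[((affineSpace (W × Fin (d + 1))).sub _).top] (_ ⁻¹' _)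
  convert! h using 1
  ext v
  simp only [Set.mem_univ, true_and]
  exact rep_mk_ne_zero_iff _ j

theorem rep_div_regular (w : W) (i j : Fin (d + 1)) :
    (projectivePower W d).IsRegular {P | (P w).rep j ≠ 0} fun P => (P w).rep i / (P w).rep j := by
  have hA := (affineSpace_hasInverses (W × Fin (d + 1))).sub {v | ∀ w, (fun i => v (w, i)) ≠ 0}
  show ((affineSpace (W × Fin (d + 1))).sub {v | ∀ w, (fun i => v (w, i)) ≠ 0}).IsRegular _ _
  refine SpaceWithFunctions.congr _ (fun v hv => ?_) (SpaceWithFunctions.mul _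
    (sub_regular_coord _ (w, i)) (hA.inv (sub_regular_coord _ (w, j)) fun v hv => ?_))
  · exact (rep_mk_div (v.2 w) i j).symm
  · exact (rep_mk_ne_zero_iff (v.2 w) j).1 hv

end SpaceWithFunctions

open SpaceWithFunctions in
theorem Elimination.cramer_regular {X B W : Type*} {d : ℕ} {E : Elimination B W} {O : SpaceWithFunctions X}
    (hO : O.HasInverses) {U : Set X}
    {v : X → W → Fin (d + 1) → ℂ} (hv : ∀ w i, O.IsRegular U fun x => v x w i)
    {r s : B → Fin (d + 1)}
    (h : ∀ x ∈ U, ∀ b, minor (v x) (E.tgt b 0) (E.tgt b 1) (r b) (s b) ≠ 0)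
    (m : E.Param d) : O.IsRegular U fun x => E.cramer r s (v x) m := by
  have hm := minor_regular hv
  rcases m with ⟨f, i⟩ | ⟨b, j⟩
  · exact hv _ _
  · simp only [cramer, Sum.elim_inr]
    refine O.mul ?_ (hO.inv (hm _ _ _ _) fun x hx => h x hx b)
    fin_cases j
    exacts [hm _ _ _ _, hm _ _ _ _]

/-! ### The moduli space as a quotient of the good parameters -/

namespace TCD

open SpaceWithFunctions

variable {B : Type*} [Fintype B] {n : ℕ} {T : TCD B n} {d : ℕ} {E : Elimination B T.W}
  (hE : ∀ (v : T.W → Fin (d + 1) → ℂ) (hv : ∀ w, v w ≠ 0), proj v hv ∈ T.maps d ↔ E.IsConfig v)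

theorem proj_congr {W : Type*} {v v' : W → Fin (d + 1) → ℂ} (h : v = v') (hv : ∀ w, v w ≠ 0)
    (hv' : ∀ w, v' w ≠ 0) : proj v hv = proj v' hv' := by
  subst h
  rfl

/-- The class of the TCD map with given parameters. -/
def classOf (hE : ∀ (v : T.W → Fin (d + 1) → ℂ) (hv : ∀ w, v w ≠ 0),
    proj v hv ∈ T.maps d ↔ E.IsConfig v) (θ : E.good d) : T.Moduli d :=
  Quotient.mk _ ⟨proj (E.vec θ.1) θ.2.2.ne_zero, (hE _ _).2 θ.2.2⟩

theorem classOf_surjective : Function.Surjective (classOf hE) := by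
  intro y
  obtain ⟨⟨P, hP⟩, rfl⟩ := Quotient.exists_rep y
  have hv : ∀ w, (P w).rep ≠ 0 := fun w => (P w).rep_nonzero
  have h : proj (fun w => (P w).rep) hv = P := funext fun w => Projectivization.mk_rep _
  have hc := (hE _ hv).1 (by rw [h]; exact hP)
  obtain ⟨θ, hθ, e⟩ := hc.exists_good
  exact ⟨⟨θ, hθ⟩, congrArg (Quotient.mk _) (Subtype.ext ((proj_congr e _ hv).trans h))⟩

theorem classOf_eq_iff (x y : E.good d) :
    classOf hE x = classOf hE y ↔ E.Rel x.1 y.1 := by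
  rw [E.rel_iff y.2, ← proj_mem_orbit_iff x.2.2.ne_zero y.2.2.ne_zero, MulAction.mem_orbit_symm]
  exact Quotient.eq

/-- The moduli space as a quotient of the space of good parameters. -/
theorem moduli_isMorphism_id :
    IsMorphism (T.moduli d) (((affineSpace (E.Param d)).sub (E.good d)).quot (classOf hE)) id ∧
      IsMorphism (((affineSpace (E.Param d)).sub (E.good d)).quot (classOf hE)) (T.moduli d) id := by
  have hA := (affineSpace_hasInverses (E.Param d)).sub (E.good d)
  have hO : ((projectivePower T.W d).sub (T.maps d)).HasInverses :=
    (((affineSpace_hasInverses _).sub _).quot _).sub _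
  refine quot_of_sections hO ?_ fun x => ?_
  · have h1 : IsMorphism ((affineSpace (E.Param d)).sub (E.good d)) (projectivePower T.W d)
        fun θ => proj (E.vec θ.1) θ.2.2.ne_zero := by
      refine (isMorphism_quot _ _).comp (isMorphism_of_coord
        (S := {v : T.W × Fin (d + 1) → ℂ | ∀ w, (fun i => v (w, i)) ≠ 0})
        (φ := fun θ : E.good d => ⟨fun x => E.vec θ.1 x.1 x.2, fun w => θ.2.2.ne_zero w⟩) hA fun x => ?_)
      have := (isMorphism_val _ (E.good d)).2 Set.univ _
        (@isOpen_univ _ (zariski _)) (Elimination.vec_regular Set.univ x.1 x.2)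
      simpa using! this
    exact (isMorphism_quot _ _).comp (isMorphism_sub (S := T.maps d)
      (φ := fun θ : E.good d => ⟨proj (E.vec θ.1) θ.2.2.ne_zero, (hE _ _).2 θ.2.2⟩) h1)
  · let := ((projectivePower T.W d).sub (T.maps d)).top
    have hi : ∀ w, ∃ i, (x.1 w).rep i ≠ 0 := fun w => Function.ne_iff.1 (x.1 w).rep_nonzero
    choose i hi using hi
    -- A regular lift to vectors near `x`: each point is scaled so that a coordinate that is
    -- non-zero at `x` becomes `1`.
    let v : T.maps d → T.W → Fin (d + 1) → ℂ := fun P w j => (P.1 w).rep j / (P.1 w).rep (i w)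
    let U₀ : Set (T.maps d) := {P | ∀ w, (P.1 w).rep (i w) ≠ 0}
    have hU₀ : IsOpen U₀ := by
      have : U₀ = ⋂ w, Subtype.val ⁻¹' {P | (P w).rep (i w) ≠ 0} := by
        ext P
        simp [U₀]
      rw [this]
      exact isOpen_iInter_of_finite fun w =>
        (isMorphism_val _ (T.maps d)).1 _ (isOpen_rep_ne_zero w (i w))
    have hv : ∀ w j, ((projectivePower T.W d).sub (T.maps d)).IsRegular U₀ fun P => v P w j :=
      fun w j => SpaceWithFunctions.restrict _ (fun P hP => hP w)
        ((isMorphism_val _ (T.maps d)).2 _ _ (isOpen_rep_ne_zero w (i w))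
          (rep_div_regular w j (i w)))
    have hne : ∀ P ∈ U₀, ∀ w, v P w ≠ 0 := fun P hP w =>
      Function.ne_iff.2 ⟨i w, by simpa [v] using hP w⟩
    have hproj : ∀ P (hP : P ∈ U₀), proj (v P) (hne P hP) = P.1 := fun P hP => by
      ext1 w
      conv_rhs => rw [← (P.1 w).mk_rep]
      refine (Projectivization.mk_eq_mk_iff' ℂ _ _ _ _).2 ⟨((P.1 w).rep (i w))⁻¹, ?_⟩
      ext j
      simp only [v, Pi.smul_apply, smul_eq_mul]
      exact inv_mul_eq_div _ _
    have hconf : ∀ P (hP : P ∈ U₀), E.IsConfig (v P) := fun P hP =>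
      (hE _ (hne P hP)).1 (by rw [hproj P hP]; exact P.2)
    -- Rows whose minors are non-zero at `x` stay usable on an open set, where Cramer's rule yields
    -- the parameters as regular functions.
    choose r s hrs using (hconf x hi).minor_ne
    let U : Set (T.maps d) := {P | P ∈ U₀ ∧
      ∀ b, Elimination.minor (v P) (E.tgt b 0) (E.tgt b 1) (r b) (s b) ≠ 0}
    have hU : IsOpen U := by
      have : U = U₀ ∩ ⋂ b, {P | P ∈ U₀ ∧
          Elimination.minor (v P) (E.tgt b 0) (E.tgt b 1) (r b) (s b) ≠ 0} := by
        ext P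
        simp only [U, Set.mem_inter_iff, Set.mem_iInter, Set.mem_ofPred_eq]
        exact ⟨fun h => ⟨h.1, fun b => ⟨h.1, h.2 b⟩⟩, fun h => ⟨h.1, fun b => (h.2 b).2⟩⟩
      rw [this]
      exact hU₀.inter (isOpen_iInter_of_finite fun b =>
        hO.isOpen_ne hU₀ (Elimination.minor_regular hv _ _ _ _))
    refine ⟨U, fun P => E.cramer r s (v P), hU, ⟨hi, hrs⟩, fun m => ?_, fun P hP => ?_⟩
    · exact Elimination.cramer_regular hO (fun w j => SpaceWithFunctions.restrict _ (fun P hP => hP.1) (hv w j))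
        (fun P hP => hP.2) m
    · obtain ⟨h1, h2⟩ := Elimination.cramer_mem_good (hconf P hP.1) hP.2
      exact ⟨h1, congrArg (Quotient.mk _)
        (Subtype.ext ((proj_congr h2 _ (hne P hP.1)).trans (hproj P hP.1)))⟩

end TCD

/-! ### Connectedness and the number of free faces -/

namespace TCD

variable {B : Type*} [Fintype B] {n : ℕ} {T : TCD B n} {d : ℕ} {E : Elimination B T.W}
  {σ : B → Fin 3}

/-- Contracting each crossing to its matched face sends edges of the bipartite graph to edges or
single vertices of the elimination graph. -/
theorem connected_elimination_graph (hout : ∀ b, E.out b = T.nbr b (σ b))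
    (htgt0 : ∀ b, E.tgt b 0 = T.nbr b (σ b + 1)) (htgt1 : ∀ b, E.tgt b 1 = T.nbr b (σ b + 2))
    (h : T.graph.Connected) : E.graph.Connected := by
  let π : B ⊕ T.W → T.W := Sum.elim E.out id
  have hadj : ∀ b j, E.graph.Adj (E.out b) (E.tgt b j) := fun b j =>
    (SimpleGraph.fromRel_adj _ _ _).2
      ⟨fun e => (E.rk_lt b j).ne (congrArg E.rk e).symm, Or.inl ⟨b, j, rfl, rfl⟩⟩
  have hnbr : ∀ b i, E.graph.Reachable (E.out b) (T.nbr b i) := fun b i => by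
    rcases fin_three_cases (σ b) i with rfl | rfl | rfl
    · rw [← hout]
    · rw [← htgt0]
      exact (hadj b 0).reachable
    · rw [← htgt1]
      exact (hadj b 1).reachable
  have hstep : ∀ u v, T.graph.Adj u v → E.graph.Reachable (π u) (π v) := by
    intro u v huv
    obtain ⟨-, ⟨b, i, rfl, rfl⟩ | ⟨b, i, rfl, rfl⟩⟩ := (SimpleGraph.fromRel_adj _ _ _).1 huv
    exacts [hnbr b i, (hnbr b i).symm]
  have hwalk : ∀ u v, T.graph.Walk u v → E.graph.Reachable (π u) (π v) := fun u v p => by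
    induction p with
    | nil => rfl
    | cons h _ ih => exact (hstep _ _ h).trans ih
  have : Nonempty T.W := h.nonempty.map π
  exact ⟨fun w w' => (h.preconnected (Sum.inr w) (Sum.inr w')).elim (hwalk _ _)⟩

theorem card_free : Nat.card E.Free + Fintype.card B = Nat.card T.W := by
  classical
  rw [← Nat.card_eq_fintype_card, ← Nat.card_range_of_injective E.out_injective, add_comm,
    ← Nat.card_sum]
  exact Nat.card_congr (Equiv.sumCompl (· ∈ Set.range E.out))

end TCD

end

/-! ### The theorem for both cases -/

theorem mainTheorem9 {B : Type*} [Fintype B] {n : ℕ} (T : TCD B n) (hT : T.IsMinimal)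
    (d : ℕ) (hd : 1 ≤ d) (hdT : (d : ℤ) ≤ T.mrank) :
    (T.graph.Connected →
      (T.moduli d).IsVariety ∧
        ∃ N : ℕ, (T.moduli d).dim = N ∧
          (N : ℤ) = ((d : ℤ) - 1) * (T.mrank + 1) - ((d : ℤ) + 1) ^ 2 + 1 + Nat.card T.W) ∧
    ((d : ℤ) < T.mrank →
      ∃ U : Set (T.Moduli d), IsOpen[(T.moduli d).top] U ∧ @Dense _ (T.moduli d).top U ∧
        ((T.moduli d).sub U).IsVariety ∧
          ∃ N : ℕ, ((T.moduli d).sub U).dim = N ∧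
            (N : ℤ) = ((d : ℤ) - 1) * (T.mrank + 1) - ((d : ℤ) + 1) ^ 2 + 1 + Nat.card T.W) := by
  obtain ⟨E, σ, h0, h1, h2⟩ := TCD.exists_elimination hT
  have hE := fun (v : T.W → Fin (d + 1) → ℂ) (hv : ∀ w, v w ≠ 0) =>
    TCD.proj_mem_maps_iff h0 h1 h2 hv
  obtain ⟨hm, hm'⟩ := TCD.moduli_isMorphism_id hE
  have hqs := TCD.classOf_surjective hE
  have hq := TCD.classOf_eq_iff hE
  have hfree : Nat.card E.Free + Fintype.card B = Nat.card T.W := TCD.card_free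
  have hmrank : T.mrank + 1 = Nat.card E.Free := by
    rw [TCD.mrank]
    omega
  -- The number of slice coordinates becomes `D` after replacing `2|B|` by `2|W| - 2(mrank + 1)`.
  have hdim : ∀ N : ℕ, N + (d + 1) ^ 2 + Nat.card T.W =
      Nat.card E.Free * (d + 1) + 2 * Nat.card B + 1 →
      (N : ℤ) = ((d : ℤ) - 1) * (T.mrank + 1) - ((d : ℤ) + 1) ^ 2 + 1 + Nat.card T.W := by
    intro N hN
    rw [hmrank]
    rw [Nat.card_eq_fintype_card (α := B)] at hN
    zify at hN hfree
    linear_combination hN + 2 * hfree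
  refine ⟨fun hconn => ?_, fun hlt => ?_⟩
  · have hcard : d + 1 ≤ Nat.card E.Free := by omega
    have hconn' := TCD.connected_elimination_graph h0 h1 h2 hconn
    have hWfin : 1 < Nat.card T.W := by omega
    have : Nontrivial T.W := Finite.one_lt_card_iff_nontrivial.1 hWfin
    obtain ⟨t⟩ := E.nonempty_tree hconn'
    obtain ⟨I, hI⟩ := E.exists_frame_index hcard
    have hN := (t.gauge I hI).card_not_fixed
    obtain ⟨hvar, hdimeq⟩ := t.isVariety_quot hd hcard hqs hq hN
    have hiso := SpaceWithFunctions.isomorphic_of_id hm hm'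
    exact ⟨hiso.isVariety hvar, _, hiso.dim_eq.trans hdimeq, hdim _ hN⟩
  -- The strict inequality `d < mrank` provides the `d + 2` free faces of a projective frame.
  · obtain ⟨c⟩ := E.exists_gauge (d := d) (by omega)
    have hN := c.card_not_fixed
    obtain ⟨U, hU, hdense, hvar, hdimeq⟩ := c.exists_dense_variety hd hqs hq hN
    have hiso := SpaceWithFunctions.isomorphic_of_id (hm.sub_id U) (hm'.sub_id U)
    have htop : (T.moduli d).top = (((SpaceWithFunctions.affineSpace (E.Param d)).sub
        (E.good d)).quot (TCD.classOf hE)).top :=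
      TopologicalSpace.ext_iff.2 fun s => ⟨hm'.1 s, hm.1 s⟩
    rw [htop]
    exact ⟨U, hU, hdense, hiso.isVariety hvar, _, hiso.dim_eq.trans hdimeq, hdim _ hN⟩
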